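/- **Setting.** Fix $T>0$, $x_0\in\mathbb R^m$, a bounded set $U\subset\mathbb R^{m_u}$ (so $|u|\le M_u$ on $U$), dynamics $f(x,u)\in\mathbb R^m$, a jump map $g:\mathbb R^m\to\mathbb R^m$, a collision function $\psi:\mathbb R^m\to\mathbb R$, a terminal cost $\phi(x)$ and a running cost $L(x,u)$. The state $x$ of a control $u:[0,T]\to U$ satisfies $x(0)=x_0$ and $\dot x=f(x,u)$ between finitely many collision times in $(0,T)$; at a collision time $\gamma$, $\psi(x(\gamma^-))=0$ and $x(\gamma^+)=g(x(\gamma^-))$; and $\psi(x)>0$ at $\gamma^+$ and at all other times. The cost is $J(u)=\phi(x(T))+\int_0^T L(x,u)\,dt$. Let $H(x,\lambda,u)=\lambda^Tf(x,u)+L(x,u)$. A *two-piece control* is a function $u$ on $[0,T]$ with a breakpoint $\beta\in(0,T)$ that is Lipschitz on $[0,\beta)$ and on $(\beta,T]$ (its value at $\beta$ is irrelevant); $u(\beta^\pm)$ are its one-sided limits there, and $\|\dot u\|_\infty=\max\{\|\dot u\|_{L^\infty(0,\beta)},\|\dot u\|_{L^\infty(\beta,T)}\}$. For two-piece controls $v_1,v_2$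 with breakpoints $\beta_1,\beta_2$, $$d(v_1,v_2)=\max\{\|v_1-v_2\|_{L^\infty(0,\min\{\beta_1,\beta_2\})},\ \|v_1-v_2\|_{L^\infty(\max\{\beta_1,\beta_2\},T)},\ |\beta_1-\beta_2|\}.$$ If the state $x$ of a two-piece control $u$ (breakpoint $\beta$) has exactly one collision, at $\gamma$, a costate $\lambda$ is a solution of $\dot\lambda=-H_x^T(x,\lambda,u)$ on $(0,\gamma)$ and $(\gamma,T)$ with $\lambda(T)=\phi_x^T(x(T))$ and, for some $\eta\in\mathbb R$, writing $x^\pm=x(\gamma^\pm)$, $u^\pm=u(\beta^\pm)$, $\lambda^\pm=\lambda(\gamma^\pm)$, $$\lambda^{-T}=\lambda^{+T}g_x(x^-)+\eta\,\psi_x(x^-),$$ $$\lambda^{+T}g_x(x^-)f(x^-,u^-)-\lambda^{+T}f(x^+,u^+)+\eta\,\psi_x(x^-)f(x^-,u^-)+L(x^-,u^-)-L(x^+,u^+)=0 .$$ One step $u^k\mapsto u^{k+1}$ of the *vanilla MSA* takes the state $x^k$ of $u^k$ (with exactly one collision, at $\gamma^k$), a costate $\lambda^k$, and a two-piece control $u^{k+1}$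 with breakpoint $\gamma^k$ and $u^{k+1}(t)\in\arg\min_{v\in U}H(x^k(t),\lambda^k(t),v)$ for all $t\ne\gamma^k$. **Assumptions.** 1. There is an optimal solution $(x^*,u^*,\lambda^*)$: $u^*$ is a $U$-valued two-piece control of least cost among all measurable $U$-valued controls that have a state, its state $x^*$ has exactly one collision, at $\gamma^*$, which is the breakpoint of $u^*$, $\lambda^*$ is a costate, and $u^*(t)$ minimizes $H(x^*(t),\lambda^*(t),\cdot)$ over $U$ for all $t\ne\gamma^*$. 2. On $\mathbb R^m\times\overline U$: $|f(x',u')-f(x,u)|\le B_{f,x}|x'-x|+B_{f,u}|u'-u|$ and $|L(x',u')-L(x,u)|\le B_{L,x}|x'-x|+B_{L,u}|u'-u|$; $f$ and $L$ are differentiable in $x$; $f_x$ is Lipschitz in $(x,u)$; and $L_x$ is Lipschitz in $(x,u)$ on $\{|x|\le r\}\times\overline U$ for every $r$. Moreover $\phi$ is differentiable with Lipschitz $\phi_x$, $\psi$ is Lipschitz, and on some open set containing $\{\psi=0\}$, $\psi$ is $C^2$ with Lipschitz $\psi_x$, and $g$ is differentiable with $g,g_x$ Lipschitz. Finally $|\psi_x|=1$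 on $\{\psi=0\}$. 3. (Strong collision.) There are $a,b,K,S>0$ with $\psi(x^*(t))\ge b$ for $t<\gamma^*-b/K$, $\psi(x^*(t))\ge K(\gamma^*-t)$ for $\gamma^*-b/K\le t<\gamma^*$, $\psi(x^*(t))\ge a$ for $t>\gamma^*$ ($t\in[0,T]$), and $K\ge B_{f,u}\sup_{s\in[0,T],\,s\ne\gamma^*}|u^*(\gamma^{*-})-u^*(s)|+S$. 4. For all $(x,\lambda)$, $H(x,\lambda,\cdot)$ has a unique minimizer $h(x,\lambda)$ over $U$, and $h$ is differentiable and Lipschitz. **Contraction constants.** Let $R\ge0$. Call positive numbers $C_0,C_0',C_1$ with $K\le C_0C_0'$ *contraction constants for $R$* if the following holds for every $k\ge0$ and all $u^0,\dots,u^k$ generated by the vanilla MSA: if $u^0$ is a $U$-valued two-piece control with $\|\dot u^0\|_\infty\le R$ and $$d(u^0,u^*)\le\frac{K}{C_0'+\|\dot u^0\|_\infty},\tag{1}$$ and $d(u^i,u^*)\le C_0$ for $i\le k$, then the MSA step from $u^k$ can be carried out, and every resulting $u^{k+1}$ satisfies $d(u^{k+1},u^*)\le C_1\,d(u^k,u^*)$.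 **Theorem (Convergence of MSA).** Under Assumptions 1–4, for every $R\ge 0$: (a) there are contraction constants $C_0,C_0',C_1$ for $R$; (b) whenever $C_0,C_0',C_1$ are contraction constants for $R$ with $C_1<1$, and $u^0$ is a $U$-valued two-piece control with $\|\dot u^0\|_\infty\le R$ satisfying (1), the vanilla MSA started at $u^0$ can be carried out for all $k$, and every sequence $(u^k)$ it generates converges linearly to $u^*$ in $d$: $$d(u^{k+1},u^*)\le C_1\,d(u^k,u^*)\quad(k\ge0),\qquad d(u^k,u^*)\to0 .$$ -/

import Mathlib

open Set Filter Topology MeasureTheory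
open scoped NNReal ENNReal RealInnerProductSpace

noncomputable section

namespace HybridMSA

/-- Euclidean space `ℝⁿ`. -/
abbrev E (n : ℕ) : Type := EuclideanSpace ℝ (Fin n)

/-- The data of an optimal control problem with autonomous state jumps on `[0, T]`:
initial state `x0`, admissible control values `U`, dynamics `f`, jump map `g`,
collision detection function `ψ`, terminal cost `φ` and running cost `L`. -/
structure Problem (m mu : ℕ) where
  T : ℝ
  x0 : E m
  U : Set (E mu)
  f : E m → E mu → E m
  g : E m → E m
  ψ : E m → ℝ
  φ : E m → ℝ
  L : E m → E mu → ℝ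

/-- A control with two pieces and breakpoint `β ∈ (0, T)`: it is Lipschitz on `[0, β)` and on
`(β, T]`, so it extends to a Lipschitz function on each of the closed intervals `[0, β]`, `[β, T]`.
The value at `β` itself is irrelevant. -/
structure TwoPiece (T : ℝ) (n : ℕ) where
  toFun : ℝ → E n
  β : ℝ
  β_mem : β ∈ Ioo 0 T
  lip_left : ∃ C : ℝ≥0, LipschitzOnWith C toFun (Ico 0 β)
  lip_right : ∃ C : ℝ≥0, LipschitzOnWith C toFun (Ioc β T)

instance (T : ℝ) (n : ℕ) : CoeFun (TwoPiece T n) (fun _ => ℝ → E n) := ⟨TwoPiece.toFun⟩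

namespace TwoPiece

variable {T : ℝ} {n : ℕ}

/-- One-sided limit `v(β⁻)` at the breakpoint. -/
def left (v : TwoPiece T n) : E n := Function.leftLim v.toFun v.β

/-- One-sided limit `v(β⁺)` at the breakpoint. -/
def right (v : TwoPiece T n) : E n := Function.rightLim v.toFun v.β

end TwoPiece

/-- The norm `‖v‖` in `L^∞(a, b)`. -/
def normLinf {n : ℕ} (v : ℝ → E n) (a b : ℝ) : ℝ :=
  (eLpNorm v ⊤ (volume.restrict (Ioo a b))).toReal

/-- The larger of the `L^∞` norms of the time derivative of `v` on `(0, β)` and on `(β, T)`. -/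
def derivBound {T : ℝ} {n : ℕ} (v : TwoPiece T n) : ℝ :=
  max (normLinf (deriv v.toFun) 0 v.β) (normLinf (deriv v.toFun) v.β T)

/-- The semimetric `d(v₁, v₂)` between functions with two pieces. -/
def semidist {T : ℝ} {n : ℕ} (v₁ v₂ : TwoPiece T n) : ℝ :=
  max (max (normLinf (fun t => v₁ t - v₂ t) 0 (min v₁.β v₂.β))
      (normLinf (fun t => v₁ t - v₂ t) (max v₁.β v₂.β) T))
    |v₁.β - v₂.β|

section Dynamics

variable {m mu : ℕ}

/-- `x` is the state driven by the control `u`, and its collision times are exactly the elements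
of `Γ`: between collisions `x' = f(x, u)` (in integrated form), at a collision time `γ` one has
`ψ(x(γ⁻)) = 0`, `x(γ⁺) = g(x(γ⁻))`, and `ψ(x)` is positive at `γ⁺` and at all other times.
The value of `x` at a collision time itself is irrelevant. -/
structure IsState (P : Problem m mu) (u : ℝ → E mu) (Γ : Finset ℝ) (x : ℝ → E m) : Prop where
  times : ∀ γ ∈ Γ, γ ∈ Ioo 0 P.T
  init : x 0 = P.x0
  integrable : IntervalIntegrable (fun t => P.f (x t) (u t)) volume 0 P.T
  ode : ∀ s t, 0 ≤ s → s ≤ t → t ≤ P.T → (∀ γ ∈ Γ, γ ∉ Icc s t) →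
    x t = x s + ∫ τ in s..t, P.f (x τ) (u τ)
  zero : ∀ γ ∈ Γ, P.ψ (Function.leftLim x γ) = 0
  jump : ∀ γ ∈ Γ, Function.rightLim x γ = P.g (Function.leftLim x γ)
  pos_right : ∀ γ ∈ Γ, 0 < P.ψ (Function.rightLim x γ)
  pos : ∀ t ∈ Icc 0 P.T, t ∉ Γ → 0 < P.ψ (x t)

/-- The Hamiltonian `H(x, p, u) = pᵀ f(x, u) + L(x, u)`. -/
def Problem.H (P : Problem m mu) (x p : E m) (u : E mu) : ℝ :=
  ⟪p, P.f x u⟫ + P.L x u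

/-- `v` attains the minimum of `H(x, p, ·)` over `U`. -/
def IsHamMin (P : Problem m mu) (x p : E m) (v : E mu) : Prop :=
  v ∈ P.U ∧ ∀ w ∈ P.U, P.H x p v ≤ P.H x p w

/-- The jump condition of the costate: `pm`, `pp` are the costate before and after the collision,
`xm`, `xp` the state and `um`, `up` the control before and after the jump. The number `η` is
determined by the second equation, the variation of the collision time. -/
def CostateJump (P : Problem m mu) (pm pp xm xp : E m) (um up : E mu) : Prop :=
  ∃ η : ℝ,
    pm = ContinuousLinearMap.adjoint (fderiv ℝ P.g xm) pp + η • gradient P.ψ xm ∧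
    ⟪pp, fderiv ℝ P.g xm (P.f xm um)⟫ - ⟪pp, P.f xp up⟫ + η * ⟪gradient P.ψ xm, P.f xm um⟫
      + P.L xm um - P.L xp up = 0

/-- `p` is the costate of the two-piece control `u` whose state `x` has its only collision at `γ`:
`p' = -H_xᵀ` off `γ` (in integrated form), `p(T) = φ_xᵀ(x(T))`, and the jump condition at `γ`,
in which the one-sided limits of `u` are taken at the breakpoint of `u`. -/
structure IsCostate (P : Problem m mu) (u : TwoPiece P.T mu) (γ : ℝ) (x p : ℝ → E m) : Prop where
  terminal : p P.T = gradient P.φ (x P.T)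
  integrable : IntervalIntegrable
    (fun t => gradient (fun y => P.H y (p t) (u t)) (x t)) volume 0 P.T
  ode : ∀ s t, 0 ≤ s → s ≤ t → t ≤ P.T → γ ∉ Icc s t →
    p t = p s + ∫ τ in s..t, -gradient (fun y => P.H y (p τ) (u τ)) (x τ)
  jump : CostateJump P (Function.leftLim p γ) (Function.rightLim p γ)
    (Function.leftLim x γ) (Function.rightLim x γ) u.left u.right

/-- The two-piece control takes its values in `U` (the breakpoint excepted). -/
def TakesValuesIn {T : ℝ} (u : TwoPiece T mu) (U : Set (E mu)) : Prop :=
  ∀ t ∈ Icc 0 T, t ≠ u.β → u t ∈ U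

/-- One step of the method of successive approximations: solve forward for the state `x` (one
collision, at `γ`), backward for the costate `p`, and minimize the Hamiltonian pointwise. The
breakpoint of the new control `u'` is the collision time `γ`, where `x` and `p` jump. -/
def MSAStep (P : Problem m mu) (u u' : TwoPiece P.T mu) : Prop :=
  ∃ (γ : ℝ) (x p : ℝ → E m), IsState P u {γ} x ∧ IsCostate P u γ x p ∧ u'.β = γ ∧
    ∀ t ∈ Icc 0 P.T, t ≠ γ → IsHamMin P (x t) (p t) (u' t)

/-- The total cost of a control `u` with state `x`. -/
def Problem.cost (P : Problem m mu) (u : ℝ → E mu) (x : ℝ → E m) : ℝ :=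
  P.φ (x P.T) + ∫ t in 0..P.T, P.L (x t) (u t)

/-- `(u, x)` has least cost among all pairs of a measurable `U`-valued control and a state of it,
with any finite number of collisions. -/
def IsOptimal (P : Problem m mu) (u : ℝ → E mu) (x : ℝ → E m) : Prop :=
  ∀ (v : ℝ → E mu) (Γ : Finset ℝ) (y : ℝ → E m),
    AEStronglyMeasurable v (volume.restrict (Ioo 0 P.T)) →
    (∀ᵐ t ∂(volume.restrict (Ioo 0 P.T)), v t ∈ P.U) →
    IsState P v Γ y → P.cost u x ≤ P.cost v y

/-- `(x, u, p)` is an optimal solution that satisfies the hybrid minimum principle and has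
exactly one collision, at `γ`, which is also the breakpoint of `u`. -/
structure IsOptimalSolution (P : Problem m mu) (u : TwoPiece P.T mu) (γ : ℝ) (x p : ℝ → E m) :
    Prop where
  values : TakesValuesIn u P.U
  state : IsState P u {γ} x
  optimal : IsOptimal P u x
  breakpoint : u.β = γ
  costate : IsCostate P u γ x p
  minimal : ∀ t ∈ Icc 0 P.T, t ≠ γ → IsHamMin P (x t) (p t) (u t)

/-- Smoothness of the data. `Bfu` is the Lipschitz constant of `f` in the control. The functions
`f`, `L` and their derivatives in `x` are continuous up to the closure of `U`, which contains the
one-sided limits of controls. The jump map `g` and the derivatives of `ψ` only matter in a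
region around the collision manifold `{ψ = 0}`. -/
structure Smoothness (P : Problem m mu) (Bfu : ℝ) : Prop where
  f_lip : ∃ Bfx : ℝ, ∀ x x', ∀ u ∈ closure P.U, ∀ u' ∈ closure P.U,
    ‖P.f x' u' - P.f x u‖ ≤ Bfx * ‖x' - x‖ + Bfu * ‖u' - u‖
  f_diff : ∀ u ∈ closure P.U, Differentiable ℝ (fun x => P.f x u)
  fx_lip : ∃ B : ℝ, ∀ x x', ∀ u ∈ closure P.U, ∀ u' ∈ closure P.U,
    ‖fderiv ℝ (fun y => P.f y u') x' - fderiv ℝ (fun y => P.f y u) x‖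
      ≤ B * (‖x' - x‖ + ‖u' - u‖)
  L_lip : ∃ BLx BLu : ℝ, ∀ x x', ∀ u ∈ closure P.U, ∀ u' ∈ closure P.U,
    |P.L x' u' - P.L x u| ≤ BLx * ‖x' - x‖ + BLu * ‖u' - u‖
  L_diff : ∀ u ∈ closure P.U, Differentiable ℝ (fun x => P.L x u)
  Lx_lip : ∀ R : ℝ, ∃ B : ℝ, ∀ x x', ‖x‖ ≤ R → ‖x'‖ ≤ R →
    ∀ u ∈ closure P.U, ∀ u' ∈ closure P.U,
    ‖gradient (fun y => P.L y u') x' - gradient (fun y => P.L y u) x‖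
      ≤ B * (‖x' - x‖ + ‖u' - u‖)
  φ_diff : Differentiable ℝ P.φ
  φx_lip : ∃ B : ℝ, ∀ x x', ‖gradient P.φ x' - gradient P.φ x‖ ≤ B * ‖x' - x‖
  ψ_lip : ∃ B : ℝ, ∀ x x', |P.ψ x' - P.ψ x| ≤ B * ‖x' - x‖
  manifold : ∃ N : Set (E m), IsOpen N ∧ {x | P.ψ x = 0} ⊆ N ∧
    ContDiffOn ℝ 2 P.ψ N ∧ DifferentiableOn ℝ P.g N ∧
    (∃ B : ℝ, ∀ x ∈ N, ∀ x' ∈ N, ‖gradient P.ψ x' - gradient P.ψ x‖ ≤ B * ‖x' - x‖) ∧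
    (∃ B : ℝ, ∀ x ∈ N, ∀ x' ∈ N, ‖P.g x' - P.g x‖ ≤ B * ‖x' - x‖) ∧
    (∃ B : ℝ, ∀ x ∈ N, ∀ x' ∈ N, ‖fderiv ℝ P.g x' - fderiv ℝ P.g x‖ ≤ B * ‖x' - x‖)
  unit_normal : ∀ x, P.ψ x = 0 → ‖gradient P.ψ x‖ = 1

/-- The magnitude of variation of the control at the collision time `γ`. -/
def jumpMagnitude {T : ℝ} (u : TwoPiece T mu) (γ : ℝ) : ℝ :=
  sSup ((fun s => ‖Function.leftLim u.toFun γ - u s‖) '' (Icc 0 T \ {γ}))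

/-- The strong collision condition with factors `a, b, K, S` for a control `u` whose state `x` has
its only collision at `γ`. -/
structure StrongCollision (P : Problem m mu) (Bfu : ℝ) (u : TwoPiece P.T mu) (γ : ℝ)
    (x : ℝ → E m) (a b K S : ℝ) : Prop where
  a_pos : 0 < a
  b_pos : 0 < b
  K_pos : 0 < K
  S_pos : 0 < S
  far : ∀ t ∈ Icc 0 P.T, t < γ - b / K → b ≤ P.ψ (x t)
  near : ∀ t ∈ Icc 0 P.T, γ - b / K ≤ t → t < γ → K * (γ - t) ≤ P.ψ (x t)
  after : ∀ t ∈ Icc 0 P.T, γ < t → a ≤ P.ψ (x t)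
  margin : Bfu * jumpMagnitude u γ + S ≤ K

/-- For every `(x, p)` the Hamiltonian has a unique minimizer `h(x, p)` over `U`, and `h` is
differentiable and Lipschitz. -/
def RegularMinimizer (P : Problem m mu) : Prop :=
  ∃ (h : E m → E m → E mu) (Bh : ℝ),
    (∀ x p v, IsHamMin P x p v ↔ v = h x p) ∧
    Differentiable ℝ (fun z : E m × E m => h z.1 z.2) ∧
    ∀ x x' p p', ‖h x' p' - h x p‖ ≤ Bh * (‖x' - x‖ + ‖p' - p‖)

/-- Admissible initial guesses: `U`-valued two-piece controls whose derivative is bounded by `R`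
and which satisfy the closeness condition `d(u⁰, u*) ≤ K / (C₀' + ‖u̇⁰‖)`. -/
structure GoodGuess (P : Problem m mu) (ustar : TwoPiece P.T mu) (K R C₀' : ℝ)
    (u₀ : TwoPiece P.T mu) : Prop where
  values : TakesValuesIn u₀ P.U
  deriv_le : derivBound u₀ ≤ R
  close : semidist u₀ ustar ≤ K / (C₀' + derivBound u₀)

/-- `C₀, C₀', C₁` are contraction constants at `ustar` for initial guesses with derivative bounded
by `R`: if `u⁰, …, uᵏ` are iterates that start at a good guess and have distance at most `C₀`
to `ustar`, then the next iterate exists and is closer to `ustar` by the factor `C₁`.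
The relation `K ≤ C₀ C₀'` says that the closeness condition implies `d(u⁰, u*) ≤ C₀`; it can always
be reached by increasing `C₀'`. -/
structure ContractionConstants (P : Problem m mu) (ustar : TwoPiece P.T mu) (K R C₀ C₀' C₁ : ℝ) :
    Prop where
  C₀_pos : 0 < C₀
  C₀'_pos : 0 < C₀'
  C₁_pos : 0 < C₁
  K_le : K ≤ C₀ * C₀'
  contract : ∀ (k : ℕ) (u : ℕ → TwoPiece P.T mu),
    GoodGuess P ustar K R C₀' (u 0) →
    (∀ i < k, MSAStep P (u i) (u (i + 1))) →
    (∀ i ≤ k, semidist (u i) ustar ≤ C₀) →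
    (∃ u', MSAStep P (u k) u') ∧
      ∀ u', MSAStep P (u k) u' → semidist u' ustar ≤ C₁ * semidist (u k) ustar

end Dynamics

end HybridMSA

end

/-! By the minimum principle `u*` is a fixed point of the step: off the collision it equals `h(x*,
λ*)`. Part (a) therefore amounts to a Lipschitz estimate at `u*`, in `d`, for the composition
control ↦ state ↦ costate ↦ minimizer. No size is claimed for the constant; `C₁ < 1` is assumed in
(b), which is then an induction with geometric decay.

States of nearby controls jump at different times, so they are not uniformly close. Each state is
instead represented by two flows without jumps on all of `[0, T]`, one through `x₀` and one through
the point after the jump (`IsStatePair`); costates are treated likewise (`IsCostatePair`). These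
extensions can be compared in the supremum norm. Gronwall's inequality needs the controls to be
close only in `L¹`, and this follows from closeness in `d`: between the two breakpoints the controls
differ by a bounded amount on a set of length at most `d`.

The collision time is controlled by transversality. The lower bound `K(γ* - t)` on `ψ` forces normal
speed at most `-K` for `u*(γ*⁻)`, and the margin leaves at most `-S` for `u*(γ*⁺)`. Hence `ψ`
decreases at rate `S/2` near the collision point under any nearby control, even if its breakpoint
comes before or after the collision (`exists_descent`). So a collision exists, and its time is
Lipschitz in the control (`exists_collision_estimates`). The same lower bound on the normal speed
controls the quotient that defines `η`, hence the jump of the costate (`costateJump_isBigO`).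

One-sided limits of controls enter the jump condition, and `d` controls them only for pieces with a
common Lipschitz constant. All states, and all costates at transversal collisions, obey uniform
bounds, so `h(x, λ)` has a Lipschitz constant fixed in advance. The class of controls with this
constant (or the initial one, if larger) is preserved by the step (`exists_step_estimates`), which
permits the iteration. -/

noncomputable section

namespace HybridMSA

/-! ### Gronwall's inequality. -/

section Gronwall

/-- Gronwall's inequality in integral form. -/
theorem le_mul_exp_of_le_integral {v : ℝ → ℝ} {a b A K : ℝ} (hK : 0 ≤ K)
    (hv : ContinuousOn v (Icc a b))
    (h : ∀ t ∈ Icc a b, v t ≤ A + K * ∫ τ in a..t, v τ) :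
    ∀ t ∈ Icc a b, v t ≤ A * Real.exp (K * (t - a)) := by
  rcases lt_or_ge b a with hab | hab
  · intro t ht; exact absurd (ht.1.trans ht.2) (not_le.2 hab)
  -- The constant extension of `v` beyond `[a, b]` is continuous on the line, so its primitive is
  -- differentiable everywhere.
  set V : ℝ → ℝ := IccExtend hab ((Icc a b).domRestrict v) with hVdef
  have hV : Continuous V := (continuousOn_iff_continuous_domRestrict.1 hv).Icc_extend'
  have hVv : ∀ t ∈ Icc a b, V t = v t := fun t ht => by
    rw [hVdef, IccExtend_of_mem hab _ ht]; rfl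
  have hW : ∀ t, HasDerivAt (fun t => A + K * ∫ τ in a..t, V τ) (K * V t) t := fun t =>
    ((hV.integral_hasStrictDerivAt a t).hasDerivAt.const_mul K).const_add A
  have hint : ∀ t ∈ Icc a b, ∫ τ in a..t, v τ = ∫ τ in a..t, V τ := fun t ht =>
    intervalIntegral.integral_congr fun τ hτ => by
      rw [uIcc_of_le ht.1] at hτ
      exact (hVv τ ⟨hτ.1, hτ.2.trans ht.2⟩).symm
  intro t ht
  -- The differential inequality is applied to the right-hand side of `h`, which is differentiable,
  -- and not to `v` itself.
  have key := le_gronwallBound_of_liminf_deriv_right_le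
    (f := fun t => A + K * ∫ τ in a..t, V τ) (f' := fun t => K * V t) (δ := A) (K := K) (ε := 0)
    (a := a) (b := b) (fun s _ => (hW s).continuousAt.continuousWithinAt)
    (fun s _ r hr => (hW s).hasDerivWithinAt.liminf_right_slope_le hr) (by simp)
    (fun s hs => by
      have hs' := Ico_subset_Icc_self hs
      have := h s hs'
      rw [hint s hs', ← hVv s hs'] at this
      simpa using mul_le_mul_of_nonneg_left this hK) t ht
  rw [gronwallBound_ε0] at key
  exact (h t ht).trans (by rw [hint t ht]; exact key)

end Gronwall

/-! ### Primitives of integrable functions and their comparison. -/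

section Primitive

variable {V : Type*} [NormedAddCommGroup V] [NormedSpace ℝ V]

/-- `x` is a primitive of the integrable function `G` on `[a, b]`. -/
structure IsPrimOn (G x : ℝ → V) (a b : ℝ) : Prop where
  integrable : IntervalIntegrable G volume a b
  eq : ∀ t ∈ Icc a b, x t = x a + ∫ τ in a..t, G τ

namespace IsPrimOn

variable {G G' x x' : ℝ → V} {a b : ℝ}

theorem intervalIntegrable (h : IsPrimOn G x a b) {s t : ℝ} (hs : s ∈ Icc a b) (ht : t ∈ Icc a b) :
    IntervalIntegrable G volume s t :=
  h.integrable.mono_set (by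
    rw [uIcc_of_le (hs.1.trans hs.2)]; exact uIcc_subset_Icc hs ht)

theorem sub_eq (h : IsPrimOn G x a b) {s t : ℝ} (hs : s ∈ Icc a b) (ht : t ∈ Icc a b) :
    x t - x s = ∫ τ in s..t, G τ := by
  have ha : a ∈ Icc a b := ⟨le_rfl, hs.1.trans hs.2⟩
  rw [h.eq t ht, h.eq s hs, add_sub_add_left_eq_sub]
  rw [← intervalIntegral.integral_add_adjacent_intervals (h.intervalIntegrable ha hs)
    (h.intervalIntegrable hs ht), add_sub_cancel_left]

theorem mono (h : IsPrimOn G x a b) {c d : ℝ} (hc : c ∈ Icc a b) (hd : d ∈ Icc a b) :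
    IsPrimOn G x c d where
  integrable := h.intervalIntegrable hc hd
  eq t ht := by
    rw [← h.sub_eq hc ⟨hc.1.trans ht.1, ht.2.trans hd.2⟩, add_sub_cancel]

theorem congr_ae (h : IsPrimOn G x a b) (hab : a ≤ b) (hG : ∀ᵐ t, t ∈ Icc a b → G t = G' t) :
    IsPrimOn G' x a b where
  integrable := by
    refine h.integrable.congr_ae ?_
    rw [EventuallyEq, ae_restrict_iff' measurableSet_uIoc]
    filter_upwards [hG] with t ht hmem
    rw [uIoc_of_le hab] at hmem
    exact ht ⟨hmem.1.le, hmem.2⟩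
  eq t ht := by
    rw [h.eq t ht]
    congr 1
    refine intervalIntegral.integral_congr_ae ?_
    filter_upwards [hG] with s hs hmem
    rw [uIoc_of_le ht.1] at hmem
    exact hs ⟨hmem.1.le, hmem.2.trans ht.2⟩

theorem continuousOn (h : IsPrimOn G x a b) : ContinuousOn x (Icc a b) := by
  rcases lt_or_ge b a with hab | hab
  · simp [Icc_eq_empty (not_le.2 hab)]
  have := intervalIntegral.continuousOn_primitive_interval' h.integrable left_mem_uIcc
  rw [uIcc_of_le hab] at this
  exact (continuousOn_const.add this).congr h.eq

theorem norm_sub_le [CompleteSpace V] (h : IsPrimOn G x a b) {C : ℝ} (hC : ∀ t ∈ Icc a b, ‖G t‖ ≤ C) {s t : ℝ}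
    (hs : s ∈ Icc a b) (ht : t ∈ Icc a b) : ‖x t - x s‖ ≤ C * |t - s| := by
  rw [h.sub_eq hs ht]
  refine intervalIntegral.norm_integral_le_of_norm_le_const fun τ hτ => hC τ ?_
  exact uIcc_subset_Icc hs ht (uIoc_subset_uIcc hτ)

/-- Comparison of two primitives whose integrands satisfy a perturbed Lipschitz estimate. -/
theorem dist_le_of_left (h : IsPrimOn G x a b) (h' : IsPrimOn G' x' a b) {K ε : ℝ} {e : ℝ → ℝ}
    (hK : 0 ≤ K) (he : IntervalIntegrable e volume a b) (he0 : ∀ t, 0 ≤ e t)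
    (hε : ∫ t in a..b, e t ≤ ε)
    (hG : ∀ t ∈ Icc a b, ‖G t - G' t‖ ≤ K * ‖x t - x' t‖ + e t) :
    ∀ t ∈ Icc a b, ‖x t - x' t‖ ≤ (‖x a - x' a‖ + ε) * Real.exp (K * (b - a)) := by
  intro t ht
  have hab := ht.1.trans ht.2
  have hc : ContinuousOn (fun t => ‖x t - x' t‖) (Icc a b) := (h.continuousOn.sub h'.continuousOn).norm
  have hε0 : 0 ≤ ε := (intervalIntegral.integral_nonneg hab fun t _ => he0 t).trans hε
  refine (le_mul_exp_of_le_integral (A := ‖x a - x' a‖ + ε) hK hc ?_ t ht).trans ?_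
  · intro t ht
    have ha : a ∈ Icc a b := ⟨le_rfl, hab⟩
    have hci : IntervalIntegrable (fun t => ‖x t - x' t‖) volume a t :=
      (hc.mono (Icc_subset_Icc le_rfl ht.2)).intervalIntegrable_of_Icc ht.1
    have hei : IntervalIntegrable e volume a t :=
      he.mono_set (by rw [uIcc_of_le ht.1, uIcc_of_le hab]; exact Icc_subset_Icc le_rfl ht.2)
    have h1 : x t - x' t = (x a - x' a) + ∫ τ in a..t, (G τ - G' τ) := by
      rw [intervalIntegral.integral_sub (h.intervalIntegrable ha ht) (h'.intervalIntegrable ha ht),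
        h.eq t ht, h'.eq t ht]
      abel
    have h2 : ‖∫ τ in a..t, (G τ - G' τ)‖ ≤ ∫ τ in a..t, (K * ‖x τ - x' τ‖ + e τ) :=
      intervalIntegral.norm_integral_le_of_norm_le ht.1
        (Eventually.of_forall fun τ hτ => hG τ ⟨hτ.1.le, hτ.2.trans ht.2⟩)
        ((hci.const_mul K).add hei)
    rw [intervalIntegral.integral_add (hci.const_mul K) hei, intervalIntegral.integral_const_mul]
      at h2
    have h3 : ∫ τ in a..t, e τ ≤ ∫ τ in a..b, e τ :=
      intervalIntegral.integral_mono_interval le_rfl ht.1 ht.2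
        (Eventually.of_forall he0) he
    calc ‖x t - x' t‖ ≤ ‖x a - x' a‖ + ‖∫ τ in a..t, (G τ - G' τ)‖ := by
          rw [h1]; exact norm_add_le _ _
      _ ≤ _ := by linarith
  · gcongr
    exact ht.2

/-- Time reversal turns the forward Gronwall estimate into a backward one, needed for data given at
`T` or at the collision time. -/
theorem comp_neg (h : IsPrimOn G x a b) :
    IsPrimOn (fun t => -G (-t)) (fun t => x (-t)) (-b) (-a) where
  integrable := by
    exact ((IntervalIntegrable.iff_comp_neg (by finiteness)).1 h.integrable).symm.neg
  eq t ht := by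
    have hab : a ≤ b := by linarith [ht.1, ht.2]
    have := h.sub_eq (s := b) (t := -t) ⟨hab, le_rfl⟩ ⟨by linarith [ht.2], by linarith [ht.1]⟩
    rw [intervalIntegral.integral_neg, intervalIntegral.integral_comp_neg (fun t => G t), neg_neg,
      ← intervalIntegral.integral_symm, ← this]
    abel

theorem dist_le_of_right (h : IsPrimOn G x a b) (h' : IsPrimOn G' x' a b) {K ε : ℝ} {e : ℝ → ℝ}
    (hK : 0 ≤ K) (he : IntervalIntegrable e volume a b) (he0 : ∀ t, 0 ≤ e t)
    (hε : ∫ t in a..b, e t ≤ ε)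
    (hG : ∀ t ∈ Icc a b, ‖G t - G' t‖ ≤ K * ‖x t - x' t‖ + e t) :
    ∀ t ∈ Icc a b, ‖x t - x' t‖ ≤ (‖x b - x' b‖ + ε) * Real.exp (K * (b - a)) := by
  intro t ht
  have := dist_le_of_left h.comp_neg h'.comp_neg (K := K) (ε := ε) (e := fun t => e (-t)) hK
    ((IntervalIntegrable.iff_comp_neg (by finiteness)).1 he).symm (fun t => he0 _)
    (by rw [intervalIntegral.integral_comp_neg (fun t => e t), neg_neg, neg_neg]; exact hε)
    (fun t ht => by
      have := hG (-t) ⟨by linarith [ht.2], by linarith [ht.1]⟩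
      rwa [neg_sub_neg, norm_sub_rev]) (-t) ⟨by linarith [ht.2], by linarith [ht.1]⟩
  simpa [sub_eq_add_neg, add_comm] using this

/-- Comparison of two primitives whose values are close at some time `s`. -/
theorem dist_le (h : IsPrimOn G x a b) (h' : IsPrimOn G' x' a b) {K ε : ℝ} {e : ℝ → ℝ}
    (hK : 0 ≤ K) (he : IntervalIntegrable e volume a b) (he0 : ∀ t, 0 ≤ e t)
    (hε : ∫ t in a..b, e t ≤ ε)
    (hG : ∀ t ∈ Icc a b, ‖G t - G' t‖ ≤ K * ‖x t - x' t‖ + e t) {s t : ℝ} (hs : s ∈ Icc a b)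
    (ht : t ∈ Icc a b) :
    ‖x t - x' t‖ ≤ (‖x s - x' s‖ + ε) * Real.exp (K * (b - a)) := by
  have hab := hs.1.trans hs.2
  have ha : a ∈ Icc a b := ⟨le_rfl, hab⟩
  have hb : b ∈ Icc a b := ⟨hab, le_rfl⟩
  have hε0 : 0 ≤ ε := (intervalIntegral.integral_nonneg hab fun t _ => he0 t).trans hε
  have hei : ∀ {c d}, c ∈ Icc a b → d ∈ Icc a b → c ≤ d → IntervalIntegrable e volume c d ∧
      ∫ t in c..d, e t ≤ ε := fun {c d} hc hd hcd =>
    ⟨he.mono_set (by rw [uIcc_of_le hab]; exact uIcc_subset_Icc hc hd),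
      (intervalIntegral.integral_mono_interval hc.1 hcd hd.2 (Eventually.of_forall he0) he).trans hε⟩
  rcases le_total s t with hst | hst
  · refine ((h.mono hs hb).dist_le_of_left (h'.mono hs hb) hK (hei hs hb hs.2).1 he0
      (hei hs hb hs.2).2 (fun τ hτ => hG τ ⟨hs.1.trans hτ.1, hτ.2⟩) t ⟨hst, ht.2⟩).trans ?_
    gcongr
    exact hs.1
  · refine ((h.mono ha hs).dist_le_of_right (h'.mono ha hs) hK (hei ha hs hs.1).1 he0
      (hei ha hs hs.1).2 (fun τ hτ => hG τ ⟨hτ.1, hτ.2.trans hs.2⟩) t ⟨ht.1, hst⟩).trans ?_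
    gcongr
    exact hs.2

/-- The comparison estimate without perturbation is uniqueness for the differential equation. It
identifies states and costates with their jump-free extensions. -/
theorem eq_of_lipschitz {K : ℝ} (h : IsPrimOn G x a b) (h' : IsPrimOn G' x' a b) (hK : 0 ≤ K)
    (hG : ∀ t ∈ Icc a b, ‖G t - G' t‖ ≤ K * ‖x t - x' t‖) {s t : ℝ} (hs : s ∈ Icc a b)
    (ht : t ∈ Icc a b) (heq : x s = x' s) : x t = x' t := by
  have := h.dist_le h' (e := fun _ => 0) (ε := 0) hK intervalIntegrable_const (fun _ => le_rfl)
    (by simp) (by simpa using hG) hs ht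
  simpa [heq, sub_eq_zero] using this

end IsPrimOn

end Primitive

/-! ### Global solutions of differential equations measurable in time. -/

section Existence

variable {V : Type*} [NormedAddCommGroup V] [NormedSpace ℝ V]

/-- Integrating the weight `exp (l|s - t₀|)` from `t₀` gains a factor `1/l`. In the correspondingly
weighted norm the Picard operator contracts on the whole line at once. -/
theorem norm_integral_le_of_norm_le_exp {G : ℝ → V} {C l t₀ : ℝ} (hl : 0 < l) (hC : 0 ≤ C)
    (hG : ∀ s, ‖G s‖ ≤ C * Real.exp (l * |s - t₀|)) (t : ℝ) :
    ‖∫ s in t₀..t, G s‖ ≤ C / l * Real.exp (l * |t - t₀|) := by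
  have hcont : Continuous fun s => C * Real.exp (l * |s - t₀|) := by fun_prop
  have hCl : 0 ≤ C / l := by positivity
  rcases le_total t₀ t with h | h
  · refine (intervalIntegral.norm_integral_le_of_norm_le h (.of_forall fun s _ => hG s)
      (hcont.intervalIntegrable _ _)).trans ?_
    have : ∫ s in t₀..t, C * Real.exp (l * |s - t₀|)
        = C / l * Real.exp (l * (t - t₀)) - C / l * Real.exp (l * (t₀ - t₀)) := by
      refine intervalIntegral.integral_eq_sub_of_hasDerivAt_of_le h
        (f := fun s => C / l * Real.exp (l * (s - t₀))) (by fun_prop) (fun s hs => ?_)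
        (hcont.intervalIntegrable _ _)
      rw [abs_of_pos (sub_pos.2 hs.1)]
      convert ((((hasDerivAt_id s).sub_const t₀).const_mul l).exp).const_mul (C / l) using 1
      · rfl
      · rfl
      · have hl0 := hl.ne'
        simp only [id]
        field_simp
    rw [this, abs_of_nonneg (sub_nonneg.2 h)]
    simp [hCl]
  · rw [intervalIntegral.integral_symm, norm_neg]
    refine (intervalIntegral.norm_integral_le_of_norm_le h (.of_forall fun s _ => hG s)
      (hcont.intervalIntegrable _ _)).trans ?_
    have : ∫ s in t..t₀, C * Real.exp (l * |s - t₀|)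
        = -(C / l) * Real.exp (l * (t₀ - t₀)) - -(C / l) * Real.exp (l * (t₀ - t)) := by
      refine intervalIntegral.integral_eq_sub_of_hasDerivAt_of_le h
        (f := fun s => -(C / l) * Real.exp (l * (t₀ - s))) (by fun_prop) (fun s hs => ?_)
        (hcont.intervalIntegrable _ _)
      rw [abs_of_neg (sub_neg.2 hs.2), neg_sub]
      convert ((((hasDerivAt_id s).const_sub t₀).const_mul l).exp).const_mul (-(C / l)) using 1
      · rfl
      · rfl
      · have hl0 := hl.ne'
        simp only [id]
        field_simp
    rw [this, abs_of_nonpos (sub_nonpos.2 h), neg_sub]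
    simp [hCl]

/-- Global existence for an ordinary differential equation whose right-hand side is measurable in
time and uniformly Lipschitz in space. -/
theorem exists_primitive_of_lipschitz [CompleteSpace V] {F : ℝ → V → V} {K M : ℝ} (hK : 0 ≤ K)
    (hF : ∀ t x y, ‖F t x - F t y‖ ≤ K * ‖x - y‖) (hM : ∀ t, ‖F t 0‖ ≤ M)
    (hmeas : ∀ x : ℝ → V, Continuous x → AEStronglyMeasurable (fun t => F t (x t)) volume)
    (t₀ : ℝ) (v : V) :
    ∃ x : ℝ → V, Continuous x ∧ x t₀ = v ∧
      ∀ a b, a ≤ b → IsPrimOn (fun t => F t (x t)) x a b := by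
  have hM0 : 0 ≤ M := (norm_nonneg _).trans (hM 0)
  -- This makes `K / l ≤ 1/2`. The unknown is `z = x / W`, a bounded continuous function, so the
  -- plain supremum norm of `z` is the weighted norm of `x`; `Φ₀` below is the Picard operator
  -- rewritten for `z`.
  set l : ℝ := 2 * K + 1 with hl
  have hlpos : 0 < l := by positivity
  set W : ℝ → ℝ := fun t => Real.exp (l * |t - t₀|) with hW
  have hWc : Continuous W := by fun_prop
  have hW1 : ∀ t, 1 ≤ W t := fun t => Real.one_le_exp (by positivity)
  have hWpos : ∀ t, 0 < W t := fun t => Real.exp_pos _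
  have hbd : ∀ (x : ℝ → V) t, ‖F t (x t)‖ ≤ M + K * ‖x t‖ := fun x t => by
    have h1 := hF t (x t) 0
    rw [sub_zero] at h1
    have h2 := norm_sub_norm_le (F t (x t)) (F t 0)
    linarith [hM t]
  have hloc : ∀ x : ℝ → V, Continuous x → ∀ a b,
      IntervalIntegrable (fun t => F t (x t)) volume a b := fun x hx a b => by
    refine IntervalIntegrable.mono_fun (f := fun t => M + K * ‖x t‖)
      (Continuous.intervalIntegrable (by fun_prop) _ _) (hmeas x hx).restrict
      (.of_forall fun t => ?_)
    exact (hbd x t).trans (le_abs_self _)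
  have hscale : ∀ z : BoundedContinuousFunction ℝ V, Continuous fun t => W t • z t := fun z =>
    hWc.smul z.continuous
  let Φ₀ : BoundedContinuousFunction ℝ V → ℝ → V := fun z t =>
    (W t)⁻¹ • (v + ∫ s in t₀..t, F s (W s • z s))
  have hΦ₀c : ∀ z, Continuous (Φ₀ z) := fun z =>
    (hWc.inv₀ fun t => (hWpos t).ne').smul
      (continuous_const.add (intervalIntegral.continuous_primitive (hloc _ (hscale z)) t₀))
  have hΦ₀b : ∀ z t, ‖Φ₀ z t‖ ≤ ‖v‖ + (M + K * ‖z‖) / l := fun z t => by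
    have h1 := norm_integral_le_of_norm_le_exp (G := fun s => F s (W s • z s)) (C := M + K * ‖z‖)
      (t₀ := t₀) hlpos (by positivity) (fun s => by
        refine (hbd (fun s => W s • z s) s).trans ?_
        rw [norm_smul, Real.norm_of_nonneg (hWpos s).le]
        have := z.norm_coe_le_norm s
        have h3 : K * (W s * ‖z s‖) ≤ K * (W s * ‖z‖) := by gcongr
        have h4 : M ≤ M * W s := le_mul_of_one_le_right hM0 (hW1 s)
        calc M + K * (W s * ‖z s‖) ≤ M * W s + K * (W s * ‖z‖) := add_le_add h4 h3
          _ = _ := by ring) t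
    rw [norm_smul, norm_inv, Real.norm_of_nonneg (hWpos t).le, inv_mul_le_iff₀ (hWpos t)]
    refine (norm_add_le _ _).trans ?_
    have h5 : ‖v‖ ≤ W t * ‖v‖ := le_mul_of_one_le_left (norm_nonneg _) (hW1 t)
    calc _ ≤ W t * ‖v‖ + (M + K * ‖z‖) / l * W t := add_le_add h5 h1
      _ = _ := by ring
  let Φ : BoundedContinuousFunction ℝ V → BoundedContinuousFunction ℝ V := fun z =>
    BoundedContinuousFunction.ofNormedAddCommGroup (Φ₀ z) (hΦ₀c z) _ (hΦ₀b z)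
  have hcontr : ContractingWith (1 / 2) Φ := by
    refine ⟨by norm_num, LipschitzWith.of_dist_le_mul fun z z' => ?_⟩
    rw [BoundedContinuousFunction.dist_le (by positivity)]
    intro t
    have h1 := norm_integral_le_of_norm_le_exp
      (G := fun s => F s (W s • z s) - F s (W s • z' s)) (C := K * dist z z')
      (t₀ := t₀) hlpos (by positivity) (fun s => by
        refine (hF s _ _).trans ?_
        rw [← smul_sub, norm_smul, Real.norm_of_nonneg (hWpos s).le, ← dist_eq_norm]
        have := z.dist_coe_le_dist (g := z') s
        calc K * (W s * dist (z s) (z' s)) ≤ K * (W s * dist z z') := by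
              gcongr
          _ = _ := by ring) t
    rw [intervalIntegral.integral_sub (hloc _ (hscale z) _ _) (hloc _ (hscale z') _ _)] at h1
    change dist (Φ₀ z t) (Φ₀ z' t) ≤ _
    rw [dist_eq_norm, ← smul_sub, add_sub_add_left_eq_sub, norm_smul, norm_inv,
      Real.norm_of_nonneg (hWpos t).le, inv_mul_le_iff₀ (hWpos t)]
    refine h1.trans ?_
    have h2 : K * dist z z' / l ≤ 1 / 2 * dist z z' := by
      rw [div_le_iff₀ hlpos, hl]
      nlinarith [dist_nonneg (x := z) (y := z')]
    calc _ ≤ 1 / 2 * dist z z' * W t := by gcongr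
      _ = _ := by push_cast; ring
  have hfix : Φ (hcontr.fixedPoint Φ) = hcontr.fixedPoint Φ := hcontr.fixedPoint_isFixedPt
  set z := hcontr.fixedPoint Φ with hz
  have hx : ∀ t, W t • z t = v + ∫ s in t₀..t, F s (W s • z s) := fun t => by
    have : Φ₀ z t = z t := congrArg (fun y : BoundedContinuousFunction ℝ V => y t) hfix
    rw [← this, smul_inv_smul₀ (hWpos t).ne']
  refine ⟨fun t => W t • z t, hscale z, by simpa using hx t₀, fun a b _ => ⟨hloc _ (hscale z) _ _, ?_⟩⟩
  intro t _
  rw [hx t, hx a, add_assoc, intervalIntegral.integral_add_adjacent_intervals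
    (hloc _ (hscale z) _ _) (hloc _ (hscale z) _ _)]

end Existence

/-! ### Essential suprema and Lipschitz constants of controls. -/

section EssentialSupremum

variable {n : ℕ} {v : ℝ → E n} {a b C : ℝ}

theorem normLinf_nonneg (v : ℝ → E n) (a b : ℝ) : 0 ≤ normLinf v a b := ENNReal.toReal_nonneg

theorem normLinf_le (hC : 0 ≤ C) (h : ∀ t ∈ Ioo a b, ‖v t‖ ≤ C) : normLinf v a b ≤ C := by
  refine ENNReal.toReal_le_of_le_ofReal hC ?_
  rw [eLpNorm_exponent_top]
  exact eLpNormEssSup_le_of_ae_bound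
    ((ae_restrict_iff' measurableSet_Ioo).2 (.of_forall h))

/-- The bound `C` serves only to make the essential supremum finite, since `toReal` sends `⊤` to
`0`. -/
theorem ae_norm_le_normLinf (h : ∀ t ∈ Ioo a b, ‖v t‖ ≤ C) :
    ∀ᵐ t, t ∈ Ioo a b → ‖v t‖ ≤ normLinf v a b := by
  rw [← ae_restrict_iff' measurableSet_Ioo]
  have hfin : eLpNormEssSup v (volume.restrict (Ioo a b)) < ⊤ :=
    eLpNormEssSup_lt_top_of_ae_bound (C := C)
      ((ae_restrict_iff' measurableSet_Ioo).2 (.of_forall h))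
  filter_upwards [enorm_ae_le_eLpNormEssSup v (volume.restrict (Ioo a b))] with t ht
  rw [normLinf, eLpNorm_exponent_top, ← toReal_enorm]
  exact ENNReal.toReal_mono hfin.ne ht

/-- By continuity, a strict excess at one point would persist on a ball, which has positive measure.
-/
theorem norm_le_normLinf (h : ∀ t ∈ Ioo a b, ‖v t‖ ≤ C) (hc : ContinuousOn v (Ioo a b)) :
    ∀ t ∈ Ioo a b, ‖v t‖ ≤ normLinf v a b := by
  intro t ht
  by_contra! hlt
  have hopen : ∀ᶠ s in 𝓝 t, s ∈ Ioo a b ∧ normLinf v a b < ‖v s‖ :=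
    (isOpen_Ioo.eventually_mem ht).and
      ((hc.continuousAt (isOpen_Ioo.mem_nhds ht)).norm.eventually (lt_mem_nhds hlt))
  have hfreq := (ae_norm_le_normLinf h)
  obtain ⟨ε, hε, hball⟩ := Metric.eventually_nhds_iff_ball.1 hopen
  have hzero : volume (Metric.ball t ε) = 0 := by
    refine measure_mono_null (fun s hs => ?_) (ae_iff.1 hfreq)
    have := hball s hs
    simp only [mem_ofPred_eq]
    push Not
    exact this
  rw [Real.volume_ball] at hzero
  simp only [ENNReal.ofReal_eq_zero] at hzero
  linarith

end EssentialSupremum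

/-- A Lipschitz function on an interval whose derivative is bounded by `R` almost everywhere is
`R`-Lipschitz. -/
theorem norm_sub_le_of_ae_deriv_le {n : ℕ} {f : ℝ → E n} {a b R : ℝ} {C : ℝ≥0} (hab : a ≤ b)
    (hf : LipschitzOnWith C f (Icc a b)) (hR : ∀ᵐ t, t ∈ Ioo a b → ‖deriv f t‖ ≤ R) :
    ‖f b - f a‖ ≤ R * (b - a) := by
  -- Pairing `f` with its own increment `e` reduces the claim to the scalar fundamental theorem for
  -- absolutely continuous functions, which yields `‖e‖² ≤ ‖e‖ R (b - a)`.
  set e := f b - f a with he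
  have hlip : LipschitzOnWith (‖e‖₊ * C) (fun t => ⟪e, f t⟫) (uIcc a b) := by
    rw [uIcc_of_le hab]
    refine LipschitzOnWith.of_dist_le_mul fun s hs t ht => ?_
    rw [Real.dist_eq, ← inner_sub_right]
    refine (abs_real_inner_le_norm _ _).trans ?_
    have := hf.norm_sub_le hs ht
    rw [Real.dist_eq, NNReal.coe_mul, coe_nnnorm, mul_assoc]
    gcongr
    simpa using this
  have hftc := hlip.absolutelyContinuousOnInterval.integral_deriv_eq_sub
  have hdiff : ∀ᵐ t, t ∈ Icc a b → DifferentiableWithinAt ℝ f (Icc a b) t :=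
    hf.ae_differentiableWithinAt_of_mem
  have hbound : ‖∫ t in a..b, deriv (fun t => ⟪e, f t⟫) t‖ ≤ ‖e‖ * R * |b - a| := by
    refine intervalIntegral.norm_integral_le_of_norm_le_const_ae ?_
    have hne : ∀ᵐ t : ℝ, t ≠ b := by simp [ae_iff, measure_singleton]
    filter_upwards [hdiff, hR, hne] with t h1 h2 h3 h4
    rw [uIoc_of_le hab] at h4
    have h5 : t ∈ Ioo a b := ⟨h4.1, lt_of_le_of_ne h4.2 h3⟩
    have h6 : DifferentiableAt ℝ f t :=
      (h1 (Ioo_subset_Icc_self h5)).differentiableAt (Icc_mem_nhds h5.1 h5.2)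
    have h7 : deriv (fun t => ⟪e, f t⟫) t = ⟪e, deriv f t⟫ := by
      have := (hasDerivAt_const t e).inner ℝ h6.hasDerivAt
      simpa using this.deriv
    rw [h7]
    exact (norm_inner_le_norm _ _).trans (by gcongr; exact h2 h5)
  rw [hftc, ← inner_sub_right, ← he, real_inner_self_eq_norm_sq, abs_of_nonneg (sub_nonneg.2 hab),
    Real.norm_of_nonneg (by positivity)] at hbound
  -- Division by `‖e‖` fails for `e = 0`. Then `0 ≤ R` is needed when `a < b`, and it follows from
  -- any point where the derivative bound holds.
  rcases eq_or_lt_of_le (norm_nonneg e) with h0 | h0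
  · rw [← h0]
    rcases eq_or_lt_of_le hab with rfl | hlt
    · simp
    · have : ∃ t ∈ Ioo a b, ‖deriv f t‖ ≤ R := by
        by_contra! hcon
        have hz : volume (Ioo a b) = 0 :=
          measure_mono_null (fun t ht => by
            simp only [mem_ofPred_eq]
            push Not
            exact ⟨ht, hcon t ht⟩) (ae_iff.1 hR)
        rw [Real.volume_Ioo, ENNReal.ofReal_eq_zero] at hz
        linarith
      obtain ⟨t, _, ht⟩ := this
      exact mul_nonneg ((norm_nonneg _).trans ht) (sub_nonneg.2 hab)
  · refine le_of_mul_le_mul_left ?_ h0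
    linarith

/-- Trades the unspecified constant `C` for the bound on the derivative. The set `s` may contain
either endpoint because the pieces of a control live on half-open intervals. -/
theorem lipschitzOnWith_of_normLinf_deriv_le {n : ℕ} {f : ℝ → E n} {a b R : ℝ} {C : ℝ≥0}
    {s : Set ℝ} (hs : s.OrdConnected) (hsub : Ioo a b ⊆ s) (hsub' : s ⊆ Icc a b)
    (hf : LipschitzOnWith C f s) (hR : normLinf (deriv f) a b ≤ R) :
    LipschitzOnWith R.toNNReal f s := by
  have hderiv : ∀ t ∈ Ioo a b, ‖deriv f t‖ ≤ C := fun t ht =>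
    norm_deriv_le_of_lipschitzOn (mem_of_superset (isOpen_Ioo.mem_nhds ht) hsub) hf
  have hae := ae_norm_le_normLinf hderiv
  have key : ∀ x ∈ s, ∀ y ∈ s, x ≤ y → ‖f y - f x‖ ≤ R * (y - x) := fun x hx y hy hxy => by
    refine norm_sub_le_of_ae_deriv_le hxy (hf.mono (hs.out hx hy)) ?_
    filter_upwards [hae] with t ht hmem
    exact (ht ⟨(hsub' hx).1.trans_lt hmem.1, hmem.2.trans_le (hsub' hy).2⟩).trans hR
  have hR0 : 0 ≤ R := (normLinf_nonneg _ _ _).trans hR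
  refine LipschitzOnWith.of_dist_le_mul fun x hx y hy => ?_
  rw [Real.coe_toNNReal _ hR0, dist_eq_norm, Real.dist_eq]
  rcases le_total x y with h | h
  · rw [norm_sub_rev, abs_sub_comm, abs_of_nonneg (sub_nonneg.2 h)]
    exact key x hx y hy h
  · rw [abs_of_nonneg (sub_nonneg.2 h)]
    exact key y hy x hx h

/-- A Lipschitz function on a dense subset `s` of `[a, b]` extends to the line with the same
Lipschitz constant and with values in the closure of its range. -/
theorem exists_lipschitzWith_extension {n : ℕ} {f : ℝ → E n} {a b : ℝ} {R : ℝ≥0} {s : Set ℝ}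
    (hab : a ≤ b) (hs : closure s = Icc a b) (hf : LipschitzOnWith R f s) :
    ∃ g : ℝ → E n, LipschitzWith R g ∧ (∀ t ∈ s, f t = g t) ∧ ∀ t, g t ∈ closure (f '' s) := by
  obtain ⟨g, hg, hfg⟩ := hf.extend_finite_dimension
  have hgs : LipschitzOnWith R g (closure s) :=
    LipschitzOnWith.closure hg.continuous.continuousOn
      (fun x hx y hy => by rw [← hfg hx, ← hfg hy]; exact hf hx hy)
  rw [hs] at hgs
  -- The finite-dimensional extension `g` may have a larger constant off `closure s`. Composing with
  -- the projection onto `[a, b]` restores `R` and keeps the values in the closure of the range.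
  refine ⟨fun t => g (projIcc a b hab t), fun x y => ?_, fun t ht => ?_, fun t => ?_⟩
  · refine (hgs (projIcc a b hab x).2 (projIcc a b hab y).2).trans ?_
    gcongr
    have := LipschitzWith.projIcc hab x y
    rwa [ENNReal.coe_one, one_mul] at this
  · have : t ∈ Icc a b := hs ▸ subset_closure ht
    dsimp only
    rw [projIcc_of_mem hab this, hfg ht]
  · have h1 : (projIcc a b hab t : ℝ) ∈ closure s := by rw [hs]; exact (projIcc a b hab t).2
    rw [hfg.image_eq]
    exact image_closure_subset_closure_image hg.continuous (mem_image_of_mem g h1)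

theorem leftLim_eq_of_eqOn {X : Type*} [TopologicalSpace X] [T2Space X] {f g : ℝ → X} {a b : ℝ}
    (hab : a < b) (hg : ContinuousAt g b) (h : ∀ t ∈ Ico a b, f t = g t) :
    Function.leftLim f b = g b := by
  refine leftLim_eq_of_tendsto ((hg.tendsto.mono_left nhdsWithin_le_nhds).congr' ?_)
  filter_upwards [Ico_mem_nhdsLT hab] with t ht using (h t ht).symm

theorem rightLim_eq_of_eqOn {X : Type*} [TopologicalSpace X] [T2Space X] {f g : ℝ → X} {a b : ℝ}
    (hab : a < b) (hg : ContinuousAt g a) (h : ∀ t ∈ Ioc a b, f t = g t) :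
    Function.rightLim f a = g a := by
  refine rightLim_eq_of_tendsto ((hg.tendsto.mono_left nhdsWithin_le_nhds).congr' ?_)
  filter_upwards [Ioc_mem_nhdsGT hab] with t ht using (h t ht).symm

/-! ### Two-piece controls, their Lipschitz extensions, and gluing. -/

namespace TwoPiece

variable {T : ℝ} {n : ℕ}

/-- Both pieces of `u` are `R`-Lipschitz. -/
structure IsLipschitz (u : TwoPiece T n) (R : ℝ≥0) : Prop where
  left : LipschitzOnWith R u (Ico 0 u.β)
  right : LipschitzOnWith R u (Ioc u.β T)

theorem IsLipschitz.mono {u : TwoPiece T n} {R R' : ℝ≥0} (h : u.IsLipschitz R) (hR : R ≤ R') :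
    u.IsLipschitz R' :=
  ⟨h.left.weaken hR, h.right.weaken hR⟩

theorem isLipschitz_of_derivBound_le {u : TwoPiece T n} {R : ℝ} (h : derivBound u ≤ R) :
    u.IsLipschitz R.toNNReal := by
  obtain ⟨C, hC⟩ := u.lip_left
  obtain ⟨C', hC'⟩ := u.lip_right
  exact ⟨lipschitzOnWith_of_normLinf_deriv_le ordConnected_Ico Ioo_subset_Ico_self
      Ico_subset_Icc_self hC ((le_max_left _ _).trans h),
    lipschitzOnWith_of_normLinf_deriv_le ordConnected_Ioc Ioo_subset_Ioc_self
      Ioc_subset_Icc_self hC' ((le_max_right _ _).trans h)⟩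

theorem exists_isLipschitz (u : TwoPiece T n) : ∃ R, u.IsLipschitz R := by
  obtain ⟨C, hC⟩ := u.lip_left
  obtain ⟨C', hC'⟩ := u.lip_right
  exact ⟨max C C', hC.weaken (le_max_left _ _), hC'.weaken (le_max_right _ _)⟩

/-- `uL` and `uR` are Lipschitz extensions to the line of the two pieces of `u`, with values in the
closure of `U`. -/
structure IsExtension (u : TwoPiece T n) (U : Set (E n)) (R : ℝ≥0) (uL uR : ℝ → E n) : Prop where
  lipL : LipschitzWith R uL
  lipR : LipschitzWith R uR
  memL : ∀ t, uL t ∈ closure U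
  memR : ∀ t, uR t ∈ closure U
  eqL : ∀ t ∈ Ico 0 u.β, u t = uL t
  eqR : ∀ t ∈ Ioc u.β T, u t = uR t

theorem IsLipschitz.exists_isExtension {u : TwoPiece T n} {R : ℝ≥0} (h : u.IsLipschitz R)
    {U : Set (E n)} (hU : TakesValuesIn u U) : ∃ uL uR, u.IsExtension U R uL uR := by
  have hβ := u.β_mem
  obtain ⟨uL, h1, h2, h3⟩ := exists_lipschitzWith_extension hβ.1.le (closure_Ico hβ.1.ne) h.left
  obtain ⟨uR, h4, h5, h6⟩ := exists_lipschitzWith_extension hβ.2.le (closure_Ioc hβ.2.ne) h.right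
  refine ⟨uL, uR, h1, h4, fun t => closure_mono ?_ (h3 t), fun t => closure_mono ?_ (h6 t), h2, h5⟩
  · rintro _ ⟨s, hs, rfl⟩
    exact hU s ⟨hs.1, hs.2.le.trans hβ.2.le⟩ hs.2.ne
  · rintro _ ⟨s, hs, rfl⟩
    exact hU s ⟨hβ.1.le.trans hs.1.le, hs.2⟩ hs.1.ne'

namespace IsExtension

variable {u : TwoPiece T n} {U : Set (E n)} {R : ℝ≥0} {uL uR : ℝ → E n}

theorem left_eq (h : u.IsExtension U R uL uR) : u.left = uL u.β :=
  leftLim_eq_of_eqOn u.β_mem.1 h.lipL.continuous.continuousAt h.eqL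

theorem right_eq (h : u.IsExtension U R uL uR) : u.right = uR u.β :=
  rightLim_eq_of_eqOn u.β_mem.2 h.lipR.continuous.continuousAt h.eqR

end IsExtension

/-- The control with pieces `uL`, `uR` and breakpoint `β`, defined on the whole line. -/
def glue (uL uR : ℝ → E n) (β t : ℝ) : E n := if t < β then uL t else uR t

theorem glue_of_lt {uL uR : ℝ → E n} {β t : ℝ} (h : t < β) : glue uL uR β t = uL t := if_pos h

theorem glue_of_le {uL uR : ℝ → E n} {β t : ℝ} (h : β ≤ t) : glue uL uR β t = uR t :=
  if_neg (not_lt.2 h)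

theorem leftLim_glue {y z : ℝ → E n} {γ : ℝ} (hγ : 0 < γ) (hy : Continuous y) :
    Function.leftLim (glue y z γ) γ = y γ :=
  leftLim_eq_of_eqOn hγ hy.continuousAt fun _ ht => glue_of_lt ht.2

theorem rightLim_glue {y z : ℝ → E n} {γ : ℝ} (hγ : γ < T) (hz : Continuous z) :
    Function.rightLim (glue y z γ) γ = z γ :=
  rightLim_eq_of_eqOn hγ hz.continuousAt fun _ ht => glue_of_le ht.1.le

theorem measurable_glue {uL uR : ℝ → E n} (hL : Continuous uL) (hR : Continuous uR) (β : ℝ) :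
    Measurable (glue uL uR β) :=
  Measurable.ite measurableSet_Iio hL.measurable hR.measurable

variable {u v : TwoPiece T n} {U : Set (E n)} {R R' : ℝ≥0} {uL uR vL vR : ℝ → E n}

theorem IsExtension.glue_eq (h : u.IsExtension U R uL uR) {t : ℝ} (ht : t ∈ Icc 0 T)
    (hne : t ≠ u.β) : glue uL uR u.β t = u t := by
  rcases lt_or_gt_of_ne hne with hlt | hlt
  · rw [glue_of_lt hlt, h.eqL t ⟨ht.1, hlt⟩]
  · rw [glue_of_le hlt.le, h.eqR t ⟨hlt, ht.2⟩]

theorem IsExtension.glue_mem (h : u.IsExtension U R uL uR) (t : ℝ) :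
    glue uL uR u.β t ∈ closure U := by
  rcases lt_or_ge t u.β with hlt | hlt
  · rw [glue_of_lt hlt]; exact h.memL t
  · rw [glue_of_le hlt]; exact h.memR t

theorem semidist_nonneg (u v : TwoPiece T n) : 0 ≤ semidist u v :=
  (abs_nonneg _).trans (le_max_right _ _)

theorem abs_sub_le_semidist (u v : TwoPiece T n) : |u.β - v.β| ≤ semidist u v := le_max_right _ _

/-- Continuity of the extensions upgrades the essential bound to every point of the open interval,
and passing to the closure includes the earlier breakpoint. That endpoint gives access to the
one-sided limits. -/
theorem IsExtension.dist_left_le (hu : u.IsExtension U R uL uR) (hv : v.IsExtension U R' vL vR)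
    {t : ℝ} (ht : t ∈ Icc 0 (min u.β v.β)) : ‖uL t - vL t‖ ≤ semidist u v := by
  have hpos : 0 < min u.β v.β := lt_min u.β_mem.1 v.β_mem.1
  have hc : Continuous fun t => uL t - vL t := hu.lipL.continuous.sub hv.lipL.continuous
  have heq : ∀ t ∈ Ioo 0 (min u.β v.β), u t - v t = uL t - vL t := fun t ht => by
    rw [hu.eqL t ⟨ht.1.le, ht.2.trans_le (min_le_left _ _)⟩,
      hv.eqL t ⟨ht.1.le, ht.2.trans_le (min_le_right _ _)⟩]
  obtain ⟨C, hC⟩ := isCompact_Icc.exists_bound_of_continuousOn (s := Icc 0 (min u.β v.β))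
    hc.continuousOn
  have hmain := norm_le_normLinf (v := fun t => u t - v t) (a := 0) (b := min u.β v.β) (C := C)
    (fun t ht => by rw [heq t ht]; exact hC t (Ioo_subset_Icc_self ht))
    (hc.continuousOn.congr heq)
  have hcl : closure (Ioo 0 (min u.β v.β)) ⊆ {t | ‖uL t - vL t‖ ≤ semidist u v} :=
    closure_minimal (fun t ht => by
      have := hmain t ht
      simp only [heq t ht] at this
      exact this.trans ((le_max_left _ _).trans (le_max_left _ _)))
      (isClosed_le hc.norm continuous_const)
  rw [closure_Ioo hpos.ne] at hcl
  exact hcl ht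

theorem IsExtension.dist_right_le (hu : u.IsExtension U R uL uR) (hv : v.IsExtension U R' vL vR)
    {t : ℝ} (ht : t ∈ Icc (max u.β v.β) T) : ‖uR t - vR t‖ ≤ semidist u v := by
  have hpos : max u.β v.β < T := max_lt u.β_mem.2 v.β_mem.2
  have hc : Continuous fun t => uR t - vR t := hu.lipR.continuous.sub hv.lipR.continuous
  have heq : ∀ t ∈ Ioo (max u.β v.β) T, u t - v t = uR t - vR t := fun t ht => by
    rw [hu.eqR t ⟨(le_max_left _ _).trans_lt ht.1, ht.2.le⟩,
      hv.eqR t ⟨(le_max_right _ _).trans_lt ht.1, ht.2.le⟩]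
  obtain ⟨C, hC⟩ := isCompact_Icc.exists_bound_of_continuousOn (s := Icc (max u.β v.β) T)
    hc.continuousOn
  have hmain := norm_le_normLinf (v := fun t => u t - v t) (a := max u.β v.β) (b := T) (C := C)
    (fun t ht => by rw [heq t ht]; exact hC t (Ioo_subset_Icc_self ht))
    (hc.continuousOn.congr heq)
  have hcl : closure (Ioo (max u.β v.β) T) ⊆ {t | ‖uR t - vR t‖ ≤ semidist u v} :=
    closure_minimal (fun t ht => by
      have := hmain t ht
      simp only [heq t ht] at this
      exact this.trans ((le_max_right _ _).trans (le_max_left _ _)))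
      (isClosed_le hc.norm continuous_const)
  rw [closure_Ioo hpos.ne] at hcl
  exact hcl ht

end TwoPiece

/-- An interval that avoids `γ` lies on one side of it, where only one of the two solutions is seen;
the integrand at `γ` itself is negligible. This yields the integrated equations of `IsState` and
`IsCostate`. -/
theorem IsPrimOn.glue {n : ℕ} {y z : ℝ → E n} {γ : ℝ} {G G₁ G₂ : ℝ → E n} {T : ℝ} (hγ : γ ∈ Ioo 0 T)
    (h₁ : IsPrimOn G₁ y 0 T) (h₂ : IsPrimOn G₂ z 0 T)
    (hG₁ : ∀ᵐ t, t ∈ Ico 0 γ → G₁ t = G t) (hG₂ : ∀ᵐ t, t ∈ Ioc γ T → G₂ t = G t) :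
    IntervalIntegrable G volume 0 T ∧ ∀ s t, 0 ≤ s → s ≤ t → t ≤ T → γ ∉ Icc s t →
      TwoPiece.glue y z γ t = TwoPiece.glue y z γ s + ∫ τ in s..t, G τ := by
  have hne : ∀ᵐ t : ℝ, t ≠ γ := by simp [ae_iff, measure_singleton]
  have hγ' : γ ∈ Icc 0 T := Ioo_subset_Icc_self hγ
  have hT : (0 : ℝ) ≤ T := hγ.1.le.trans hγ.2.le
  have h₁' : IsPrimOn G y 0 γ := (h₁.mono ⟨le_rfl, hT⟩ hγ').congr_ae hγ.1.le (by
    filter_upwards [hG₁, hne] with t ht hn hmem using ht ⟨hmem.1, lt_of_le_of_ne hmem.2 hn⟩)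
  have h₂' : IsPrimOn G z γ T := (h₂.mono hγ' ⟨hT, le_rfl⟩).congr_ae hγ.2.le (by
    filter_upwards [hG₂, hne] with t ht hn hmem using ht ⟨lt_of_le_of_ne hmem.1 hn.symm, hmem.2⟩)
  refine ⟨h₁'.integrable.trans h₂'.integrable, fun s t hs hst ht hnot => ?_⟩
  rcases lt_or_ge t γ with h | h
  · rw [TwoPiece.glue_of_lt h, TwoPiece.glue_of_lt (hst.trans_lt h),
      ← h₁'.sub_eq ⟨hs, hst.trans h.le⟩ ⟨hs.trans hst, h.le⟩, add_sub_cancel]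
  · have hs' : γ < s := by
      by_contra! hcon
      exact hnot ⟨hcon, h⟩
    rw [TwoPiece.glue_of_le h, TwoPiece.glue_of_le hs'.le,
      ← h₂'.sub_eq ⟨hs'.le, hst.trans ht⟩ ⟨h, ht⟩, add_sub_cancel]

/-! ### Uniform constants; flows and coflows without jumps. -/

variable {m mu : ℕ}

/-- Quantitative form of the smoothness assumptions: one constant `B` serves as Lipschitz constant
of all the data, and the control values have diameter at most `B`. -/
structure UniformBounds (P : Problem m mu) (N : Set (E m)) (Bfu B : ℝ) : Prop where
  T_pos : 0 < P.T
  one_le : 1 ≤ B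
  f_lip : ∀ x x', ∀ u ∈ closure P.U, ∀ u' ∈ closure P.U,
    ‖P.f x' u' - P.f x u‖ ≤ B * ‖x' - x‖ + B * ‖u' - u‖
  f_lip_control : ∀ x, ∀ u ∈ closure P.U, ∀ u' ∈ closure P.U,
    ‖P.f x u' - P.f x u‖ ≤ Bfu * ‖u' - u‖
  f_zero : ∀ u ∈ closure P.U, ‖P.f 0 u‖ ≤ B
  f_diff : ∀ u ∈ closure P.U, Differentiable ℝ (fun x => P.f x u)
  fx_lip : ∀ x x', ∀ u ∈ closure P.U, ∀ u' ∈ closure P.U,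
    ‖fderiv ℝ (fun y => P.f y u') x' - fderiv ℝ (fun y => P.f y u) x‖
      ≤ B * (‖x' - x‖ + ‖u' - u‖)
  L_lip : ∀ x x', ∀ u ∈ closure P.U, ∀ u' ∈ closure P.U,
    |P.L x' u' - P.L x u| ≤ B * ‖x' - x‖ + B * ‖u' - u‖
  L_diff : ∀ u ∈ closure P.U, Differentiable ℝ (fun x => P.L x u)
  Lx_lip : ∀ R : ℝ, ∃ B : ℝ, 0 ≤ B ∧ ∀ x x', ‖x‖ ≤ R → ‖x'‖ ≤ R →
    ∀ u ∈ closure P.U, ∀ u' ∈ closure P.U,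
    ‖gradient (fun y => P.L y u') x' - gradient (fun y => P.L y u) x‖
      ≤ B * (‖x' - x‖ + ‖u' - u‖)
  φx_lip : ∀ x x', ‖gradient P.φ x' - gradient P.φ x‖ ≤ B * ‖x' - x‖
  ψ_lip : ∀ x x', |P.ψ x' - P.ψ x| ≤ B * ‖x' - x‖
  N_open : IsOpen N
  zero_subset : ∀ x, P.ψ x = 0 → x ∈ N
  ψ_contDiff : ContDiffOn ℝ 2 P.ψ N
  ψx_lip : ∀ x ∈ N, ∀ x' ∈ N, ‖gradient P.ψ x' - gradient P.ψ x‖ ≤ B * ‖x' - x‖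
  g_lip : ∀ x ∈ N, ∀ x' ∈ N, ‖P.g x' - P.g x‖ ≤ B * ‖x' - x‖
  gx_lip : ∀ x ∈ N, ∀ x' ∈ N, ‖fderiv ℝ P.g x' - fderiv ℝ P.g x‖ ≤ B * ‖x' - x‖
  unit_normal : ∀ x, P.ψ x = 0 → ‖gradient P.ψ x‖ = 1
  diam : ∀ u ∈ closure P.U, ∀ u' ∈ closure P.U, ‖u' - u‖ ≤ B

/-- Boundedness of `U` supplies the diameter bound, and together with the Lipschitz dependence on
the control it bounds `f 0` on the closure of `U`. -/
theorem Smoothness.exists_uniformBounds {P : Problem m mu} {Bfu : ℝ} (h : Smoothness P Bfu)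
    (hT : 0 < P.T) (hU : Bornology.IsBounded P.U) : ∃ N B, UniformBounds P N Bfu B := by
  obtain ⟨c₁, h₁⟩ := h.f_lip
  obtain ⟨c₂, h₂⟩ := h.fx_lip
  obtain ⟨c₃, c₄, h₃⟩ := h.L_lip
  obtain ⟨c₅, h₅⟩ := h.φx_lip
  obtain ⟨c₆, h₆⟩ := h.ψ_lip
  obtain ⟨N, hN, hsub, hψ, -, ⟨c₇, h₇⟩, ⟨c₈, h₈⟩, ⟨c₉, h₉⟩⟩ := h.manifold
  obtain ⟨D, hD⟩ := Metric.isBounded_iff.1 hU.closure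
  obtain ⟨F, hF⟩ : ∃ F : ℝ, ∀ u ∈ closure P.U, ‖P.f 0 u‖ ≤ F := by
    rcases (closure P.U).eq_empty_or_nonempty with he | ⟨u₀, hu₀⟩
    · exact ⟨0, by simp [he]⟩
    · refine ⟨‖P.f 0 u₀‖ + |Bfu| * D, fun u hu => ?_⟩
      have h1 := h₁ 0 0 u₀ hu₀ u hu
      have h2 := norm_sub_norm_le (P.f 0 u) (P.f 0 u₀)
      have h3 : ‖u - u₀‖ ≤ D := by rw [← dist_eq_norm]; exact hD hu hu₀
      have h4 : Bfu * ‖u - u₀‖ ≤ |Bfu| * D :=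
        mul_le_mul (le_abs_self _) h3 (norm_nonneg _) (abs_nonneg _)
      simp only [sub_self, norm_zero, mul_zero, zero_add] at h1
      linarith
  obtain ⟨B, hB⟩ : ∃ B, ∀ c ∈ ({1, c₁, Bfu, c₂, c₃, c₄, c₅, c₆, c₇, c₈, c₉, D, F} : Finset ℝ),
      c ≤ B := Finset.exists_le _
  simp only [Finset.mem_insert, Finset.mem_singleton, forall_eq_or_imp, forall_eq] at hB
  obtain ⟨b₀, b₁, bu, b₂, b₃, b₄, b₅, b₆, b₇, b₈, b₉, bD, bF⟩ := hB
  refine ⟨N, B, ⟨hT, b₀, fun x x' u hu u' hu' => ?_, fun x u hu u' hu' => ?_,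
    fun u hu => (hF u hu).trans bF, h.f_diff, fun x x' u hu u' hu' => ?_,
    fun x x' u hu u' hu' => ?_, h.L_diff, fun R => ?_, fun x x' => ?_, fun x x' => ?_, hN,
    fun x hx => hsub hx, hψ, fun x hx x' hx' => ?_, fun x hx x' hx' => ?_,
    fun x hx x' hx' => ?_, h.unit_normal, fun u hu u' hu' => ?_⟩⟩
  · exact (h₁ x x' u hu u' hu').trans (by gcongr)
  · simpa using h₁ x x u hu u' hu'
  · exact (h₂ x x' u hu u' hu').trans (by gcongr)
  · exact (h₃ x x' u hu u' hu').trans (by gcongr)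
  · obtain ⟨c, hc⟩ := h.Lx_lip R
    refine ⟨|c|, abs_nonneg _, fun x x' hx hx' u hu u' hu' =>
      (hc x x' hx hx' u hu u' hu').trans ?_⟩
    gcongr
    exact le_abs_self _
  · exact (h₅ x x').trans (by gcongr)
  · exact (h₆ x x').trans (by gcongr)
  · exact (h₇ x hx x' hx').trans (by gcongr)
  · exact (h₈ x hx x' hx').trans (by gcongr)
  · exact (h₉ x hx x' hx').trans (by gcongr)
  · rw [← dist_eq_norm]; exact (hD hu' hu).trans bD

/-- The derivative in `x` of the Hamiltonian, for control values in the closure of `U`. -/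
def Problem.Hx (P : Problem m mu) (x p : E m) (u : E mu) : E m :=
  ContinuousLinearMap.adjoint (fderiv ℝ (fun y => P.f y u) x) p + gradient (fun y => P.L y u) x

/-- Measurable controls with values in the closure of `U`. -/
structure IsAdmissible (P : Problem m mu) (w : ℝ → E mu) : Prop where
  measurable : Measurable w
  mem : ∀ t, w t ∈ closure P.U

/-- `y` solves `y' = f(y, w)` on `[0, T]`, without jumps. -/
structure IsFlow (P : Problem m mu) (w : ℝ → E mu) (y : ℝ → E m) : Prop where
  continuous : Continuous y
  prim : IsPrimOn (fun τ => P.f (y τ) (w τ)) y 0 P.T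

/-- `q` solves the adjoint equation `q' = -H_xᵀ(y, q, w)` on `[0, T]`, without jumps. -/
structure IsCoflow (P : Problem m mu) (w : ℝ → E mu) (y q : ℝ → E m) : Prop where
  continuous : Continuous q
  prim : IsPrimOn (fun τ => -P.Hx (y τ) (q τ) (w τ)) q 0 P.T

/-- The dynamics are controlled only for control values in the closure of `U`. The composition is
therefore factored through the subtype, on which the function is continuous. -/
theorem measurable_comp_of_continuousOn {X : Type*} [TopologicalSpace X] [MeasurableSpace X]
    [BorelSpace X] [SecondCountableTopology X] {n k : ℕ} {Ψ : X × E n → E k} {S : Set (E n)}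
    (hΨ : ContinuousOn Ψ (univ ×ˢ S)) {ξ : ℝ → X} (hξ : Continuous ξ) {w : ℝ → E n}
    (hw : Measurable w) (hmem : ∀ t, w t ∈ S) : Measurable fun t => Ψ (ξ t, w t) := by
  have h1 : Measurable fun t => (⟨(ξ t, w t), mem_univ _, hmem t⟩ :
      ((univ : Set X) ×ˢ S : Set (X × E n))) :=
    (hξ.measurable.prodMk hw).subtype_mk
  exact (continuousOn_iff_continuous_domRestrict.1 hΨ).measurable.comp h1

theorem norm_gradient {f : E m → ℝ} {x : E m} : ‖gradient f x‖ = ‖fderiv ℝ f x‖ := by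
  simp [gradient]

namespace UniformBounds

variable {P : Problem m mu} {N : Set (E m)} {Bfu B : ℝ}

theorem pos (hB : UniformBounds P N Bfu B) : 0 < B := zero_lt_one.trans_le hB.one_le

theorem norm_f_le (hB : UniformBounds P N Bfu B) (x : E m) {u : E mu} (hu : u ∈ closure P.U) :
    ‖P.f x u‖ ≤ B * ‖x‖ + B := by
  have h1 := hB.f_lip 0 x u hu u hu
  have h2 := norm_sub_norm_le (P.f x u) (P.f 0 u)
  have h3 := hB.f_zero u hu
  simp only [sub_self, norm_zero, mul_zero, add_zero, sub_zero] at h1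
  linarith

theorem norm_fderiv_f_le (hB : UniformBounds P N Bfu B) (x : E m) {u : E mu}
    (hu : u ∈ closure P.U) : ‖fderiv ℝ (fun y => P.f y u) x‖ ≤ B :=
  norm_fderiv_le_of_lip' ℝ hB.pos.le (.of_forall fun y => by
    simpa using hB.f_lip x y u hu u hu)

theorem norm_gradient_L_le (hB : UniformBounds P N Bfu B) (x : E m) {u : E mu}
    (hu : u ∈ closure P.U) : ‖gradient (fun y => P.L y u) x‖ ≤ B := by
  rw [norm_gradient]
  exact norm_fderiv_le_of_lip' ℝ hB.pos.le (.of_forall fun y => by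
    simpa using hB.L_lip x y u hu u hu)

theorem norm_fderiv_g_le (hB : UniformBounds P N Bfu B) {x : E m} (hx : x ∈ N) :
    ‖fderiv ℝ P.g x‖ ≤ B :=
  norm_fderiv_le_of_lip' ℝ hB.pos.le (by
    filter_upwards [hB.N_open.mem_nhds hx] with y hy using hB.g_lip x hx y hy)

theorem gradient_H (hB : UniformBounds P N Bfu B) (x p : E m) {u : E mu}
    (hu : u ∈ closure P.U) : gradient (fun y => P.H y p u) x = P.Hx x p u := by
  have h1 := (hB.f_diff u hu x).hasFDerivAt
  have h2 := (hB.L_diff u hu x).hasGradientAt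
  refine HasGradientAt.gradient ?_
  rw [hasGradientAt_iff_hasFDerivAt] at h2 ⊢
  have h3 := ((hasFDerivAt_const p x).inner ℝ h1).add h2
  refine h3.congr_fderiv ?_
  ext v
  simp [Problem.Hx, ContinuousLinearMap.adjoint_inner_left]

theorem Hx_lip_costate (hB : UniformBounds P N Bfu B) (x p p' : E m) {u : E mu}
    (hu : u ∈ closure P.U) : ‖P.Hx x p u - P.Hx x p' u‖ ≤ B * ‖p - p'‖ := by
  rw [Problem.Hx, Problem.Hx, add_sub_add_right_eq_sub, ← map_sub]
  refine (ContinuousLinearMap.le_opNorm _ _).trans ?_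
  rw [LinearIsometryEquiv.norm_map]
  gcongr
  exact hB.norm_fderiv_f_le x hu

theorem norm_Hx_le (hB : UniformBounds P N Bfu B) (x p : E m) {u : E mu}
    (hu : u ∈ closure P.U) : ‖P.Hx x p u‖ ≤ B * ‖p‖ + B := by
  refine (norm_add_le _ _).trans (add_le_add ?_ (hB.norm_gradient_L_le x hu))
  refine (ContinuousLinearMap.le_opNorm _ _).trans ?_
  rw [LinearIsometryEquiv.norm_map]
  gcongr
  exact hB.norm_fderiv_f_le x hu

/-- `H_x` contains the product of `f_x` and the costate, so its dependence on `(x, u)` is Lipschitz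
only for bounded costates. Changing the costate first, at fixed `(x, u)`, means that only `p'` has
to be bounded. -/
theorem exists_Hx_lip (hB : UniformBounds P N Bfu B) (M : ℝ) : ∃ C, 0 ≤ C ∧
    ∀ x x' p p', ‖x‖ ≤ M → ‖x'‖ ≤ M → ‖p'‖ ≤ M → ∀ u ∈ closure P.U, ∀ u' ∈ closure P.U,
      ‖P.Hx x p u - P.Hx x' p' u'‖ ≤ B * ‖p - p'‖ + C * (‖x - x'‖ + ‖u - u'‖) := by
  obtain ⟨B', hB'0, hB'⟩ := hB.Lx_lip M
  have hBpos := hB.pos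
  refine ⟨B * |M| + B', by positivity, fun x x' p p' hx hx' hp' u hu u' hu' => ?_⟩
  have h1 := hB.Hx_lip_costate x p p' hu
  have h2 : ‖P.Hx x p' u - P.Hx x' p' u'‖ ≤ (B * |M| + B') * (‖x - x'‖ + ‖u - u'‖) := by
    rw [Problem.Hx, Problem.Hx, add_sub_add_comm, ← sub_apply, ← map_sub]
    refine (norm_add_le _ _).trans ?_
    rw [add_mul]
    refine add_le_add ?_ (hB' x' x hx' hx u' hu' u hu)
    refine (ContinuousLinearMap.le_opNorm _ _).trans ?_
    rw [LinearIsometryEquiv.norm_map]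
    calc _ ≤ (B * (‖x - x'‖ + ‖u - u'‖)) * |M| := by
          gcongr
          · exact hB.fx_lip x' x u' hu' u hu
          · exact hp'.trans (le_abs_self _)
      _ = _ := by ring
  calc _ ≤ _ := norm_sub_le_norm_sub_add_norm_sub _ (P.Hx x p' u) _
    _ ≤ _ := add_le_add h1 h2

theorem continuousOn_f (hB : UniformBounds P N Bfu B) :
    ContinuousOn (fun z : E m × E mu => P.f z.1 z.2) (univ ×ˢ closure P.U) := by
  intro z hz
  rw [ContinuousWithinAt, tendsto_iff_norm_sub_tendsto_zero]
  have hlim : Tendsto (fun y : E m × E mu => B * ‖y.1 - z.1‖ + B * ‖y.2 - z.2‖)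
      (𝓝[univ ×ˢ closure P.U] z) (𝓝 0) := by
    have : Continuous fun y : E m × E mu => B * ‖y.1 - z.1‖ + B * ‖y.2 - z.2‖ := by fun_prop
    have := this.tendsto z
    simp only [sub_self, norm_zero, mul_zero, add_zero] at this
    exact this.mono_left nhdsWithin_le_nhds
  refine squeeze_zero' (.of_forall fun _ => norm_nonneg _) ?_ hlim
  filter_upwards [self_mem_nhdsWithin] with y hy using hB.f_lip _ _ _ hz.2 _ hy.2

theorem continuousOn_Hx (hB : UniformBounds P N Bfu B) :
    ContinuousOn (fun z : (E m × E m) × E mu => P.Hx z.1.1 z.1.2 z.2) (univ ×ˢ closure P.U) := by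
  intro z hz
  obtain ⟨C, hC0, hC⟩ := hB.exists_Hx_lip (‖z.1‖ + 1)
  rw [ContinuousWithinAt, tendsto_iff_norm_sub_tendsto_zero]
  have hlim : Tendsto (fun y : (E m × E m) × E mu =>
      B * ‖y.1.2 - z.1.2‖ + C * (‖y.1.1 - z.1.1‖ + ‖y.2 - z.2‖))
      (𝓝[univ ×ˢ closure P.U] z) (𝓝 0) := by
    have : Continuous fun y : (E m × E m) × E mu =>
      B * ‖y.1.2 - z.1.2‖ + C * (‖y.1.1 - z.1.1‖ + ‖y.2 - z.2‖) := by fun_prop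
    have := this.tendsto z
    simp only [sub_self, norm_zero, mul_zero, add_zero] at this
    exact this.mono_left nhdsWithin_le_nhds
  refine squeeze_zero' (.of_forall fun _ => norm_nonneg _) ?_ hlim
  have hnear : ∀ᶠ y in 𝓝[univ ×ˢ closure P.U] z, ‖y.1.1‖ < ‖z.1‖ + 1 := by
    have hc : Continuous fun y : (E m × E m) × E mu => ‖y.1.1‖ := by fun_prop
    have : ‖z.1.1‖ < ‖z.1‖ + 1 := (norm_fst_le z.1).trans_lt (lt_add_one _)
    exact (hc.tendsto z).mono_left nhdsWithin_le_nhds |>.eventually (gt_mem_nhds this)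
  filter_upwards [self_mem_nhdsWithin, hnear] with y hy hy1
  exact hC _ _ _ _ hy1.le ((norm_fst_le z.1).trans (by linarith))
    ((norm_snd_le z.1).trans (by linarith)) _ hy.2 _ hz.2

variable {w w' : ℝ → E mu} {y y' q q' : ℝ → E m}

theorem exists_flow (hB : UniformBounds P N Bfu B) (hw : IsAdmissible P w) (t₀ : ℝ) (v : E m) :
    ∃ y, IsFlow P w y ∧ y t₀ = v := by
  obtain ⟨y, hc, hy, hp⟩ := exists_primitive_of_lipschitz (F := fun t x => P.f x (w t)) hB.pos.le
    (fun t x x' => by simpa using hB.f_lip x' x (w t) (hw.mem t) (w t) (hw.mem t))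
    (fun t => hB.f_zero _ (hw.mem t))
    (fun x hx => (measurable_comp_of_continuousOn hB.continuousOn_f hx hw.measurable
      hw.mem).aestronglyMeasurable) t₀ v
  exact ⟨y, ⟨hc, hp 0 P.T hB.T_pos.le⟩, hy⟩

theorem exists_coflow (hB : UniformBounds P N Bfu B) (hw : IsAdmissible P w) (hy : Continuous y)
    (t₀ : ℝ) (v : E m) : ∃ q, IsCoflow P w y q ∧ q t₀ = v := by
  obtain ⟨q, hc, hq, hp⟩ := exists_primitive_of_lipschitz
    (F := fun t p => -P.Hx (y t) p (w t)) (M := B) hB.pos.le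
    (fun t p p' => by
      rw [neg_sub_neg, norm_sub_rev]
      exact hB.Hx_lip_costate _ _ _ (hw.mem t))
    (fun t => by simpa using hB.norm_Hx_le (y t) 0 (hw.mem t))
    (fun x hx => (measurable_comp_of_continuousOn hB.continuousOn_Hx (hy.prodMk hx) hw.measurable
      hw.mem).neg.aestronglyMeasurable) t₀ v
  exact ⟨q, ⟨hc, hp 0 P.T hB.T_pos.le⟩, hq⟩

theorem intervalIntegrable_norm_sub (hB : UniformBounds P N Bfu B) (hw : IsAdmissible P w)
    (hw' : IsAdmissible P w') (a b : ℝ) :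
    IntervalIntegrable (fun t => ‖w t - w' t‖) volume a b := by
  refine IntervalIntegrable.mono_fun (f := fun _ => B) intervalIntegrable_const
    (hw.measurable.sub hw'.measurable).norm.aestronglyMeasurable (.of_forall fun t => ?_)
  simpa [abs_of_pos hB.pos] using hB.diam _ (hw'.mem t) _ (hw.mem t)

/-- Only the `L¹` distance of the controls enters, so misaligned breakpoints cost no more than a
multiple of their distance. The base time `s` will be `0` before the collision and the collision
time after it. -/
theorem flow_dist_le (hB : UniformBounds P N Bfu B) (hw : IsAdmissible P w)
    (hw' : IsAdmissible P w') (hy : IsFlow P w y) (hy' : IsFlow P w' y') {ε : ℝ}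
    (hε : ∫ t in 0..P.T, ‖w t - w' t‖ ≤ ε) {s t : ℝ} (hs : s ∈ Icc 0 P.T) (ht : t ∈ Icc 0 P.T) :
    ‖y t - y' t‖ ≤ (‖y s - y' s‖ + B * ε) * Real.exp (B * P.T) := by
  have hBpos := hB.pos
  have := hy.prim.dist_le hy'.prim (K := B) (ε := B * ε) (e := fun t => B * ‖w t - w' t‖) hB.pos.le
    ((hB.intervalIntegrable_norm_sub hw hw' _ _).const_mul B) (fun t => by positivity)
    (by rw [intervalIntegral.integral_const_mul]; gcongr)
    (fun t _ => hB.f_lip _ _ _ (hw'.mem t) _ (hw.mem t)) hs ht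
  rwa [sub_zero] at this

theorem norm_flow_le (hB : UniformBounds P N Bfu B) (hw : IsAdmissible P w) (hy : IsFlow P w y)
    {s t : ℝ} (hs : s ∈ Icc 0 P.T) (ht : t ∈ Icc 0 P.T) :
    ‖y t‖ ≤ (‖y s‖ + B * P.T) * Real.exp (B * P.T) := by
  -- Comparison with the zero curve, linear growth of `f` being the perturbed Lipschitz estimate.
  have := hy.prim.dist_le (G' := fun _ => 0) (x' := fun _ => 0) ⟨by simp, by simp⟩ (K := B)
    (ε := B * P.T) (e := fun _ => B) hB.pos.le intervalIntegrable_const (fun _ => hB.pos.le)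
    (by simp [mul_comm]) (fun t _ => by simpa using hB.norm_f_le (y t) (hw.mem t)) hs ht
  simpa using this

theorem flow_lipschitz (hB : UniformBounds P N Bfu B) (hw : IsAdmissible P w) (hy : IsFlow P w y)
    {M : ℝ} (hM : ∀ t ∈ Icc 0 P.T, ‖y t‖ ≤ M) {s t : ℝ} (hs : s ∈ Icc 0 P.T)
    (ht : t ∈ Icc 0 P.T) : ‖y t - y s‖ ≤ (B * M + B) * |t - s| :=
  hy.prim.norm_sub_le (fun τ hτ => (hB.norm_f_le _ (hw.mem τ)).trans (by
    have := hB.pos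
    gcongr
    exact hM τ hτ)) hs ht

theorem norm_coflow_le (hB : UniformBounds P N Bfu B) (hw : IsAdmissible P w)
    (hq : IsCoflow P w y q) {s t : ℝ} (hs : s ∈ Icc 0 P.T) (ht : t ∈ Icc 0 P.T) :
    ‖q t‖ ≤ (‖q s‖ + B * P.T) * Real.exp (B * P.T) := by
  have := hq.prim.dist_le (G' := fun _ => 0) (x' := fun _ => 0) ⟨by simp, by simp⟩ (K := B)
    (ε := B * P.T) (e := fun _ => B) hB.pos.le intervalIntegrable_const (fun _ => hB.pos.le)
    (by simp [mul_comm]) (fun t _ => by simpa using hB.norm_Hx_le (y t) (q t) (hw.mem t)) hs ht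
  simpa using this

theorem coflow_lipschitz (hB : UniformBounds P N Bfu B) (hw : IsAdmissible P w)
    (hq : IsCoflow P w y q) {M : ℝ} (hM : ∀ t ∈ Icc 0 P.T, ‖q t‖ ≤ M) {s t : ℝ}
    (hs : s ∈ Icc 0 P.T) (ht : t ∈ Icc 0 P.T) : ‖q t - q s‖ ≤ (B * M + B) * |t - s| :=
  hq.prim.norm_sub_le (fun τ hτ => by
    have := hB.pos
    rw [norm_neg]
    refine (hB.norm_Hx_le _ _ (hw.mem τ)).trans ?_
    gcongr
    exact hM τ hτ) hs ht

/-- The differences of states and controls act as sources in Gronwall's inequality. The base time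
`s` will be `T` for the costate after the collision and the collision time for the one before. -/
theorem exists_coflow_dist_le (hB : UniformBounds P N Bfu B) (M : ℝ) : ∃ C, 0 ≤ C ∧
    ∀ (w w' : ℝ → E mu) (y y' q q' : ℝ → E m), IsAdmissible P w → IsAdmissible P w' →
      IsFlow P w y → IsFlow P w' y' → IsCoflow P w y q → IsCoflow P w' y' q' →
      (∀ t ∈ Icc 0 P.T, ‖y t‖ ≤ M) → (∀ t ∈ Icc 0 P.T, ‖y' t‖ ≤ M) →
      (∀ t ∈ Icc 0 P.T, ‖q' t‖ ≤ M) → ∀ δ ε : ℝ, (∀ t ∈ Icc 0 P.T, ‖y t - y' t‖ ≤ δ) →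
      ∫ t in 0..P.T, ‖w t - w' t‖ ≤ ε → ∀ s ∈ Icc 0 P.T, ∀ t ∈ Icc 0 P.T,
      ‖q t - q' t‖ ≤ C * (‖q s - q' s‖ + δ + ε) := by
  obtain ⟨C, hC0, hC⟩ := hB.exists_Hx_lip M
  have hT := hB.T_pos
  refine ⟨(1 + C * (P.T + 1)) * Real.exp (B * P.T), by positivity, ?_⟩
  intro w w' y y' q q' hw hw' hy hy' hq hq' hyM hyM' hqM' δ ε hδ hε s hs t ht
  have hδ0 : 0 ≤ δ := (norm_nonneg _).trans (hδ s hs)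
  have hε0 : 0 ≤ ε := (intervalIntegral.integral_nonneg hT.le fun t _ => norm_nonneg _).trans hε
  have hint := hB.intervalIntegrable_norm_sub hw hw' 0 P.T
  have := hq.prim.dist_le hq'.prim (K := B) (ε := C * (P.T * δ + ε))
    (e := fun t => C * (δ + ‖w t - w' t‖)) hB.pos.le
    ((intervalIntegrable_const.add hint).const_mul C) (fun t => by positivity)
    (by
      rw [intervalIntegral.integral_const_mul,
        intervalIntegral.integral_add intervalIntegrable_const hint,
        intervalIntegral.integral_const, sub_zero, smul_eq_mul]
      gcongr)
    (fun t ht => by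
      rw [neg_sub_neg, norm_sub_rev]
      refine (hC _ _ _ _ (hyM t ht) (hyM' t ht) (hqM' t ht) _ (hw.mem t) _ (hw'.mem t)).trans ?_
      gcongr
      exact hδ t ht) hs ht
  refine this.trans ?_
  rw [sub_zero, mul_right_comm]
  gcongr
  have h0 : 0 ≤ ‖q s - q' s‖ := norm_nonneg _
  nlinarith [mul_nonneg hC0 h0, mul_nonneg hC0 hε0, mul_nonneg hC0 hδ0,
    mul_nonneg (mul_nonneg hC0 hT.le) h0, mul_nonneg (mul_nonneg hC0 hT.le) hε0]

end UniformBounds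

/-! ### States and costates with one collision as pairs of jump-free curves. -/

/-- The state with a single collision at `γ`, described by the flow `y` before and the flow `z`
after the collision, both extended to `[0, T]`. -/
structure IsStatePair (P : Problem m mu) (w : ℝ → E mu) (γ : ℝ) (y z : ℝ → E m) : Prop where
  mem : γ ∈ Ioo 0 P.T
  flow_left : IsFlow P w y
  flow_right : IsFlow P w z
  init : y 0 = P.x0
  zero : P.ψ (y γ) = 0
  pos_left : ∀ t ∈ Ico 0 γ, 0 < P.ψ (y t)
  jump : z γ = P.g (y γ)
  pos_right : ∀ t ∈ Icc γ P.T, 0 < P.ψ (z t)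

/-- The costate along a state with a single collision, described by the coflows `q` before and `r`
after the collision, both extended to `[0, T]`. -/
structure IsCostatePair (P : Problem m mu) (w : ℝ → E mu) (γ : ℝ) (ul ur : E mu)
    (y z q r : ℝ → E m) : Prop where
  coflow_left : IsCoflow P w y q
  coflow_right : IsCoflow P w z r
  terminal : r P.T = gradient P.φ (z P.T)
  jump : CostateJump P (q γ) (r γ) (y γ) (z γ) ul ur

namespace UniformBounds

variable {P : Problem m mu} {N : Set (E m)} {Bfu B : ℝ} {w : ℝ → E mu} {u : ℝ → E mu} {γ : ℝ}
  {x y z p q r : ℝ → E m}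

/-- The value `x γ` carries no information, so the right flow is solved backward from `x P.T`.
Uniqueness identifies `x` with the two flows off `γ`, and the one-sided limits in `IsState` become
values of continuous curves. -/
theorem exists_statePair (hB : UniformBounds P N Bfu B) (hw : IsAdmissible P w)
    (hwu : ∀ᵐ t, t ∈ Icc 0 P.T → w t = u t) (hx : IsState P u {γ} x) :
    ∃ y z, IsStatePair P w γ y z ∧ (∀ t ∈ Ico 0 γ, x t = y t) ∧ ∀ t ∈ Ioc γ P.T, x t = z t := by
  have hγ := hx.times γ (Finset.mem_singleton_self γ)
  have hT := hB.T_pos.le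
  obtain ⟨y, hy, hy0⟩ := hB.exists_flow hw 0 P.x0
  obtain ⟨z, hz, hzT⟩ := hB.exists_flow hw P.T (x P.T)
  have hprim : ∀ a b, 0 ≤ a → a ≤ b → b ≤ P.T → γ ∉ Icc a b →
      IsPrimOn (fun τ => P.f (x τ) (w τ)) x a b := fun a b ha hab hb hnot => by
    refine IsPrimOn.congr_ae (G := fun τ => P.f (x τ) (u τ)) ⟨?_, fun t ht => ?_⟩ hab ?_
    · exact hx.integrable.mono_set (by
        rw [uIcc_of_le hab, uIcc_of_le hT]; exact Icc_subset_Icc ha hb)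
    · exact hx.ode a t ha ht.1 (ht.2.trans hb) (fun γ' hmem h => hnot (by
        rw [Finset.mem_singleton] at hmem
        subst hmem
        exact ⟨h.1, h.2.trans ht.2⟩))
    · filter_upwards [hwu] with t ht hmem
      rw [ht ⟨ha.trans hmem.1, hmem.2.trans hb⟩]
  have hl : ∀ t ∈ Ico 0 γ, x t = y t := fun t ht => by
    have ht' : t ∈ Icc 0 P.T := ⟨ht.1, ht.2.le.trans hγ.2.le⟩
    exact (hprim 0 t le_rfl ht.1 ht'.2 (fun h => absurd h.2 (not_le.2 ht.2))).eq_of_lipschitz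
      (hy.prim.mono ⟨le_rfl, hT⟩ ht') hB.pos.le
      (fun s _ => by simpa using hB.f_lip (y s) (x s) (w s) (hw.mem s) (w s) (hw.mem s))
      ⟨le_rfl, ht.1⟩ ⟨ht.1, le_rfl⟩ (by rw [hx.init, hy0])
  have hr : ∀ t ∈ Ioc γ P.T, x t = z t := fun t ht => by
    have ht' : t ∈ Icc 0 P.T := ⟨hγ.1.le.trans ht.1.le, ht.2⟩
    exact (hprim t P.T ht'.1 ht.2 le_rfl (fun h => absurd h.1 (not_le.2 ht.1))).eq_of_lipschitz
      (hz.prim.mono ht' ⟨hT, le_rfl⟩) hB.pos.le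
      (fun s _ => by simpa using hB.f_lip (z s) (x s) (w s) (hw.mem s) (w s) (hw.mem s))
      ⟨ht.2, le_rfl⟩ ⟨le_rfl, ht.2⟩ hzT.symm
  have hleft : Function.leftLim x γ = y γ :=
    leftLim_eq_of_eqOn hγ.1 hy.continuous.continuousAt hl
  have hright : Function.rightLim x γ = z γ :=
    rightLim_eq_of_eqOn hγ.2 hz.continuous.continuousAt hr
  have h1 := hx.zero γ (Finset.mem_singleton_self γ)
  have h2 := hx.jump γ (Finset.mem_singleton_self γ)
  have h3 := hx.pos_right γ (Finset.mem_singleton_self γ)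
  rw [hleft] at h1 h2
  rw [hright] at h2 h3
  refine ⟨y, z, ⟨hγ, hy, hz, hy0, h1, fun t ht => ?_, h2, fun t ht => ?_⟩, hl, hr⟩
  · rw [← hl t ht]
    exact hx.pos t ⟨ht.1, ht.2.le.trans hγ.2.le⟩ (by simpa using ht.2.ne)
  · rcases eq_or_lt_of_le ht.1 with rfl | hlt
    · exact h3
    · rw [← hr t ⟨hlt, ht.2⟩]
      exact hx.pos t ⟨hγ.1.le.trans ht.1, ht.2⟩ (by simpa using hlt.ne')

theorem isState_glue (hwu : ∀ᵐ t, t ∈ Icc 0 P.T → w t = u t) (h : IsStatePair P w γ y z) :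
    IsState P u {γ} (TwoPiece.glue y z γ) := by
  have hγ := h.mem
  obtain ⟨h1, h2⟩ := IsPrimOn.glue (G := fun t => P.f (TwoPiece.glue y z γ t) (u t)) hγ
    h.flow_left.prim h.flow_right.prim
    (by
      filter_upwards [hwu] with t ht hmem
      rw [TwoPiece.glue_of_lt hmem.2, ht ⟨hmem.1, hmem.2.le.trans hγ.2.le⟩])
    (by
      filter_upwards [hwu] with t ht hmem
      rw [TwoPiece.glue_of_le hmem.1.le, ht ⟨hγ.1.le.trans hmem.1.le, hmem.2⟩])
  have hleft := TwoPiece.leftLim_glue (z := z) hγ.1 h.flow_left.continuous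
  have hright := TwoPiece.rightLim_glue (y := y) hγ.2 h.flow_right.continuous
  refine ⟨by simpa using hγ, ?_, h1, ?_, ?_, ?_, ?_, ?_⟩
  · rw [TwoPiece.glue_of_lt hγ.1, h.init]
  · intro s t hs hst ht hnot
    exact h2 s t hs hst ht (hnot γ (Finset.mem_singleton_self γ))
  · simpa [hleft] using h.zero
  · simpa [hleft, hright] using h.jump
  · simpa [hright] using h.pos_right γ ⟨le_rfl, hγ.2.le⟩
  · intro t ht hne
    rcases lt_or_ge t γ with hlt | hle
    · rw [TwoPiece.glue_of_lt hlt]; exact h.pos_left t ⟨ht.1, hlt⟩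
    · rw [TwoPiece.glue_of_le hle]; exact h.pos_right t ⟨hle, ht.2⟩

/-- The scheme is that of the state: `q` starts from `p 0`, `r` from `p P.T`, and uniqueness for the
adjoint equation does the rest. -/
theorem exists_costatePair (hB : UniformBounds P N Bfu B) (hw : IsAdmissible P w)
    {u : TwoPiece P.T mu} (hwu : ∀ᵐ t, t ∈ Icc 0 P.T → w t = u t) (h : IsStatePair P w γ y z)
    (hl : ∀ t ∈ Ico 0 γ, x t = y t) (hr : ∀ t ∈ Ioc γ P.T, x t = z t)
    (hp : IsCostate P u γ x p) :
    ∃ q r, IsCostatePair P w γ u.left u.right y z q r ∧ (∀ t ∈ Ico 0 γ, p t = q t) ∧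
      ∀ t ∈ Ioc γ P.T, p t = r t := by
  have hγ := h.mem
  have hT := hB.T_pos.le
  obtain ⟨q, hq, hq0⟩ := hB.exists_coflow hw h.flow_left.continuous 0 (p 0)
  obtain ⟨r, hr', hrT⟩ := hB.exists_coflow hw h.flow_right.continuous P.T (p P.T)
  have hprim : ∀ y' : ℝ → E m, ∀ a b, 0 ≤ a → a ≤ b → b ≤ P.T → γ ∉ Icc a b →
      (∀ t ∈ Icc a b, x t = y' t) →
      IsPrimOn (fun τ => -P.Hx (y' τ) (p τ) (w τ)) p a b := fun y' a b ha hab hb hnot hxy => by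
    refine IsPrimOn.congr_ae
      (G := fun τ => -gradient (fun y => P.H y (p τ) (u τ)) (x τ)) ⟨?_, fun t ht => ?_⟩ hab ?_
    · exact (hp.integrable.mono_set (by
        rw [uIcc_of_le hab, uIcc_of_le hT]; exact Icc_subset_Icc ha hb)).neg
    · exact hp.ode a t ha ht.1 (ht.2.trans hb) fun h => hnot ⟨h.1, h.2.trans ht.2⟩
    · filter_upwards [hwu] with t ht hmem
      rw [← ht ⟨ha.trans hmem.1, hmem.2.trans hb⟩, hB.gradient_H _ _ (hw.mem t), hxy t hmem]
  have hpl : ∀ t ∈ Ico 0 γ, p t = q t := fun t ht => by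
    have ht' : t ∈ Icc 0 P.T := ⟨ht.1, ht.2.le.trans hγ.2.le⟩
    refine (hprim y 0 t le_rfl ht.1 ht'.2 (fun h => absurd h.2 (not_le.2 ht.2))
      fun s hs => hl s ⟨hs.1, hs.2.trans_lt ht.2⟩).eq_of_lipschitz
      (hq.prim.mono ⟨le_rfl, hT⟩ ht') hB.pos.le
      (fun s _ => ?_) ⟨le_rfl, ht.1⟩ ⟨ht.1, le_rfl⟩ hq0.symm
    rw [neg_sub_neg, norm_sub_rev]
    exact hB.Hx_lip_costate _ _ _ (hw.mem s)
  have hpr : ∀ t ∈ Ioc γ P.T, p t = r t := fun t ht => by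
    have ht' : t ∈ Icc 0 P.T := ⟨hγ.1.le.trans ht.1.le, ht.2⟩
    refine (hprim z t P.T ht'.1 ht.2 le_rfl (fun h => absurd h.1 (not_le.2 ht.1))
      fun s hs => hr s ⟨ht.1.trans_le hs.1, hs.2⟩).eq_of_lipschitz
      (hr'.prim.mono ht' ⟨hT, le_rfl⟩) hB.pos.le
      (fun s _ => ?_) ⟨ht.2, le_rfl⟩ ⟨le_rfl, ht.2⟩ hrT.symm
    rw [neg_sub_neg, norm_sub_rev]
    exact hB.Hx_lip_costate _ _ _ (hw.mem s)
  have hjump := hp.jump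
  rw [leftLim_eq_of_eqOn hγ.1 hq.continuous.continuousAt hpl,
    rightLim_eq_of_eqOn hγ.2 hr'.continuous.continuousAt hpr,
    leftLim_eq_of_eqOn hγ.1 h.flow_left.continuous.continuousAt hl,
    rightLim_eq_of_eqOn hγ.2 h.flow_right.continuous.continuousAt hr] at hjump
  exact ⟨q, r, ⟨hq, hr', by rw [hrT, hp.terminal, hr P.T ⟨hγ.2, le_rfl⟩], hjump⟩, hpl, hpr⟩

theorem isCostate_glue (hB : UniformBounds P N Bfu B) (hw : IsAdmissible P w)
    {u : TwoPiece P.T mu} (hwu : ∀ᵐ t, t ∈ Icc 0 P.T → w t = u t) (h : IsStatePair P w γ y z)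
    (hp : IsCostatePair P w γ u.left u.right y z q r) :
    IsCostate P u γ (TwoPiece.glue y z γ) (TwoPiece.glue q r γ) := by
  have hγ := h.mem
  obtain ⟨h1, h2⟩ := IsPrimOn.glue (G := fun t => -gradient
    (fun y => P.H y (TwoPiece.glue q r γ t) (u t)) (TwoPiece.glue y z γ t)) hγ
    hp.coflow_left.prim hp.coflow_right.prim
    (by
      filter_upwards [hwu] with t ht hmem
      rw [TwoPiece.glue_of_lt hmem.2, TwoPiece.glue_of_lt hmem.2,
        ← ht ⟨hmem.1, hmem.2.le.trans hγ.2.le⟩, hB.gradient_H _ _ (hw.mem t)])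
    (by
      filter_upwards [hwu] with t ht hmem
      rw [TwoPiece.glue_of_le hmem.1.le, TwoPiece.glue_of_le hmem.1.le,
        ← ht ⟨hγ.1.le.trans hmem.1.le, hmem.2⟩, hB.gradient_H _ _ (hw.mem t)])
  refine ⟨?_, by simpa only [Pi.neg_def, neg_neg] using h1.neg, h2, ?_⟩
  · rw [TwoPiece.glue_of_le hγ.2.le, TwoPiece.glue_of_le hγ.2.le, hp.terminal]
  · rw [TwoPiece.leftLim_glue hγ.1 hp.coflow_left.continuous, TwoPiece.rightLim_glue hγ.2 hp.coflow_right.continuous,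
      TwoPiece.leftLim_glue hγ.1 h.flow_left.continuous, TwoPiece.rightLim_glue hγ.2 h.flow_right.continuous]
    exact hp.jump

end UniformBounds

/-! ### Transversality, and dependence of the collision and the state on the control. -/

/-- The control `w` with one-sided limits `ul`, `ur` at its breakpoint is close to the reference
control `wstar` with one-sided limits `uls`, `urs` at its breakpoint `γ`. -/
structure CloseControl (P : Problem m mu) (wstar : ℝ → E mu) (γ : ℝ) (uls urs : E mu) (A : ℝ)
    (w : ℝ → E mu) (ul ur : E mu) (ε : ℝ) : Prop where
  adm : IsAdmissible P w
  memL : ul ∈ closure P.U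
  memR : ur ∈ closure P.U
  int : ∫ t in 0..P.T, ‖w t - wstar t‖ ≤ ε
  near : ∀ t, ‖w t - uls‖ ≤ ε + A * |t - γ| ∨ ‖w t - urs‖ ≤ ε + A * |t - γ|
  left : ‖ul - uls‖ ≤ ε
  right : ‖ur - urs‖ ≤ ε

/-- A reference solution with a strong collision. -/
structure IsReference (P : Problem m mu) (a b K S : ℝ) (w : ℝ → E mu) (γ : ℝ) (ul ur : E mu)
    (y z q r : ℝ → E m) : Prop where
  adm : IsAdmissible P w
  memL : ul ∈ closure P.U
  memR : ur ∈ closure P.U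
  state : IsStatePair P w γ y z
  costate : IsCostatePair P w γ ul ur y z q r
  a_pos : 0 < a
  b_pos : 0 < b
  K_pos : 0 < K
  S_pos : 0 < S
  before : ∀ t ∈ Ico 0 γ, min b (K * (γ - t)) ≤ P.ψ (y t)
  after : ∀ t ∈ Icc γ P.T, a ≤ P.ψ (z t)
  speed_left : ⟪gradient P.ψ (y γ), P.f (y γ) ul⟫ ≤ -S
  speed_right : ⟪gradient P.ψ (y γ), P.f (y γ) ur⟫ ≤ -S

theorem exists_first_zero {f : ℝ → ℝ} (hf : Continuous f) (h0 : 0 < f 0) {t₁ : ℝ} (ht₁ : 0 ≤ t₁)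
    (h1 : f t₁ ≤ 0) : ∃ γ ∈ Ioc 0 t₁, f γ = 0 ∧ ∀ t ∈ Ico 0 γ, 0 < f t := by
  have hcomp : IsCompact (Icc 0 t₁ ∩ {t | f t ≤ 0}) :=
    isCompact_Icc.inter_right (isClosed_le hf continuous_const)
  obtain ⟨γ, ⟨hγ, hγ0⟩, hleast⟩ := hcomp.exists_isLeast ⟨t₁, ⟨ht₁, le_rfl⟩, h1⟩
  have hpos : ∀ t ∈ Ico 0 γ, 0 < f t := fun t ht => by
    by_contra! hcon
    exact absurd (hleast ⟨⟨ht.1, ht.2.le.trans hγ.2⟩, hcon⟩) (not_le.2 ht.2)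
  have hγpos : 0 < γ := lt_of_le_of_ne hγ.1 fun h => by
    subst h
    exact absurd hγ0 (not_le.2 h0)
  refine ⟨γ, ⟨hγpos, hγ.2⟩, le_antisymm hγ0 ?_, hpos⟩
  have hcl : closure (Ico 0 γ) ⊆ {t | 0 ≤ f t} :=
    closure_minimal (fun t ht => (hpos t ht).le) (isClosed_le continuous_const hf)
  rw [closure_Ico hγpos.ne] at hcl
  exact hcl ⟨hγ.1, le_rfl⟩

namespace UniformBounds

variable {P : Problem m mu} {N : Set (E m)} {Bfu B : ℝ}

/-- All states with a single collision are bounded by the same constant. -/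
theorem exists_state_bound (hB : UniformBounds P N Bfu B) : ∃ M, 0 ≤ M ∧
    ∀ w γ y z, IsAdmissible P w → IsStatePair P w γ y z → ∀ t ∈ Icc 0 P.T,
      ‖y t‖ ≤ M ∧ ‖z t‖ ≤ M := by
  have hT := hB.T_pos.le
  have hBpos := hB.pos
  set M₁ := (‖P.x0‖ + B * P.T) * Real.exp (B * P.T) with hM₁
  have hM₁0 : 0 ≤ M₁ := by positivity
  have hy1 : ∀ w y, IsAdmissible P w → IsFlow P w y → y 0 = P.x0 → ∀ t ∈ Icc 0 P.T,
      ‖y t‖ ≤ M₁ := fun w y hw hy h0 t ht => by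
    have := hB.norm_flow_le hw hy ⟨le_rfl, hT⟩ ht
    rwa [h0] at this
  -- The jump map is controlled only near `{ψ = 0}`, so bounding `g (y γ)` needs a base point there.
  -- Without one, no collision is possible and the claim is vacuous.
  by_cases hex : ∃ x₁, P.ψ x₁ = 0
  · obtain ⟨x₁, hx₁⟩ := hex
    set G := ‖P.g x₁‖ + B * (M₁ + ‖x₁‖) with hG
    set M₂ := (G + B * P.T) * Real.exp (B * P.T) with hM₂
    have hM₂0 : 0 ≤ M₂ := by positivity
    refine ⟨M₁ + M₂, by positivity, fun w γ y z hw h t ht => ?_⟩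
    have hγ : γ ∈ Icc 0 P.T := Ioo_subset_Icc_self h.mem
    refine ⟨(hy1 w y hw h.flow_left h.init t ht).trans (by linarith), ?_⟩
    have h1 := hB.norm_flow_le hw h.flow_right hγ ht
    have h2 : ‖z γ‖ ≤ G := by
      have h3 := hB.g_lip x₁ (hB.zero_subset _ hx₁) (y γ) (hB.zero_subset _ h.zero)
      have h4 : ‖y γ - x₁‖ ≤ M₁ + ‖x₁‖ :=
        (norm_sub_le _ _).trans (by gcongr; exact hy1 w y hw h.flow_left h.init γ hγ)
      have h5 := norm_sub_norm_le (P.g (y γ)) (P.g x₁)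
      have h6 : B * ‖y γ - x₁‖ ≤ B * (M₁ + ‖x₁‖) := by gcongr
      rw [h.jump]
      linarith
    have h7 : (‖z γ‖ + B * P.T) * Real.exp (B * P.T) ≤ M₂ := by rw [hM₂]; gcongr
    linarith
  · exact ⟨M₁, hM₁0, fun w γ y z hw h => absurd ⟨_, h.zero⟩ hex⟩

section Reference

variable {a b K S : ℝ} {ws : ℝ → E mu} {γs : ℝ} {uls urs : E mu} {ys zs qs rs : ℝ → E m}

/-- Near the collision point of the reference, `ψ` decreases along flows at a definite rate. -/
theorem exists_descent (hB : UniformBounds P N Bfu B)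
    (href : IsReference P a b K S ws γs uls urs ys zs qs rs) : ∃ ρ, 0 < ρ ∧
    ∀ (w : ℝ → E mu) (y : ℝ → E m), IsAdmissible P w → IsFlow P w y → ∀ s ∈ Icc 0 P.T,
      ∀ t ∈ Icc 0 P.T, s ≤ t →
      (∀ τ ∈ Icc s t, ‖y τ - ys γs‖ ≤ ρ ∧ (‖w τ - uls‖ ≤ ρ ∨ ‖w τ - urs‖ ≤ ρ)) →
      P.ψ (y t) - P.ψ (y s) ≤ -(S / 2) * (t - s) := by
  have hBpos := hB.pos
  have hS := href.S_pos
  set xs := ys γs with hxs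
  set ν := gradient P.ψ xs with hν
  have hν1 : ‖ν‖ = 1 := hB.unit_normal _ href.state.zero
  set F := B * (‖xs‖ + 1) + B with hF
  have hFpos : 0 < F := by positivity
  -- The control is merely measurable, so the increment of `ψ` is not differentiated in time. Strict
  -- differentiability compares it with the linear increment uniformly in both endpoints.
  have hsd : HasStrictFDerivAt P.ψ (fderiv ℝ P.ψ xs) xs := by
    have hN := hB.N_open.mem_nhds (hB.zero_subset _ href.state.zero)
    exact (hB.ψ_contDiff.contDiffAt hN).hasStrictFDerivAt (by norm_num)
  have hev : ∀ᶠ z in 𝓝 (xs, xs),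
      ‖P.ψ z.1 - P.ψ z.2 - fderiv ℝ P.ψ xs (z.1 - z.2)‖ ≤ S / (4 * F) * ‖z.1 - z.2‖ :=
    hsd.isLittleO.bound (by positivity)
  obtain ⟨ρ₁, hρ₁, hball⟩ := Metric.eventually_nhds_iff_ball.1 hev
  -- The three bounds keep `y` where the linearization is valid, bound its speed by `F`, and limit
  -- the loss of normal speed to `S/4`, whichever of `uls`, `urs` the control is near. The
  -- linearization error costs another `S/4`, leaving the rate `S/2`.
  refine ⟨min (ρ₁ / 2) (min 1 (S / (8 * B))), by positivity, ?_⟩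
  intro w y hw hy s hs t ht hst hnear
  have hρ1 : min (ρ₁ / 2) (min 1 (S / (8 * B))) < ρ₁ := (min_le_left _ _).trans_lt (by linarith)
  have hρ2 : min (ρ₁ / 2) (min 1 (S / (8 * B))) ≤ 1 := (min_le_right _ _).trans (min_le_left _ _)
  have hρ3 : min (ρ₁ / 2) (min 1 (S / (8 * B))) ≤ S / (8 * B) :=
    (min_le_right _ _).trans (min_le_right _ _)
  set ρ := min (ρ₁ / 2) (min 1 (S / (8 * B))) with hρ
  have hfb : ∀ τ ∈ Icc s t, ‖P.f (y τ) (w τ)‖ ≤ F := fun τ hτ => by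
    refine (hB.norm_f_le _ (hw.mem τ)).trans ?_
    have h1 := norm_sub_norm_le (y τ) xs
    have h2 := (hnear τ hτ).1
    rw [hF]
    gcongr
    linarith
  have hspeed : ∀ τ ∈ Icc s t, ⟪ν, P.f (y τ) (w τ)⟫ ≤ -(3 * S / 4) := fun τ hτ => by
    have hgen : ∀ u ∈ closure P.U, ⟪ν, P.f xs u⟫ ≤ -S → ‖w τ - u‖ ≤ ρ →
        ⟪ν, P.f (y τ) (w τ)⟫ ≤ -(3 * S / 4) := fun u hu hsp hwu => by
      have h1 : ⟪ν, P.f (y τ) (w τ) - P.f xs u⟫ ≤ B * ρ + B * ρ := by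
        refine (real_inner_le_norm _ _).trans ?_
        rw [hν1, one_mul]
        refine (hB.f_lip _ _ _ hu _ (hw.mem τ)).trans ?_
        gcongr
        exact (hnear τ hτ).1
      rw [inner_sub_right] at h1
      have h2 : B * ρ ≤ S / 8 := by
        calc B * ρ ≤ B * (S / (8 * B)) := by gcongr
          _ = S / 8 := by field_simp
      linarith
    rcases (hnear τ hτ).2 with h | h
    · exact hgen _ href.memL href.speed_left h
    · exact hgen _ href.memR href.speed_right h
  have hint : IntervalIntegrable (fun τ => P.f (y τ) (w τ)) volume s t :=
    hy.prim.intervalIntegrable hs ht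
  have hinner : ⟪ν, y t - y s⟫ ≤ -(3 * S / 4) * (t - s) := by
    rw [hy.prim.sub_eq hs ht]
    have h1 := (innerSL ℝ ν).intervalIntegral_comp_comm hint
    simp only [innerSL_apply_apply] at h1
    rw [← h1]
    have h2 : IntervalIntegrable (fun τ => ⟪ν, P.f (y τ) (w τ)⟫) volume s t := by
      have := (innerSL ℝ ν).integrable_comp hint.1
      have h' := (innerSL ℝ ν).integrable_comp hint.2
      exact ⟨by simpa [IntegrableOn] using this, by simpa [IntegrableOn] using h'⟩
    calc _ ≤ ∫ τ in s..t, -(3 * S / 4) :=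
          intervalIntegral.integral_mono_on hst h2 intervalIntegrable_const hspeed
      _ = _ := by rw [intervalIntegral.integral_const, smul_eq_mul, mul_comm]
  have hnorm : ‖y t - y s‖ ≤ F * (t - s) := by
    rw [hy.prim.sub_eq hs ht]
    have := intervalIntegral.norm_integral_le_of_norm_le_const (a := s) (b := t)
      (f := fun τ => P.f (y τ) (w τ)) (C := F) fun τ hτ => hfb τ (by
        rw [uIoc_of_le hst] at hτ; exact ⟨hτ.1.le, hτ.2⟩)
    rwa [abs_of_nonneg (sub_nonneg.2 hst)] at this
  have hb := hball (y t, y s) (by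
    rw [Metric.mem_ball, Prod.dist_eq, max_lt_iff, dist_eq_norm, dist_eq_norm]
    exact ⟨((hnear t ⟨hst, le_rfl⟩).1).trans_lt hρ1, ((hnear s ⟨le_rfl, hst⟩).1).trans_lt hρ1⟩)
  have hgrad : fderiv ℝ P.ψ xs (y t - y s) = ⟪ν, y t - y s⟫ := by
    rw [hν, gradient, InnerProductSpace.toDual_symm_apply]
  simp only [hgrad] at hb
  have h3 := (le_abs_self _).trans hb
  have h4 : S / (4 * F) * ‖y t - y s‖ ≤ S / 4 * (t - s) := by
    calc _ ≤ S / (4 * F) * (F * (t - s)) := by gcongr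
      _ = _ := by field_simp
  linarith

/-- Existence of the collision time, and its Lipschitz dependence on the control. -/
theorem exists_collision_estimates (hB : UniformBounds P N Bfu B)
    (href : IsReference P a b K S ws γs uls urs ys zs qs rs) {A : ℝ} (hA : 0 ≤ A) :
    ∃ C ε₀, 0 ≤ C ∧ 0 < ε₀ ∧ ∀ w ul ur ε, CloseControl P ws γs uls urs A w ul ur ε → ε ≤ ε₀ →
      ∀ y, IsFlow P w y → y 0 = P.x0 →
        (∀ t ∈ Icc 0 P.T, ‖y t - ys t‖ ≤ C * ε) ∧
        (∃ γ ∈ Ioo 0 P.T, P.ψ (y γ) = 0 ∧ ∀ t ∈ Ico 0 γ, 0 < P.ψ (y t)) ∧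
        ∀ γ ∈ Ioo 0 P.T, P.ψ (y γ) = 0 → (∀ t ∈ Ico 0 γ, 0 < P.ψ (y t)) → |γ - γs| ≤ C * ε := by
  have hT := hB.T_pos.le
  have hBpos := hB.pos
  have hS := href.S_pos
  have hb := href.b_pos
  have hK := href.K_pos
  have hγs := href.state.mem
  have hγs' := Ioo_subset_Icc_self hγs
  obtain ⟨ρ, hρ, hdesc⟩ := hB.exists_descent href
  obtain ⟨M, hM0, hM⟩ := hB.exists_state_bound
  have hyM : ∀ t ∈ Icc 0 P.T, ‖ys t‖ ≤ M := fun t ht => (hM _ _ _ _ href.adm href.state t ht).1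
  set l := B * M + B with hl
  have hl0 : 0 ≤ l := by positivity
  set C₁ := B * Real.exp (B * P.T) with hC₁
  have hC₁0 : 0 ≤ C₁ := by positivity
  set C₂ := B * C₁ with hC₂
  have hC₂0 : 0 ≤ C₂ := by positivity
  -- A window of length `δ` after the reference collision, inside `[0, T]`, over which the reference
  -- flow and the drift `A|t - γs|` of the control use up at most half of `ρ`.
  obtain ⟨δ, hδ, hδ1, hδ2, hδ3, hδ4⟩ : ∃ δ > 0, δ < γs ∧ δ < P.T - γs ∧ l * δ ≤ ρ / 2 ∧
      A * δ ≤ ρ / 2 := by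
    have h1 : 0 < γs := hγs.1
    have h2 : 0 < P.T - γs := sub_pos.2 hγs.2
    have h3 : min (γs / 2) (min ((P.T - γs) / 2) (ρ / (2 * (l + A + 1)))) ≤ ρ / (2 * (l + A + 1)) :=
      (min_le_right _ _).trans (min_le_right _ _)
    have h4 : (l + A + 1) * min (γs / 2) (min ((P.T - γs) / 2) (ρ / (2 * (l + A + 1)))) ≤ ρ / 2 := by
      calc _ ≤ (l + A + 1) * (ρ / (2 * (l + A + 1))) := by gcongr
        _ = _ := by field_simp
    have h5 : 0 < min (γs / 2) (min ((P.T - γs) / 2) (ρ / (2 * (l + A + 1)))) := by positivity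
    refine ⟨_, h5, (min_le_left _ _).trans_lt (by linarith),
      ((min_le_right _ _).trans (min_le_left _ _)).trans_lt (by linarith), ?_, ?_⟩ <;>
    nlinarith [mul_nonneg hl0 h5.le, mul_nonneg hA h5.le]
  -- These conditions keep the perturbed flow and control in the descent region, make the drop over
  -- the window exceed the error in `ψ` at `γs`, and exclude a collision where the reference has `ψ
  -- ≥ b`.
  obtain ⟨ε₀, hε₀, he1, he2, he3⟩ : ∃ ε₀ > 0, (C₁ + 1) * ε₀ ≤ ρ / 2 ∧ C₂ * ε₀ < S / 2 * δ ∧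
      C₂ * ε₀ < b := by
    set e := min (ρ / (2 * (C₁ + 1))) (min (S / 4 * δ) (b / 2) / (C₂ + 1)) with he
    have h5 : 0 < e := by positivity
    have h6 : (C₂ + 1) * e ≤ min (S / 4 * δ) (b / 2) := by
      calc _ ≤ (C₂ + 1) * (min (S / 4 * δ) (b / 2) / (C₂ + 1)) := by
            gcongr; exact min_le_right _ _
        _ = _ := by field_simp
    have h7 := h6.trans (min_le_left _ _)
    have h8 := h6.trans (min_le_right _ _)
    refine ⟨e, h5, ?_, ?_, ?_⟩
    · calc _ ≤ (C₁ + 1) * (ρ / (2 * (C₁ + 1))) := by gcongr; exact min_le_left _ _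
        _ = _ := by field_simp
    · nlinarith [mul_pos hS hδ]
    · nlinarith
  refine ⟨C₁ + 2 * C₂ / S + C₂ / K, ε₀, by positivity, hε₀, ?_⟩
  intro w ul ur ε hclose hε y hy hy0
  have hε0 : 0 ≤ ε := (norm_nonneg _).trans hclose.left
  have hdist : ∀ t ∈ Icc 0 P.T, ‖y t - ys t‖ ≤ C₁ * ε := fun t ht => by
    have := hB.flow_dist_le hclose.adm href.adm hy href.state.flow_left hclose.int
      (s := 0) ⟨le_rfl, hT⟩ ht
    rw [hy0, href.state.init, sub_self, norm_zero, zero_add] at this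
    rw [hC₁]; linarith
  have hψ : ∀ t ∈ Icc 0 P.T, |P.ψ (y t) - P.ψ (ys t)| ≤ C₂ * ε := fun t ht => by
    refine (hB.ψ_lip _ _).trans ?_
    rw [hC₂, mul_assoc]
    gcongr
    exact hdist t ht
  have hC₂ε : C₂ * ε ≤ C₂ * ε₀ := by gcongr
  have hstart : P.ψ (y γs) ≤ C₂ * ε := by
    have := (le_abs_self _).trans (hψ γs hγs')
    rwa [href.state.zero, sub_zero] at this
  have hdrop : ∀ t ∈ Icc γs (γs + δ), P.ψ (y t) ≤ C₂ * ε - S / 2 * (t - γs) := fun t ht => by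
    have := hdesc w y hclose.adm hy γs hγs' t ⟨hγs.1.le.trans ht.1, by linarith [ht.2]⟩ ht.1 ?_
    · linarith
    · intro τ hτ
      have hτT : τ ∈ Icc 0 P.T := ⟨hγs.1.le.trans hτ.1, by linarith [hτ.2, ht.2]⟩
      have habs : |τ - γs| ≤ δ := by
        rw [abs_of_nonneg (sub_nonneg.2 hτ.1)]; linarith [hτ.2, ht.2]
      have h1 := hdist τ hτT
      have h2 := hB.flow_lipschitz href.adm href.state.flow_left hyM hγs' hτT
      have h3 : l * |τ - γs| ≤ ρ / 2 := (by gcongr : _ ≤ l * δ).trans hδ3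
      have h4 : A * |τ - γs| ≤ ρ / 2 := (by gcongr : _ ≤ A * δ).trans hδ4
      have h5 : (C₁ + 1) * ε ≤ ρ / 2 := (by gcongr : _ ≤ (C₁ + 1) * ε₀).trans he1
      have h6 : 0 ≤ C₁ * ε := by positivity
      refine ⟨(norm_sub_le_norm_sub_add_norm_sub _ (ys τ) _).trans ?_, ?_⟩
      · linarith
      · exact (hclose.near τ).imp (fun h => h.trans (by linarith)) (fun h => h.trans (by linarith))
  have hend : P.ψ (y (γs + δ)) < 0 := by
    have := hdrop (γs + δ) ⟨by linarith, le_rfl⟩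
    rw [add_sub_cancel_left] at this
    linarith
  have hψc : Continuous P.ψ :=
    (LipschitzWith.of_dist_le_mul (K := B.toNNReal) fun x x' => by
      rw [Real.coe_toNNReal _ hBpos.le, Real.dist_eq, dist_eq_norm]
      exact hB.ψ_lip x' x).continuous
  have hstart0 : 0 < P.ψ (y 0) := by
    rw [hy0, ← href.state.init]
    exact href.state.pos_left 0 ⟨le_rfl, hγs.1⟩
  have hextra1 : 0 ≤ C₁ * ε := by positivity
  have hextra2 : 0 ≤ 2 * C₂ / S * ε := by positivity
  have hextra3 : 0 ≤ C₂ / K * ε := by positivity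
  refine ⟨fun t ht => (hdist t ht).trans (by linarith), ?_, ?_⟩
  · obtain ⟨γ, h1, h2, h3⟩ := exists_first_zero (f := fun t => P.ψ (y t))
      (hψc.comp hy.continuous) hstart0 (t₁ := γs + δ) (by linarith [hγs.1]) hend.le
    exact ⟨γ, ⟨h1.1, by linarith [h1.2]⟩, h2, h3⟩
  · intro γ hγ hzero hpos
    -- For an early collision, the reference value at `γ` is at least `min b (K (γs - γ))` but at
    -- most `C₂ * ε`. A late collision is limited by the descent, and beyond the window `ψ` would
    -- already have been negative.
    rw [abs_le]
    constructor
    · rcases le_or_gt γs γ with h | h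
      · linarith
      · have h1 := href.before γ ⟨hγ.1.le, h⟩
        have h2 := (neg_abs_le _).trans' (neg_le_neg (hψ γ (Ioo_subset_Icc_self hγ)))
        rw [hzero, zero_sub] at h2
        have h3 : K * (γs - γ) ≤ C₂ * ε := by
          rcases min_le_iff.1 h1 with h4 | h4
          · linarith
          · linarith
        have h4 : γs - γ ≤ C₂ / K * ε := by
          rw [div_mul_eq_mul_div, le_div_iff₀ hK]; linarith
        linarith
    · rcases le_or_gt γ γs with h | h
      · linarith
      · rcases le_or_gt γ (γs + δ) with h' | h'
        · have h1 := hdrop γ ⟨h.le, h'⟩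
          rw [hzero] at h1
          have h4 : γ - γs ≤ 2 * C₂ / S * ε := by
            rw [div_mul_eq_mul_div, le_div_iff₀ hS]; linarith
          linarith
        · have := hpos (γs + δ) ⟨by linarith [hγs.1], h'⟩
          linarith

/-- Existence of the state, and its Lipschitz dependence on the control. -/
theorem exists_state_estimates (hB : UniformBounds P N Bfu B)
    (href : IsReference P a b K S ws γs uls urs ys zs qs rs) {A : ℝ} (hA : 0 ≤ A) :
    ∃ C ε₀, 0 ≤ C ∧ 0 < ε₀ ∧ ∀ w ul ur ε, CloseControl P ws γs uls urs A w ul ur ε → ε ≤ ε₀ →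
      (∃ γ y z, IsStatePair P w γ y z) ∧ ∀ γ y z, IsStatePair P w γ y z → |γ - γs| ≤ C * ε ∧
        ∀ t ∈ Icc 0 P.T, ‖y t - ys t‖ ≤ C * ε ∧ ‖z t - zs t‖ ≤ C * ε := by
  have hT := hB.T_pos.le
  have hBpos := hB.pos
  have ha := href.a_pos
  have hγs := href.state.mem
  have hγs' := Ioo_subset_Icc_self hγs
  obtain ⟨M, hM0, hM⟩ := hB.exists_state_bound
  have hyM : ∀ t ∈ Icc 0 P.T, ‖ys t‖ ≤ M := fun t ht => (hM _ _ _ _ href.adm href.state t ht).1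
  have hzM : ∀ t ∈ Icc 0 P.T, ‖zs t‖ ≤ M := fun t ht => (hM _ _ _ _ href.adm href.state t ht).2
  set l := B * M + B with hl
  have hl0 : 0 ≤ l := by positivity
  obtain ⟨C₁, ε₁, hC₁, hε₁, hcoll⟩ := hB.exists_collision_estimates href hA
  -- The summands come from `g` applied to the two collision points, from moving `zs` between the
  -- two collision times, and from the `L¹` distance of the controls.
  set C₂ := (B * (C₁ + l * C₁) + l * C₁ + B) * Real.exp (B * P.T) with hC₂
  have hC₂0 : 0 ≤ C₂ := by positivity
  set D := B * C₂ + B * (l * C₁) with hD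
  have hD0 : 0 ≤ D := by positivity
  refine ⟨C₁ + C₂, min ε₁ (a / (2 * (D + 1))), by positivity, by positivity, ?_⟩
  intro w ul ur ε hclose hε
  have hε0 : 0 ≤ ε := (norm_nonneg _).trans hclose.left
  have hDε : D * ε < a := by
    have h1 : (D + 1) * ε ≤ a / 2 := by
      calc _ ≤ (D + 1) * (a / (2 * (D + 1))) := by gcongr; exact hε.trans (min_le_right _ _)
        _ = _ := by field_simp
    nlinarith
  have hcoll' := hcoll w ul ur ε hclose (hε.trans (min_le_left _ _))
  have hz : ∀ γ y z, IsFlow P w y → y 0 = P.x0 → IsFlow P w z → γ ∈ Ioo 0 P.T →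
      P.ψ (y γ) = 0 → z γ = P.g (y γ) → |γ - γs| ≤ C₁ * ε → ∀ t ∈ Icc 0 P.T,
      ‖z t - zs t‖ ≤ C₂ * ε := fun γ y z hy hy0 hz hγ hzero hjump hγd t ht => by
    have hγ' := Ioo_subset_Icc_self hγ
    have h1 : ‖y γ - ys γs‖ ≤ (C₁ + l * C₁) * ε := by
      refine (norm_sub_le_norm_sub_add_norm_sub _ (ys γ) _).trans ?_
      have h2 := (hcoll' y hy hy0).1 γ hγ'
      have h3 := hB.flow_lipschitz href.adm href.state.flow_left hyM hγs' hγ'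
      have h4 : l * |γ - γs| ≤ l * (C₁ * ε) := by gcongr
      linarith
    have h5 : ‖z γ - zs γ‖ ≤ (B * (C₁ + l * C₁) + l * C₁) * ε := by
      refine (norm_sub_le_norm_sub_add_norm_sub _ (zs γs) _).trans ?_
      have h2 := hB.g_lip _ (hB.zero_subset _ href.state.zero) _ (hB.zero_subset _ hzero)
      have h3 := hB.flow_lipschitz href.adm href.state.flow_right hzM hγ' hγs'
      have h4 : l * |γs - γ| ≤ l * (C₁ * ε) := by rw [abs_sub_comm]; gcongr
      have h6 : B * ‖y γ - ys γs‖ ≤ B * ((C₁ + l * C₁) * ε) := by gcongr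
      rw [hjump, href.state.jump]
      rw [href.state.jump] at h3
      linarith
    refine (hB.flow_dist_le hclose.adm href.adm hz href.state.flow_right hclose.int hγ' ht).trans ?_
    calc _ ≤ ((B * (C₁ + l * C₁) + l * C₁) * ε + B * ε) * Real.exp (B * P.T) := by gcongr
      _ = _ := by rw [hC₂]; ring
  constructor
  · obtain ⟨y, hy, hy0⟩ := hB.exists_flow hclose.adm 0 P.x0
    obtain ⟨hyd, ⟨γ, hγ, hzero, hpos⟩, huniq⟩ := hcoll' y hy hy0
    obtain ⟨z, hzf, hzγ⟩ := hB.exists_flow hclose.adm γ (P.g (y γ))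
    have hγd := huniq γ hγ hzero hpos
    have hzd := hz γ y z hy hy0 hzf hγ hzero hzγ hγd
    refine ⟨γ, y, z, hγ, hy, hzf, hy0, hzero, hpos, hzγ, fun t ht => ?_⟩
    have htT : t ∈ Icc 0 P.T := ⟨hγ.1.le.trans ht.1, ht.2⟩
    have h1 : |P.ψ (z t) - P.ψ (zs t)| ≤ B * (C₂ * ε) :=
      (hB.ψ_lip _ _).trans (by gcongr; exact hzd t htT)
    -- If the perturbed collision comes first, times in `[γ, γs)` are not covered by the lower bound
    -- `a`; there `zs` is compared with its value at `γs`.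
    have h2 : a - B * (l * (C₁ * ε)) ≤ P.ψ (zs t) := by
      rcases le_total γs t with h | h
      · exact (sub_le_self _ (by positivity)).trans (href.after t ⟨h, ht.2⟩)
      · have h3 := href.after γs ⟨le_rfl, hγs.2.le⟩
        have h4 : |P.ψ (zs t) - P.ψ (zs γs)| ≤ B * (l * (C₁ * ε)) := by
          refine (hB.ψ_lip _ _).trans ?_
          gcongr
          refine (hB.flow_lipschitz href.adm href.state.flow_right hzM hγs' htT).trans ?_
          gcongr
          refine le_trans ?_ hγd
          rw [abs_sub_comm, abs_sub_comm γ, abs_of_nonneg (sub_nonneg.2 h)]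
          exact (by linarith [ht.1] : γs - t ≤ γs - γ).trans (le_abs_self _)
        linarith [(abs_le.1 h4).1]
    have h5 := (abs_le.1 h1).1
    have h6 : D * ε = B * (C₂ * ε) + B * (l * (C₁ * ε)) := by rw [hD]; ring
    linarith
  · intro γ y z h
    have hγd := (hcoll' y h.flow_left h.init).2.2 γ h.mem h.zero h.pos_left
    have h1 : 0 ≤ C₁ * ε := by positivity
    have h2 : 0 ≤ C₂ * ε := by positivity
    refine ⟨by linarith, fun t ht => ⟨?_, ?_⟩⟩
    · linarith [(hcoll' y h.flow_left h.init).1 t ht]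
    · linarith [hz γ y z h.flow_left h.init h.flow_right h.mem h.zero h.jump hγd t ht]

end Reference

end UniformBounds

/-! ### The jump condition of the costate. -/

open Asymptotics

/-- The difference splits into two terms linear in the errors and one product of errors, which
boundedness of `e` makes `O(e)` as well. -/
theorem isBigO_bilinear_sub {ι X Y Z : Type*} [NormedAddCommGroup X] [NormedSpace ℝ X]
    [NormedAddCommGroup Y] [NormedSpace ℝ Y] [NormedAddCommGroup Z] [NormedSpace ℝ Z]
    {l : Filter ι} {e : ι → ℝ} (he : e =O[l] fun _ => (1 : ℝ)) (L : X →L[ℝ] Y →L[ℝ] Z)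
    {a : ι → X} {a₀ : X} {b : ι → Y} {b₀ : Y} (ha : (fun i => a i - a₀) =O[l] e)
    (hb : (fun i => b i - b₀) =O[l] e) : (fun i => L (a i) (b i) - L a₀ b₀) =O[l] e := by
  have h1 : (fun i => L (a i - a₀) (b i - b₀)) =O[l] e := by
    have h := ha.norm_left.mul (hb.norm_left.trans he)
    simp only [mul_one] at h
    refine (IsBigO.of_bound ‖L‖ (.of_forall fun i => ?_)).trans h
    rw [Real.norm_of_nonneg (by positivity), ← mul_assoc]
    exact L.le_opNorm₂ _ _
  have h2 : (fun i => L (a i - a₀) b₀) =O[l] e :=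
    ((L.flip b₀).isBigO_comp (fun i => a i - a₀) l).trans ha
  have h3 : (fun i => L a₀ (b i - b₀)) =O[l] e :=
    ((L a₀).isBigO_comp (fun i => b i - b₀) l).trans hb
  refine ((h1.add h2).add h3).congr_left fun i => ?_
  simp only [map_sub, sub_apply]
  abel

theorem isBigO_inner_sub {ι : Type*} {l : Filter ι} {e : ι → ℝ} (he : e =O[l] fun _ => (1 : ℝ))
    {a b : ι → E m} {a₀ b₀ : E m} (ha : (fun i => a i - a₀) =O[l] e)
    (hb : (fun i => b i - b₀) =O[l] e) : (fun i => ⟪a i, b i⟫ - ⟪a₀, b₀⟫) =O[l] e := by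
  exact isBigO_bilinear_sub he (innerSL ℝ) ha hb

theorem isBigO_apply_sub {ι : Type*} {l : Filter ι} {e : ι → ℝ} (he : e =O[l] fun _ => (1 : ℝ))
    {a : ι → E m →L[ℝ] E m} {b : ι → E m} {a₀ : E m →L[ℝ] E m} {b₀ : E m}
    (ha : (fun i => a i - a₀) =O[l] e) (hb : (fun i => b i - b₀) =O[l] e) :
    (fun i => a i (b i) - a₀ b₀) =O[l] e := by
  simpa using isBigO_bilinear_sub he (ContinuousLinearMap.id ℝ (E m →L[ℝ] E m)) ha hb

theorem isBigO_smul_sub {ι : Type*} {l : Filter ι} {e : ι → ℝ} (he : e =O[l] fun _ => (1 : ℝ))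
    {a : ι → ℝ} {b : ι → E m} {a₀ : ℝ} {b₀ : E m}
    (ha : (fun i => a i - a₀) =O[l] e) (hb : (fun i => b i - b₀) =O[l] e) :
    (fun i => a i • b i - a₀ • b₀) =O[l] e := by
  simpa using isBigO_bilinear_sub he (ContinuousLinearMap.lsmul ℝ ℝ) ha hb

namespace UniformBounds

variable {P : Problem m mu} {N : Set (E m)} {Bfu B : ℝ}

theorem isBigO_f_sub (hB : UniformBounds P N Bfu B) {ι : Type*} {l : Filter ι} {e : ι → ℝ}
    {x : ι → E m} {x₀ : E m} {u : ι → E mu} {u₀ : E mu} (hx : (fun i => x i - x₀) =O[l] e)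
    (hu : (fun i => u i - u₀) =O[l] e) (hmem : ∀ᶠ i in l, u i ∈ closure P.U)
    (hmem₀ : u₀ ∈ closure P.U) : (fun i => P.f (x i) (u i) - P.f x₀ u₀) =O[l] e := by
  have h1 := (hx.norm_left.const_mul_left B).add (hu.norm_left.const_mul_left B)
  refine (IsBigO.of_bound 1 ?_).trans h1
  filter_upwards [hmem] with i hi
  rw [one_mul]
  exact (hB.f_lip _ _ _ hmem₀ _ hi).trans (le_abs_self _)

theorem isBigO_L_sub (hB : UniformBounds P N Bfu B) {ι : Type*} {l : Filter ι} {e : ι → ℝ}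
    {x : ι → E m} {x₀ : E m} {u : ι → E mu} {u₀ : E mu} (hx : (fun i => x i - x₀) =O[l] e)
    (hu : (fun i => u i - u₀) =O[l] e) (hmem : ∀ᶠ i in l, u i ∈ closure P.U)
    (hmem₀ : u₀ ∈ closure P.U) : (fun i => P.L (x i) (u i) - P.L x₀ u₀) =O[l] e := by
  have h1 := (hx.norm_left.const_mul_left B).add (hu.norm_left.const_mul_left B)
  refine (IsBigO.of_bound 1 ?_).trans h1
  filter_upwards [hmem] with i hi
  rw [one_mul, Real.norm_eq_abs]
  exact (hB.L_lip _ _ _ hmem₀ _ hi).trans (le_abs_self _)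

/-- The costate before the collision depends in a Lipschitz way on the data of the jump. -/
theorem costateJump_isBigO (hB : UniformBounds P N Bfu B) {ι : Type*} {l : Filter ι} {e : ι → ℝ}
    (he : e =O[l] fun _ => (1 : ℝ)) {pm pp xm xp : ι → E m} {um up : ι → E mu}
    {pm₀ pp₀ xm₀ xp₀ : E m} {um₀ up₀ : E mu} {c : ℝ} (hc : 0 < c)
    (hjump : ∀ᶠ i in l, CostateJump P (pm i) (pp i) (xm i) (xp i) (um i) (up i))
    (hjump₀ : CostateJump P pm₀ pp₀ xm₀ xp₀ um₀ up₀)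
    (hzero : ∀ᶠ i in l, P.ψ (xm i) = 0) (hzero₀ : P.ψ xm₀ = 0)
    (hspeed : ∀ᶠ i in l, ⟪gradient P.ψ (xm i), P.f (xm i) (um i)⟫ ≤ -c)
    (humem : ∀ᶠ i in l, um i ∈ closure P.U) (humem₀ : um₀ ∈ closure P.U)
    (hupem : ∀ᶠ i in l, up i ∈ closure P.U) (hupem₀ : up₀ ∈ closure P.U)
    (hpp : (fun i => pp i - pp₀) =O[l] e) (hxm : (fun i => xm i - xm₀) =O[l] e)
    (hxp : (fun i => xp i - xp₀) =O[l] e) (hum : (fun i => um i - um₀) =O[l] e)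
    (hup : (fun i => up i - up₀) =O[l] e) : (fun i => pm i - pm₀) =O[l] e := by
  have hx₀ := hB.zero_subset _ hzero₀
  have hxN : ∀ᶠ i in l, xm i ∈ N := hzero.mono fun i hi => hB.zero_subset _ hi
  have hν : (fun i => gradient P.ψ (xm i) - gradient P.ψ xm₀) =O[l] e := by
    refine (IsBigO.of_bound B ?_).trans hxm
    filter_upwards [hxN] with i hi using hB.ψx_lip _ hx₀ _ hi
  have hG : (fun i => fderiv ℝ P.g (xm i) - fderiv ℝ P.g xm₀) =O[l] e := by
    refine (IsBigO.of_bound B ?_).trans hxm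
    filter_upwards [hxN] with i hi using hB.gx_lip _ hx₀ _ hi
  have hG' : (fun i => ContinuousLinearMap.adjoint (fderiv ℝ P.g (xm i))
      - ContinuousLinearMap.adjoint (fderiv ℝ P.g xm₀)) =O[l] e := by
    refine (IsBigO.of_bound 1 (.of_forall fun i => ?_)).trans hG
    rw [← map_sub, LinearIsometryEquiv.norm_map, one_mul]
  have hF := hB.isBigO_f_sub hxm hum humem humem₀
  have hFp := hB.isBigO_f_sub hxp hup hupem hupem₀
  have hD := isBigO_inner_sub he hν hF
  have hNum := (((isBigO_inner_sub he hpp (isBigO_apply_sub he hG hF)).sub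
    (isBigO_inner_sub he hpp hFp)).add (hB.isBigO_L_sub hxm hum humem humem₀)).sub
    (hB.isBigO_L_sub hxp hup hupem hupem₀)
  obtain ⟨η₀, hpm₀, heq₀⟩ := hjump₀
  -- The multiplier is chosen for every index, with default `0` where the jump condition fails, so
  -- that it becomes a function.
  have hex : ∀ i, ∃ η, CostateJump P (pm i) (pp i) (xm i) (xp i) (um i) (up i) →
      pm i = ContinuousLinearMap.adjoint (fderiv ℝ P.g (xm i)) (pp i) + η • gradient P.ψ (xm i) ∧
      ⟪pp i, fderiv ℝ P.g (xm i) (P.f (xm i) (um i))⟫ - ⟪pp i, P.f (xp i) (up i)⟫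
        + η * ⟪gradient P.ψ (xm i), P.f (xm i) (um i)⟫
        + P.L (xm i) (um i) - P.L (xp i) (up i) = 0 := fun i => by
    by_cases h : CostateJump P (pm i) (pp i) (xm i) (xp i) (um i) (up i)
    · obtain ⟨η, hη⟩ := h
      exact ⟨η, fun _ => hη⟩
    · exact ⟨0, fun h' => absurd h' h⟩
  choose η hη using hex
  -- Subtracting the two equations for the multipliers expresses `(η i - η₀) * Di` through `O(e)`
  -- terms, and `|Di| ≥ c` allows the division. No lower bound on `D₀` is needed.
  have hηO : (fun i => η i - η₀) =O[l] e := by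
    have h1 := hNum.norm_left.add (hD.norm_left.const_mul_left |η₀|)
    refine (IsBigO.of_bound c⁻¹ ?_).trans h1
    filter_upwards [hjump, hspeed] with i hi hs
    have h2 := (hη i hi).2
    set Di := ⟪gradient P.ψ (xm i), P.f (xm i) (um i)⟫
    set D₀ := ⟪gradient P.ψ xm₀, P.f xm₀ um₀⟫
    rw [inv_mul_eq_div, le_div_iff₀ hc]
    have h3 : c ≤ |Di| := by rw [abs_of_neg (by linarith)]; linarith
    have h4 : (η i - η₀) * Di = -(⟪pp i, fderiv ℝ P.g (xm i) (P.f (xm i) (um i))⟫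
        - ⟪pp₀, fderiv ℝ P.g xm₀ (P.f xm₀ um₀)⟫ -
        (⟪pp i, P.f (xp i) (up i)⟫ - ⟪pp₀, P.f xp₀ up₀⟫)
        + (P.L (xm i) (um i) - P.L xm₀ um₀) - (P.L (xp i) (up i) - P.L xp₀ up₀))
        - η₀ * (Di - D₀) := by linarith
    calc ‖η i - η₀‖ * c ≤ ‖η i - η₀‖ * |Di| := by gcongr
      _ = |(η i - η₀) * Di| := by rw [abs_mul, Real.norm_eq_abs]
      _ ≤ _ := by
        rw [h4]
        refine (abs_sub _ _).trans ?_
        rw [abs_neg, abs_mul]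
        exact le_abs_self _
  have hfin := (isBigO_apply_sub he hG' hpp).add (isBigO_smul_sub he hηO hν)
  refine hfin.congr' ?_ EventuallyEq.rfl
  filter_upwards [hjump] with i hi
  rw [(hη i hi).1, hpm₀]
  abel

/-- The second jump equation is affine in `η` with the normal speed as coefficient. -/
theorem exists_costateJump {pp xm xp : E m} {um up : E mu}
    (h : ⟪gradient P.ψ xm, P.f xm um⟫ ≠ 0) : ∃ pm, CostateJump P pm pp xm xp um up := by
  refine ⟨_, -(⟪pp, fderiv ℝ P.g xm (P.f xm um)⟫ - ⟪pp, P.f xp up⟫ + P.L xm um - P.L xp up)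
    / ⟪gradient P.ψ xm, P.f xm um⟫, rfl, ?_⟩
  rw [div_mul_cancel₀ _ h]
  ring

/-! ### Dependence of the costate on the control. -/

section Reference

variable {a b K S : ℝ} {ws : ℝ → E mu} {γs : ℝ} {uls urs : E mu} {ys zs qs rs : ℝ → E m}

/-- The data of a configuration close to a reference: state, costate and control limits. -/
structure JumpData (m mu : ℕ) where
  (pm pp xm xp : E m)
  (um up : E mu)
  (e : ℝ)

/-- Along the principal filter of the set of all admissible configurations, a big-O relation is an
inequality with one uniform constant. -/
theorem exists_costateJump_estimate (hB : UniformBounds P N Bfu B)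
    (href : IsReference P a b K S ws γs uls urs ys zs qs rs) : ∃ C, 0 ≤ C ∧
    ∀ (pm pp xm xp : E m) (um up : E mu) (e : ℝ), e ≤ 1 → um ∈ closure P.U → up ∈ closure P.U →
      P.ψ xm = 0 → ⟪gradient P.ψ xm, P.f xm um⟫ ≤ -(S / 2) →
      CostateJump P pm pp xm xp um up → ‖pp - rs γs‖ ≤ e → ‖xm - ys γs‖ ≤ e →
      ‖xp - zs γs‖ ≤ e → ‖um - uls‖ ≤ e → ‖up - urs‖ ≤ e → ‖pm - qs γs‖ ≤ C * e := by
  let s : Set (JumpData m mu) := {d | d.e ≤ 1 ∧ d.um ∈ closure P.U ∧ d.up ∈ closure P.U ∧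
    P.ψ d.xm = 0 ∧ ⟪gradient P.ψ d.xm, P.f d.xm d.um⟫ ≤ -(S / 2) ∧
    CostateJump P d.pm d.pp d.xm d.xp d.um d.up ∧ ‖d.pp - rs γs‖ ≤ d.e ∧ ‖d.xm - ys γs‖ ≤ d.e ∧
    ‖d.xp - zs γs‖ ≤ d.e ∧ ‖d.um - uls‖ ≤ d.e ∧ ‖d.up - urs‖ ≤ d.e}
  have hO : ∀ {V : Type} [NormedAddCommGroup V] (f : JumpData m mu → V), (∀ d ∈ s, ‖f d‖ ≤ d.e) →
      f =O[𝓟 s] fun d => d.e := fun f hf => by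
    refine IsBigO.of_bound 1 (eventually_principal.2 fun d hd => ?_)
    rw [one_mul]
    exact (hf d hd).trans (le_abs_self _)
  have key := hB.costateJump_isBigO (l := 𝓟 s) (e := fun d => d.e) (pm := fun d => d.pm)
    (pp := fun d => d.pp) (xm := fun d => d.xm) (xp := fun d => d.xp) (um := fun d => d.um)
    (up := fun d => d.up) (c := S / 2)
    (by
      refine IsBigO.of_bound 1 (eventually_principal.2 fun d hd => ?_)
      have : 0 ≤ d.e := (norm_nonneg _).trans hd.2.2.2.2.2.2.1
      simpa [abs_of_nonneg this] using hd.1)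
    (half_pos href.S_pos)
    (eventually_principal.2 fun d hd => hd.2.2.2.2.2.1) href.costate.jump
    (eventually_principal.2 fun d hd => hd.2.2.2.1) href.state.zero
    (eventually_principal.2 fun d hd => hd.2.2.2.2.1)
    (eventually_principal.2 fun d hd => hd.2.1) href.memL
    (eventually_principal.2 fun d hd => hd.2.2.1) href.memR
    (hO _ fun d hd => hd.2.2.2.2.2.2.1) (hO _ fun d hd => hd.2.2.2.2.2.2.2.1)
    (hO _ fun d hd => hd.2.2.2.2.2.2.2.2.1) (hO _ fun d hd => hd.2.2.2.2.2.2.2.2.2.1)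
    (hO _ fun d hd => hd.2.2.2.2.2.2.2.2.2.2)
  obtain ⟨C, hC⟩ := isBigO_principal.1 key
  refine ⟨|C|, abs_nonneg _, ?_⟩
  intro pm pp xm xp um up e h1 h2 h3 h4 h5 h6 h7 h8 h9 h10 h11
  have := hC ⟨pm, pp, xm, xp, um, up, e⟩ ⟨h1, h2, h3, h4, h5, h6, h7, h8, h9, h10, h11⟩
  have he : 0 ≤ e := (norm_nonneg _).trans h7
  refine this.trans ?_
  simp only [Real.norm_eq_abs, abs_of_nonneg he]
  gcongr
  exact le_abs_self _

/-- Costates are bounded as soon as the collision is transversal. -/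
theorem exists_costate_bound (hB : UniformBounds P N Bfu B) {c : ℝ} (hc : 0 < c) : ∃ M, 0 ≤ M ∧
    ∀ w γ ul ur y z q r, IsAdmissible P w → ul ∈ closure P.U → ur ∈ closure P.U →
      IsStatePair P w γ y z → ⟪gradient P.ψ (y γ), P.f (y γ) ul⟫ ≤ -c →
      IsCostatePair P w γ ul ur y z q r → ∀ t ∈ Icc 0 P.T, ‖q t‖ ≤ M ∧ ‖r t‖ ≤ M := by
  have hT := hB.T_pos.le
  have hBpos := hB.pos
  obtain ⟨Mx, hMx0, hMx⟩ := hB.exists_state_bound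
  set X := Real.exp (B * P.T) with hX
  set R₁ := (‖gradient P.φ 0‖ + B * Mx + B * P.T) * X with hR₁
  set F := B * Mx + B with hF
  obtain ⟨L, hL0, hL⟩ : ∃ L : ℝ, 0 ≤ L ∧ ∀ x u, ‖x‖ ≤ Mx → u ∈ closure P.U → |P.L x u| ≤ L := by
    rcases (closure P.U).eq_empty_or_nonempty with he | ⟨u₀, hu₀⟩
    · exact ⟨0, le_rfl, by simp [he]⟩
    · refine ⟨|P.L 0 u₀| + (B * Mx + B * B), by positivity, fun x u hx hu => ?_⟩
      have h1 := hB.L_lip 0 x u₀ hu₀ u hu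
      have h2 := abs_sub_abs_le_abs_sub (P.L x u) (P.L 0 u₀)
      have h3 : B * ‖x - 0‖ ≤ B * Mx := by rw [sub_zero]; gcongr
      have h4 : B * ‖u - u₀‖ ≤ B * B := by gcongr; exact hB.diam _ hu₀ _ hu
      linarith
  -- A bound for `|η|`: the remaining terms of the second jump equation, divided by the lower bound
  -- `c` on the normal speed. `R₁` bounds the costate after the collision.
  set H := (R₁ * (B * F) + R₁ * F + L + L) / c with hH
  set Q := (B * R₁ + H + B * P.T) * X with hQ
  have hX0 : 0 ≤ X := (Real.exp_pos _).le
  have hF0 : 0 ≤ F := by positivity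
  have hR₁0 : 0 ≤ R₁ := by positivity
  have hH0 : 0 ≤ H := by positivity
  have hQ0 : 0 ≤ Q := by positivity
  refine ⟨R₁ + Q, by positivity, ?_⟩
  intro w γ ul ur y z q r hw hul hur hst hspeed hco
  have hγ := Ioo_subset_Icc_self hst.mem
  have hr : ∀ t ∈ Icc 0 P.T, ‖r t‖ ≤ R₁ := fun t ht => by
    refine (hB.norm_coflow_le hw hco.coflow_right ⟨hT, le_rfl⟩ ht).trans ?_
    rw [hR₁, hco.terminal]
    gcongr
    have h1 := hB.φx_lip 0 (z P.T)
    have h2 := norm_sub_norm_le (gradient P.φ (z P.T)) (gradient P.φ 0)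
    have h3 := (hMx w γ y z hw hst P.T ⟨hT, le_rfl⟩).2
    have h4 : B * ‖z P.T - 0‖ ≤ B * Mx := by rw [sub_zero]; gcongr
    linarith
  have hyM := (hMx w γ y z hw hst γ hγ).1
  have hzM := (hMx w γ y z hw hst γ hγ).2
  have hf1 : ‖P.f (y γ) ul‖ ≤ F := (hB.norm_f_le _ hul).trans (by rw [hF]; gcongr)
  have hf2 : ‖P.f (z γ) ur‖ ≤ F := (hB.norm_f_le _ hur).trans (by rw [hF]; gcongr)
  have hg := hB.norm_fderiv_g_le (hB.zero_subset _ hst.zero)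
  have hqγ : ‖q γ‖ ≤ B * R₁ + H := by
    obtain ⟨η, hqη, heq⟩ := hco.jump
    have h1 : |⟪r γ, fderiv ℝ P.g (y γ) (P.f (y γ) ul)⟫| ≤ R₁ * (B * F) := by
      refine (abs_real_inner_le_norm _ _).trans ?_
      gcongr
      · exact hr γ hγ
      · exact (ContinuousLinearMap.le_opNorm _ _).trans (by gcongr)
    have h2 : |⟪r γ, P.f (z γ) ur⟫| ≤ R₁ * F := by
      refine (abs_real_inner_le_norm _ _).trans ?_
      gcongr
      exact hr γ hγ
    have h3 := hL _ _ hyM hul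
    have h4 := hL _ _ hzM hur
    have hη : |η| ≤ H := by
      rw [hH, le_div_iff₀ hc]
      have h5 : c ≤ |⟪gradient P.ψ (y γ), P.f (y γ) ul⟫| := by
        rw [abs_of_neg (by linarith)]; linarith
      calc |η| * c ≤ |η| * |⟪gradient P.ψ (y γ), P.f (y γ) ul⟫| := by gcongr
        _ = |η * ⟪gradient P.ψ (y γ), P.f (y γ) ul⟫| := (abs_mul _ _).symm
        _ ≤ _ := by
          rw [abs_le] at h1 h2 h3 h4 ⊢
          constructor <;> linarith [h1.1, h1.2, h2.1, h2.2, h3.1, h3.2, h4.1, h4.2]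
    rw [hqη]
    refine (norm_add_le _ _).trans (add_le_add ?_ ?_)
    · refine (ContinuousLinearMap.le_opNorm _ _).trans ?_
      rw [LinearIsometryEquiv.norm_map]
      gcongr
      exact hr γ hγ
    · rw [norm_smul, hB.unit_normal _ hst.zero, mul_one]
      exact hη
  intro t ht
  refine ⟨?_, (hr t ht).trans (by linarith)⟩
  refine (hB.norm_coflow_le hw hco.coflow_left hγ ht).trans ?_
  have : (‖q γ‖ + B * P.T) * X ≤ Q := by rw [hQ]; gcongr
  linarith

/-- Existence of the costate, and its Lipschitz dependence on the control. -/
theorem exists_costate_estimates (hB : UniformBounds P N Bfu B)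
    (href : IsReference P a b K S ws γs uls urs ys zs qs rs) {A : ℝ} (hA : 0 ≤ A) :
    ∃ C ε₀, 0 ≤ C ∧ 0 < ε₀ ∧ ∀ w ul ur ε, CloseControl P ws γs uls urs A w ul ur ε → ε ≤ ε₀ →
      (∃ γ y z, IsStatePair P w γ y z) ∧
      ∀ γ y z, IsStatePair P w γ y z →
        ⟪gradient P.ψ (y γ), P.f (y γ) ul⟫ ≤ -(S / 2) ∧
        (∃ q r, IsCostatePair P w γ ul ur y z q r) ∧
        ∀ q r, IsCostatePair P w γ ul ur y z q r → |γ - γs| ≤ C * ε ∧ ∀ t ∈ Icc 0 P.T,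
          ‖y t - ys t‖ ≤ C * ε ∧ ‖z t - zs t‖ ≤ C * ε ∧ ‖q t - qs t‖ ≤ C * ε ∧
          ‖r t - rs t‖ ≤ C * ε := by
  have hT := hB.T_pos.le
  have hBpos := hB.pos
  have hS := href.S_pos
  have hγs := href.state.mem
  have hγs' := Ioo_subset_Icc_self hγs
  obtain ⟨Mx, hMx0, hMx⟩ := hB.exists_state_bound
  obtain ⟨Mp, hMp0, hMp⟩ := hB.exists_costate_bound hS
  set M := Mx + Mp with hM
  have hyM : ∀ t ∈ Icc 0 P.T, ‖ys t‖ ≤ M := fun t ht =>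
    ((hMx _ _ _ _ href.adm href.state t ht).1).trans (by linarith)
  have hzM : ∀ t ∈ Icc 0 P.T, ‖zs t‖ ≤ M := fun t ht =>
    ((hMx _ _ _ _ href.adm href.state t ht).2).trans (by linarith)
  have hqrM : ∀ t ∈ Icc 0 P.T, ‖qs t‖ ≤ M ∧ ‖rs t‖ ≤ M := fun t ht => by
    have := hMp _ _ _ _ _ _ _ _ href.adm href.memL href.memR href.state href.speed_left
      href.costate t ht
    exact ⟨this.1.trans (by linarith), this.2.trans (by linarith)⟩
  set l := B * M + B with hl
  have hl0 : 0 ≤ l := by positivity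
  obtain ⟨C₁, ε₁, hC₁, hε₁, hstate⟩ := hB.exists_state_estimates href hA
  obtain ⟨D, hD0, hD⟩ := hB.exists_coflow_dist_le M
  obtain ⟨J, hJ0, hJ⟩ := hB.exists_costateJump_estimate href
  -- `C₂` compares states at the two different collision times, `C₃` the costates after the
  -- collision, `C₄` all arguments of the jump condition, and `C₅` the costates before it. `V`
  -- measures the loss of normal speed.
  set C₂ := C₁ + l * C₁ with hC₂
  have hC₂0 : 0 ≤ C₂ := by positivity
  set C₃ := D * (B * C₁ + C₁ + 1) with hC₃
  have hC₃0 : 0 ≤ C₃ := by positivity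
  set C₄ := C₂ + C₃ + l * C₁ + 1 with hC₄
  have hC₄0 : 0 ≤ C₄ := by positivity
  set C₅ := D * (J * C₄ + l * C₁ + C₁ + 1) with hC₅
  have hC₅0 : 0 ≤ C₅ := by positivity
  set V := B * C₂ * l + (B * C₂ + B) with hV
  have hV0 : 0 ≤ V := by positivity
  refine ⟨C₁ + C₃ + C₅, min ε₁ (min (1 / (C₄ + 1)) (S / (2 * (V + 1)))), by positivity,
    by positivity, ?_⟩
  intro w ul ur ε hclose hε
  have hε0 : 0 ≤ ε := (norm_nonneg _).trans hclose.left
  have hε1 : C₄ * ε ≤ 1 := by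
    have h1 : (C₄ + 1) * ε ≤ 1 := by
      calc _ ≤ (C₄ + 1) * (1 / (C₄ + 1)) := by
            gcongr; exact hε.trans ((min_le_right _ _).trans (min_le_left _ _))
        _ = _ := by field_simp
    linarith
  have hε2 : V * ε ≤ S / 2 := by
    have h1 : (V + 1) * ε ≤ S / 2 := by
      calc _ ≤ (V + 1) * (S / (2 * (V + 1))) := by
            gcongr; exact hε.trans ((min_le_right _ _).trans (min_le_right _ _))
        _ = _ := by field_simp
    linarith
  obtain ⟨hex, hall⟩ := hstate w ul ur ε hclose (hε.trans (min_le_left _ _))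
  refine ⟨hex, fun γ y z hst => ?_⟩
  obtain ⟨hγd, hyz⟩ := hall γ y z hst
  have hγ := Ioo_subset_Icc_self hst.mem
  have hlγ : l * |γ - γs| ≤ l * C₁ * ε := by rw [mul_assoc]; gcongr
  have hyγ : ‖y γ - ys γs‖ ≤ C₂ * ε := by
    refine (norm_sub_le_norm_sub_add_norm_sub _ (ys γ) _).trans ?_
    have h1 := hB.flow_lipschitz href.adm href.state.flow_left hyM hγs' hγ
    rw [hC₂, add_mul]
    exact add_le_add (hyz γ hγ).1 (h1.trans hlγ)
  have hzγ : ‖z γ - zs γs‖ ≤ C₂ * ε := by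
    refine (norm_sub_le_norm_sub_add_norm_sub _ (zs γ) _).trans ?_
    have h1 := hB.flow_lipschitz href.adm href.state.flow_right hzM hγs' hγ
    rw [hC₂, add_mul]
    exact add_le_add (hyz γ hγ).2 (h1.trans hlγ)
  have hyM' : ∀ t ∈ Icc 0 P.T, ‖y t‖ ≤ M := fun t ht =>
    ((hMx _ _ _ _ hclose.adm hst t ht).1).trans (by linarith)
  have hzM' : ∀ t ∈ Icc 0 P.T, ‖z t‖ ≤ M := fun t ht =>
    ((hMx _ _ _ _ hclose.adm hst t ht).2).trans (by linarith)
  have hspeed : ⟪gradient P.ψ (y γ), P.f (y γ) ul⟫ ≤ -(S / 2) := by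
    have h1 : ⟪gradient P.ψ (y γ) - gradient P.ψ (ys γs), P.f (y γ) ul⟫ ≤ B * C₂ * ε * l := by
      refine (real_inner_le_norm _ _).trans ?_
      gcongr
      · refine (hB.ψx_lip _ (hB.zero_subset _ href.state.zero) _
          (hB.zero_subset _ hst.zero)).trans ?_
        rw [mul_assoc]
        gcongr
      · refine (hB.norm_f_le _ hclose.memL).trans ?_
        rw [hl]
        gcongr
        exact hyM' γ hγ
    have h2 : ⟪gradient P.ψ (ys γs), P.f (y γ) ul - P.f (ys γs) uls⟫ ≤ B * (C₂ * ε) + B * ε := by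
      refine (real_inner_le_norm _ _).trans ?_
      rw [hB.unit_normal _ href.state.zero, one_mul]
      refine (hB.f_lip _ _ _ href.memL _ hclose.memL).trans ?_
      gcongr
      exact hclose.left
    rw [inner_sub_left] at h1
    rw [inner_sub_right] at h2
    have h3 := href.speed_left
    have h4 : V * ε = B * C₂ * ε * l + (B * (C₂ * ε) + B * ε) := by rw [hV]; ring
    linarith
  refine ⟨hspeed, ?_, fun q r hco => ?_⟩
  -- The construction runs backward: from the terminal condition to `r`, through the jump by
  -- transversality, then to `q` with its value prescribed at `γ`.
  · obtain ⟨r, hr, hrT⟩ := hB.exists_coflow hclose.adm hst.flow_right.continuous P.T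
      (gradient P.φ (z P.T))
    obtain ⟨pm, hpm⟩ := exists_costateJump (P := P) (pp := r γ) (xm := y γ) (xp := z γ) (um := ul)
      (up := ur) (by linarith)
    obtain ⟨q, hq, hqγ⟩ := hB.exists_coflow hclose.adm hst.flow_left.continuous γ pm
    exact ⟨q, r, hq, hr, hrT, by rw [hqγ]; exact hpm⟩
  · have hrd : ∀ t ∈ Icc 0 P.T, ‖r t - rs t‖ ≤ C₃ * ε := fun t ht => by
      refine (hD w ws z zs r rs hclose.adm href.adm hst.flow_right href.state.flow_right
        hco.coflow_right href.costate.coflow_right hzM' hzM (fun t ht => (hqrM t ht).2) (C₁ * ε) ε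
        (fun t ht => (hyz t ht).2) hclose.int P.T ⟨hT, le_rfl⟩ t ht).trans ?_
      rw [hco.terminal, href.costate.terminal]
      calc _ ≤ D * (B * (C₁ * ε) + C₁ * ε + ε) := by
            gcongr
            refine (hB.φx_lip _ _).trans ?_
            gcongr
            exact (hyz P.T ⟨hT, le_rfl⟩).2
        _ = _ := by rw [hC₃]; ring
    have hrγ : ‖r γ - rs γs‖ ≤ (C₃ + l * C₁) * ε := by
      refine (norm_sub_le_norm_sub_add_norm_sub _ (rs γ) _).trans ?_
      have h1 := hB.coflow_lipschitz href.adm href.costate.coflow_right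
        (fun t ht => (hqrM t ht).2) hγs' hγ
      rw [add_mul]
      exact add_le_add (hrd γ hγ) (h1.trans hlγ)
    have e1 : 0 ≤ C₂ * ε := by positivity
    have e2 : 0 ≤ C₃ * ε := by positivity
    have e3 : 0 ≤ l * C₁ * ε := by positivity
    have e4 : C₄ * ε = C₂ * ε + C₃ * ε + l * C₁ * ε + ε := by rw [hC₄]; ring
    have hqγ : ‖q γ - qs γs‖ ≤ J * (C₄ * ε) :=
      hJ _ _ _ _ _ _ _ hε1 hclose.memL hclose.memR hst.zero hspeed hco.jump
        (hrγ.trans (by linarith)) (hyγ.trans (by linarith)) (hzγ.trans (by linarith))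
        (hclose.left.trans (by linarith)) (hclose.right.trans (by linarith))
    have hqγ' : ‖q γ - qs γ‖ ≤ J * (C₄ * ε) + l * C₁ * ε := by
      refine (norm_sub_le_norm_sub_add_norm_sub _ (qs γs) _).trans ?_
      have h1 := hB.coflow_lipschitz href.adm href.costate.coflow_left
        (fun t ht => (hqrM t ht).1) hγs' hγ
      rw [norm_sub_rev] at h1
      exact add_le_add hqγ (h1.trans hlγ)
    have hqd : ∀ t ∈ Icc 0 P.T, ‖q t - qs t‖ ≤ C₅ * ε := fun t ht => by
      refine (hD w ws y ys q qs hclose.adm href.adm hst.flow_left href.state.flow_left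
        hco.coflow_left href.costate.coflow_left hyM' hyM (fun t ht => (hqrM t ht).1) (C₁ * ε) ε
        (fun t ht => (hyz t ht).1) hclose.int γ hγ t ht).trans ?_
      calc _ ≤ D * (J * (C₄ * ε) + l * C₁ * ε + C₁ * ε + ε) := by gcongr
        _ = _ := by rw [hC₅]; ring
    have e5 : 0 ≤ C₁ * ε := by positivity
    have e6 : 0 ≤ C₅ * ε := by positivity
    refine ⟨by linarith, fun t ht => ⟨?_, ?_, ?_, ?_⟩⟩
    · linarith [(hyz t ht).1]
    · linarith [(hyz t ht).2]
    · linarith [hqd t ht]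
    · linarith [hrd t ht]

end Reference

end UniformBounds

/-! ### From two-piece controls and the strong collision condition to the reference setting. -/

namespace UniformBounds

variable {P : Problem m mu} {N : Set (E m)} {Bfu B : ℝ}

theorem isAdmissible_glue {u : TwoPiece P.T mu} {R : ℝ≥0} {uL uR : ℝ → E mu}
    (h : u.IsExtension P.U R uL uR) : IsAdmissible P (TwoPiece.glue uL uR u.β) :=
  ⟨TwoPiece.measurable_glue h.lipL.continuous h.lipR.continuous _, h.glue_mem⟩

theorem ae_glue_eq {u : TwoPiece P.T mu} {R : ℝ≥0} {uL uR : ℝ → E mu}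
    (h : u.IsExtension P.U R uL uR) :
    ∀ᵐ t, t ∈ Icc 0 P.T → TwoPiece.glue uL uR u.β t = u t := by
  have hne : ∀ᵐ t : ℝ, t ≠ u.β := by simp [ae_iff, measure_singleton]
  filter_upwards [hne] with t ht hmem using h.glue_eq hmem ht

/-- Controls that are close in the semimetric are close in the integral sense. -/
theorem integral_glue_sub_le (hB : UniformBounds P N Bfu B) {u v : TwoPiece P.T mu} {R R' : ℝ≥0}
    {uL uR vL vR : ℝ → E mu} (hu : u.IsExtension P.U R uL uR) (hv : v.IsExtension P.U R' vL vR) :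
    ∫ t in 0..P.T, ‖TwoPiece.glue uL uR u.β t - TwoPiece.glue vL vR v.β t‖
      ≤ (P.T + B) * semidist u v := by
  have hint := hB.intervalIntegrable_norm_sub (isAdmissible_glue hu) (isAdmissible_glue hv)
  set d := semidist u v with hd
  have hd0 : 0 ≤ d := TwoPiece.semidist_nonneg u v
  set lo := min u.β v.β with hlo
  set hi := max u.β v.β with hhi
  have h0 : 0 < lo := lt_min u.β_mem.1 v.β_mem.1
  have hlohi : lo ≤ hi := min_le_max
  have h1 : hi < P.T := max_lt u.β_mem.2 v.β_mem.2
  have hdiff : hi - lo ≤ d := by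
    rw [hhi, hlo, max_sub_min_eq_abs', hd]
    exact TwoPiece.abs_sub_le_semidist u v
  have i1 : ∫ t in 0..lo, ‖TwoPiece.glue uL uR u.β t - TwoPiece.glue vL vR v.β t‖
      ≤ ∫ _ in 0..lo, d :=
    intervalIntegral.integral_mono_on_of_le_Ioo h0.le (hint _ _) intervalIntegrable_const
      fun t ht => by
        rw [TwoPiece.glue_of_lt (ht.2.trans_le (min_le_left _ _)),
          TwoPiece.glue_of_lt (ht.2.trans_le (min_le_right _ _))]
        exact hu.dist_left_le hv ⟨ht.1.le, ht.2.le⟩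
  -- Between the breakpoints the semimetric gives no information. The diameter bound `B` suffices
  -- because this interval has length at most `d`.
  have i2 : ∫ t in lo..hi, ‖TwoPiece.glue uL uR u.β t - TwoPiece.glue vL vR v.β t‖
      ≤ ∫ _ in lo..hi, B :=
    intervalIntegral.integral_mono_on_of_le_Ioo hlohi (hint _ _) intervalIntegrable_const
      fun t _ => hB.diam _ (hv.glue_mem t) _ (hu.glue_mem t)
  have i3 : ∫ t in hi..P.T, ‖TwoPiece.glue uL uR u.β t - TwoPiece.glue vL vR v.β t‖
      ≤ ∫ _ in hi..P.T, d :=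
    intervalIntegral.integral_mono_on_of_le_Ioo h1.le (hint _ _) intervalIntegrable_const
      fun t ht => by
        rw [TwoPiece.glue_of_le ((le_max_left _ _).trans ht.1.le),
          TwoPiece.glue_of_le ((le_max_right _ _).trans ht.1.le)]
        exact hu.dist_right_le hv ⟨ht.1.le, ht.2.le⟩
  rw [← intervalIntegral.integral_add_adjacent_intervals (hint 0 lo) (hint lo P.T),
    ← intervalIntegral.integral_add_adjacent_intervals (hint lo hi) (hint hi P.T)]
  simp only [intervalIntegral.integral_const, smul_eq_mul] at i1 i2 i3
  have hBpos := hB.pos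
  nlinarith [mul_le_mul_of_nonneg_right hdiff hBpos.le, mul_nonneg (sub_nonneg.2 hlohi) hd0]

/-- Each pair of pieces is compared at the earlier (left) or later (right) breakpoint, where the
semimetric still applies; the Lipschitz constants carry the estimate to the limits and to other
times. The terms `P.T + B` come from the `L¹` estimate. -/
theorem closeControl_of_extension (hB : UniformBounds P N Bfu B) {u v : TwoPiece P.T mu}
    {R R' : ℝ≥0} {uL uR vL vR : ℝ → E mu} (hu : u.IsExtension P.U R uL uR)
    (hv : v.IsExtension P.U R' vL vR) :
    CloseControl P (TwoPiece.glue vL vR v.β) v.β (vL v.β) (vR v.β) R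
      (TwoPiece.glue uL uR u.β) (uL u.β) (uR u.β) ((1 + 2 * R + R' + P.T + B) * semidist u v) := by
  have hT := hB.T_pos.le
  have hBpos := hB.pos
  set d := semidist u v with hd
  have hd0 : 0 ≤ d := TwoPiece.semidist_nonneg u v
  have hβ : |u.β - v.β| ≤ d := TwoPiece.abs_sub_le_semidist u v
  have e1 : 0 ≤ R * d := by positivity
  have e2 : 0 ≤ R' * d := by positivity
  have e3 : 0 ≤ P.T * d := by positivity
  have e4 : 0 ≤ B * d := by positivity
  have hL : ∀ t, ‖uL t - vL v.β‖ ≤ (1 + R + R') * d + R * |t - v.β| := fun t => by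
    have hlo : min u.β v.β ∈ Icc 0 (min u.β v.β) := ⟨(lt_min u.β_mem.1 v.β_mem.1).le, le_rfl⟩
    have h0 : |min u.β v.β - v.β| ≤ d := by
      refine le_trans ?_ hβ
      rcases le_total u.β v.β with h | h
      · rw [min_eq_left h]
      · rw [min_eq_right h]; simp
    set s := min u.β v.β
    have h1 : ‖uL t - uL s‖ ≤ R * (|t - v.β| + d) := by
      refine (hu.lipL.norm_sub_le _ _).trans ?_
      gcongr
      have := abs_sub_le t v.β s
      rw [abs_sub_comm v.β] at this
      rw [Real.norm_eq_abs]
      linarith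
    have h2 := hu.dist_left_le hv hlo
    have h3 : ‖vL s - vL v.β‖ ≤ R' * d := (hv.lipL.norm_sub_le _ _).trans (by gcongr; exact h0)
    have h4 := norm_sub_le_norm_sub_add_norm_sub (uL t) (uL s) (vL v.β)
    have h5 := norm_sub_le_norm_sub_add_norm_sub (uL s) (vL s) (vL v.β)
    linarith
  have hR : ∀ t, ‖uR t - vR v.β‖ ≤ (1 + R + R') * d + R * |t - v.β| := fun t => by
    have hhi : max u.β v.β ∈ Icc (max u.β v.β) P.T := ⟨le_rfl, (max_lt u.β_mem.2 v.β_mem.2).le⟩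
    have h0 : |max u.β v.β - v.β| ≤ d := by
      refine le_trans ?_ hβ
      rcases le_total u.β v.β with h | h
      · rw [max_eq_right h]; simp
      · rw [max_eq_left h]
    set s := max u.β v.β
    have h1 : ‖uR t - uR s‖ ≤ R * (|t - v.β| + d) := by
      refine (hu.lipR.norm_sub_le _ _).trans ?_
      gcongr
      have := abs_sub_le t v.β s
      rw [abs_sub_comm v.β] at this
      rw [Real.norm_eq_abs]
      linarith
    have h2 := hu.dist_right_le hv hhi
    have h3 : ‖vR s - vR v.β‖ ≤ R' * d := (hv.lipR.norm_sub_le _ _).trans (by gcongr; exact h0)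
    have h4 := norm_sub_le_norm_sub_add_norm_sub (uR t) (uR s) (vR v.β)
    have h5 := norm_sub_le_norm_sub_add_norm_sub (uR s) (vR s) (vR v.β)
    linarith
  have hRβ : R * |u.β - v.β| ≤ R * d := by gcongr
  refine ⟨isAdmissible_glue hu, hu.memL _, hu.memR _,
    (hB.integral_glue_sub_le hu hv).trans ?_, fun t => ?_, ?_, ?_⟩
  · linarith
  · rcases lt_or_ge t u.β with h | h
    · rw [TwoPiece.glue_of_lt h]
      exact Or.inl ((hL t).trans (by linarith))
    · rw [TwoPiece.glue_of_le h]
      exact Or.inr ((hR t).trans (by linarith))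
  · exact (hL u.β).trans (by linarith)
  · exact (hR u.β).trans (by linarith)

/-- Before `γ` the control agrees with the continuous `v`, so the integrand may be replaced by one
to which the fundamental theorem of calculus applies at `γ`. -/
theorem hasDerivWithinAt_flow_left (hB : UniformBounds P N Bfu B) {w v : ℝ → E mu} {y : ℝ → E m}
    (hy : IsFlow P w y) (hv : Continuous v) (hmem : ∀ t, v t ∈ closure P.U) {γ : ℝ}
    (hγ : γ ∈ Ioo 0 P.T) (hwv : ∀ t < γ, w t = v t) :
    HasDerivWithinAt y (P.f (y γ) (v γ)) (Iio γ) γ := by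
  have hT := hB.T_pos.le
  have hc : Continuous fun t => P.f (y t) (v t) :=
    hB.continuousOn_f.comp_continuous (f := fun t => (y t, v t)) (hy.continuous.prodMk hv)
      fun t => ⟨mem_univ _, hmem t⟩
  have hd : HasDerivAt (fun t => y γ + ∫ τ in γ..t, P.f (y τ) (v τ)) (P.f (y γ) (v γ)) γ :=
    (hc.integral_hasStrictDerivAt γ γ).hasDerivAt.const_add _
  refine hd.hasDerivWithinAt.congr_of_eventuallyEq ?_ (by simp)
  filter_upwards [Ioo_mem_nhdsLT hγ.1] with t ht
  have h1 := hy.prim.sub_eq (s := γ) (t := t) (Ioo_subset_Icc_self hγ)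
    ⟨ht.1.le, ht.2.le.trans hγ.2.le⟩
  have hne : ∀ᵐ t : ℝ, t ≠ γ := by simp [ae_iff, measure_singleton]
  have h2 : ∫ τ in γ..t, P.f (y τ) (w τ) = ∫ τ in γ..t, P.f (y τ) (v τ) := by
    refine intervalIntegral.integral_congr_ae ?_
    filter_upwards [hne] with τ hτ hmem
    rw [uIoc_of_ge ht.2.le] at hmem
    rw [hwv τ (lt_of_le_of_ne hmem.2 hτ)]
  rw [← h2, ← h1, add_sub_cancel]

/-- If `ψ` decreases to zero at least at rate `K` along a flow, the flow hits `{ψ = 0}` with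
normal speed at least `K`. -/
theorem inner_gradient_le_of_collision (hB : UniformBounds P N Bfu B) {w v : ℝ → E mu}
    {y : ℝ → E m} (hy : IsFlow P w y) (hv : Continuous v) (hmem : ∀ t, v t ∈ closure P.U) {γ b K : ℝ}
    (hγ : γ ∈ Ioo 0 P.T) (hwv : ∀ t < γ, w t = v t) (hzero : P.ψ (y γ) = 0) (hb : 0 < b)
    (hK : 0 < K) (h : ∀ t ∈ Ico 0 γ, min b (K * (γ - t)) ≤ P.ψ (y t)) :
    ⟪gradient P.ψ (y γ), P.f (y γ) (v γ)⟫ ≤ -K := by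
  have hN := hB.N_open.mem_nhds (hB.zero_subset _ hzero)
  have hdiff : DifferentiableAt ℝ P.ψ (y γ) :=
    (hB.ψ_contDiff.contDiffAt hN).differentiableAt (by norm_num)
  have h1 := hdiff.hasFDerivAt.comp_hasDerivWithinAt γ
    (hB.hasDerivWithinAt_flow_left hy hv hmem hγ hwv)
  rw [hasDerivWithinAt_iff_tendsto_slope' (by simp)] at h1
  rw [gradient, InnerProductSpace.toDual_symm_apply]
  -- For `t` within `b / K` of `γ` the minimum is `K (γ - t)`, so the left difference quotients of
  -- `ψ` along `y` are at most `-K`.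
  refine le_of_tendsto h1 ?_
  have hpos : max 0 (γ - b / K) < γ := max_lt hγ.1 (sub_lt_self _ (by positivity))
  filter_upwards [Ioo_mem_nhdsLT hpos] with t ht
  have ht0 : 0 < t := (le_max_left _ _).trans_lt ht.1
  have htb : γ - b / K < t := (le_max_right _ _).trans_lt ht.1
  have h2 := h t ⟨ht0.le, ht.2⟩
  have h3 : K * (γ - t) ≤ b := by
    have : γ - t < b / K := by linarith
    rw [lt_div_iff₀ hK] at this
    linarith
  rw [min_eq_right h3] at h2
  simp only [slope_def_field, Function.comp_apply, hzero, sub_zero]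
  rw [div_le_iff_of_neg (sub_neg.2 ht.2)]
  linarith

/-- An optimal solution with a strong collision is a reference solution. -/
theorem exists_isReference (hB : UniformBounds P N Bfu B) {ustar : TwoPiece P.T mu} {γ : ℝ}
    {xs ps : ℝ → E m} (hopt : IsOptimalSolution P ustar γ xs ps) {a b K S : ℝ}
    (hs : StrongCollision P Bfu ustar γ xs a b K S) {R : ℝ≥0} {uL uR : ℝ → E mu}
    (hu : ustar.IsExtension P.U R uL uR) :
    ∃ y z q r, IsReference P a b K S (TwoPiece.glue uL uR ustar.β) γ (uL γ) (uR γ) y z q r ∧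
      (∀ t ∈ Ico 0 γ, xs t = y t ∧ ps t = q t) ∧ ∀ t ∈ Ioc γ P.T, xs t = z t ∧ ps t = r t := by
  have hγβ := hopt.breakpoint
  have hadm := isAdmissible_glue hu
  obtain ⟨y, z, hst, hl, hr⟩ := hB.exists_statePair hadm (ae_glue_eq hu) hopt.state
  obtain ⟨q, r, hco, hl', hr'⟩ := hB.exists_costatePair hadm (ae_glue_eq hu) hst hl hr hopt.costate
  have hγ := hst.mem
  have hleft : ustar.left = uL γ := by rw [hu.left_eq, hγβ]
  have hright : ustar.right = uR γ := by rw [hu.right_eq, hγβ]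
  rw [hleft, hright] at hco
  have hbefore : ∀ t ∈ Ico 0 γ, min b (K * (γ - t)) ≤ P.ψ (y t) := fun t ht => by
    have htT : t ∈ Icc 0 P.T := ⟨ht.1, ht.2.le.trans hγ.2.le⟩
    rw [← hl t ht]
    rcases lt_or_ge t (γ - b / K) with h | h
    · exact (min_le_left _ _).trans (hs.far t htT h)
    · exact (min_le_right _ _).trans (hs.near t htT h ht.2)
  have hψc : Continuous P.ψ :=
    (LipschitzWith.of_dist_le_mul (K := B.toNNReal) fun x x' => by
      rw [Real.coe_toNNReal _ hB.pos.le, Real.dist_eq, dist_eq_norm]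
      exact hB.ψ_lip x' x).continuous
  have hafter : ∀ t ∈ Icc γ P.T, a ≤ P.ψ (z t) := fun t ht => by
    have hcl : closure (Ioc γ P.T) ⊆ {t | a ≤ P.ψ (z t)} :=
      closure_minimal (fun t ht => by
        have := hs.after t ⟨hγ.1.le.trans ht.1.le, ht.2⟩ ht.1
        rwa [hr t ht] at this)
        (isClosed_le continuous_const (hψc.comp hst.flow_right.continuous))
    rw [closure_Ioc hγ.2.ne] at hcl
    exact hcl ht
  have hspeed : ⟪gradient P.ψ (y γ), P.f (y γ) (uL γ)⟫ ≤ -K :=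
    hB.inner_gradient_le_of_collision hst.flow_left hu.lipL.continuous hu.memL hγ
      (fun t ht => TwoPiece.glue_of_lt (by rwa [hγβ])) hst.zero hs.b_pos hs.K_pos hbefore
  set J := jumpMagnitude ustar γ with hJ
  have hlim : Function.leftLim ustar.toFun γ = uL γ := by
    rw [← hleft, TwoPiece.left, hγβ]
  have hbdd : BddAbove ((fun s => ‖Function.leftLim ustar.toFun γ - ustar s‖) ''
      (Icc 0 P.T \ {γ})) := by
    refine ⟨B, ?_⟩
    rintro _ ⟨s, hs, rfl⟩
    rw [hlim]
    exact hB.diam _ (subset_closure (hopt.values s hs.1 (by rw [hγβ]; exact hs.2))) _ (hu.memL γ)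
  have hle : ∀ t ∈ Icc 0 P.T, t ≠ γ → ‖uL γ - ustar t‖ ≤ J := fun t ht hne => by
    rw [← hlim]
    exact le_csSup hbdd ⟨t, ⟨ht, hne⟩, rfl⟩
  have hJ0 : 0 ≤ J := (norm_nonneg _).trans (hle 0 ⟨le_rfl, hB.T_pos.le⟩ hγ.1.ne)
  have hLR : ‖uR γ - uL γ‖ ≤ J := by
    have hcl : closure (Ioc γ P.T) ⊆ {t | ‖uR t - uL γ‖ ≤ J} :=
      closure_minimal (fun t ht => by
        have := hle t ⟨hγ.1.le.trans ht.1.le, ht.2⟩ ht.1.ne'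
        rwa [hu.eqR t (by rw [hγβ]; exact ht), norm_sub_rev] at this)
        (isClosed_le (hu.lipR.continuous.sub continuous_const).norm continuous_const)
    rw [closure_Ioc hγ.2.ne] at hcl
    exact hcl ⟨le_rfl, hγ.2.le⟩
  have hmargin := hs.margin
  rw [← hJ] at hmargin
  -- The sign of `Bfu` is not prescribed. A negative value forces all of `closure P.U` to coincide
  -- with `uL γ`, and both sides vanish.
  have hBJ : 0 ≤ Bfu * J ∧ Bfu * ‖uR γ - uL γ‖ ≤ Bfu * J := by
    rcases le_or_gt 0 Bfu with h | h
    · exact ⟨mul_nonneg h hJ0, mul_le_mul_of_nonneg_left hLR h⟩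
    · have heq : ∀ v ∈ closure P.U, ‖uL γ - v‖ = 0 := fun v hv => by
        have h1 := (norm_nonneg _).trans (hB.f_lip_control 0 v hv _ (hu.memL γ))
        nlinarith [norm_nonneg (uL γ - v)]
      have hJ' : J = 0 := by
        refine le_antisymm (Real.sSup_nonpos ?_) hJ0
        rintro _ ⟨s, hs, rfl⟩
        rw [hlim]
        exact (heq _ (subset_closure (hopt.values s hs.1 (by rw [hγβ]; exact hs.2)))).le
      rw [norm_sub_rev, heq _ (hu.memR γ), hJ']
      simp
  -- The margin is used here: switching to the right limit raises the normal speed from at most `-K`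
  -- by at most `Bfu * J`, which leaves `-S`.
  have hright_speed : ⟪gradient P.ψ (y γ), P.f (y γ) (uR γ)⟫ ≤ -S := by
    have h1 : ⟪gradient P.ψ (y γ), P.f (y γ) (uR γ) - P.f (y γ) (uL γ)⟫ ≤ Bfu * J := by
      refine (real_inner_le_norm _ _).trans ?_
      rw [hB.unit_normal _ hst.zero, one_mul]
      exact (hB.f_lip_control _ _ (hu.memL γ) _ (hu.memR γ)).trans hBJ.2
    rw [inner_sub_right] at h1
    linarith
  exact ⟨y, z, q, r, ⟨hadm, hu.memL _, hu.memR _, hst, hco, hs.a_pos, hs.b_pos, hs.K_pos, hs.S_pos,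
    hbefore, hafter, by linarith [hBJ.1], hright_speed⟩, fun t ht => ⟨hl t ht, hl' t ht⟩,
    fun t ht => ⟨hr t ht, hr' t ht⟩⟩

/-! ### One step of the method. -/

/-- One step of the method from a control with Lipschitz pieces close to the reference can be
carried out, contracts the distance up to a constant, and keeps the Lipschitz bound. -/
theorem exists_step_estimates (hB : UniformBounds P N Bfu B) {ustar : TwoPiece P.T mu} {γ : ℝ}
    {xs ps : ℝ → E m} (hopt : IsOptimalSolution P ustar γ xs ps) {a b K S : ℝ}
    (hs : StrongCollision P Bfu ustar γ xs a b K S) (hmin : RegularMinimizer P) (R : ℝ≥0) :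
    ∃ R' : ℝ≥0, ∃ C₀ C₁ : ℝ, R ≤ R' ∧ 0 < C₀ ∧ 0 < C₁ ∧ ∀ u : TwoPiece P.T mu, u.IsLipschitz R' →
      TakesValuesIn u P.U → semidist u ustar ≤ C₀ → (∃ u', MSAStep P u u') ∧
      ∀ u', MSAStep P u u' → semidist u' ustar ≤ C₁ * semidist u ustar ∧ u'.IsLipschitz R' ∧
        TakesValuesIn u' P.U := by
  have hT := hB.T_pos.le
  have hBpos := hB.pos
  obtain ⟨h, Bh, hhmin, -, hhlip⟩ := hmin
  obtain ⟨Rs, hRs⟩ := ustar.exists_isLipschitz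
  obtain ⟨vL, vR, hv⟩ := hRs.exists_isExtension hopt.values
  obtain ⟨ys, zs, qs, rs, href, hsl, hsr⟩ := hB.exists_isReference hopt hs hv
  have hγβ := hopt.breakpoint
  have hh : ∀ x x' p p', ‖h x' p' - h x p‖ ≤ |Bh| * (‖x' - x‖ + ‖p' - p‖) := fun x x' p p' =>
    (hhlip x x' p p').trans (by gcongr; exact le_abs_self _)
  obtain ⟨Mx, hMx0, hMx⟩ := hB.exists_state_bound
  obtain ⟨Mp, hMp0, hMp⟩ := hB.exists_costate_bound (half_pos href.S_pos)
  -- A Lipschitz constant for `h` along every state and costate with normal speed at most `-S/2`. It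
  -- does not depend on the class `R'`, which can thus be fixed before `ε₀`, chosen in terms of
  -- `R'`.
  set R₀ : ℝ≥0 := (|Bh| * ((B * Mx + B) + (B * Mp + B))).toNNReal with hR₀
  set R' : ℝ≥0 := max R R₀ with hR'
  obtain ⟨C, ε₀, hC0, hε₀, hest⟩ := hB.exists_costate_estimates href (A := R') R'.2
  set c : ℝ := 1 + 2 * R' + Rs + P.T + B with hc
  have hc0 : 0 ≤ c := by positivity
  -- The factor `c` converts the semimetric into the closeness parameter. `C` accounts for the
  -- breakpoint and `2 * |Bh| * C` for state and costate inside `h`; the final `1` makes the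
  -- constant positive.
  refine ⟨R', ε₀ / (c + 1), (C + 2 * |Bh| * C) * c + 1, le_max_left _ _, by positivity,
    by positivity, fun u hlip hval hd => ?_⟩
  obtain ⟨uL, uR, hu⟩ := hlip.exists_isExtension hval
  have hd0 : 0 ≤ semidist u ustar := TwoPiece.semidist_nonneg _ _
  have hclose := hB.closeControl_of_extension hu hv
  rw [hγβ, ← hc] at hclose
  have hε : c * semidist u ustar ≤ ε₀ := by
    have h1 : (c + 1) * semidist u ustar ≤ ε₀ := by
      calc _ ≤ (c + 1) * (ε₀ / (c + 1)) := by gcongr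
        _ = _ := by field_simp
    linarith
  rw [hγβ] at href hest
  obtain ⟨hstex, hstall⟩ := hest _ _ _ _ hclose hε
  have hadm := hclose.adm
  have hcomp : ∀ {w : ℝ → E mu} {y q : ℝ → E m}, IsAdmissible P w → IsFlow P w y →
      (∀ t ∈ Icc 0 P.T, ‖y t‖ ≤ Mx) → IsCoflow P w y q → (∀ t ∈ Icc 0 P.T, ‖q t‖ ≤ Mp) →
      LipschitzOnWith R' (fun t => h (y t) (q t)) (Icc 0 P.T) := by
    intro w y q hw hy hyM hq hqM
    refine LipschitzOnWith.weaken (LipschitzOnWith.of_dist_le_mul fun s hs t ht => ?_)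
      (le_max_right R R₀)
    rw [hR₀, Real.coe_toNNReal _ (by positivity), dist_eq_norm, Real.dist_eq]
    refine (hh _ _ _ _).trans ?_
    have h1 := hB.flow_lipschitz hw hy hyM ht hs
    have h2 := hB.coflow_lipschitz hw hq hqM ht hs
    calc _ ≤ |Bh| * ((B * Mx + B) * |s - t| + (B * Mp + B) * |s - t|) := by gcongr
      _ = _ := by ring
  constructor
  · obtain ⟨γ', y, z, hst⟩ := hstex
    obtain ⟨hspeed, ⟨q, r, hco⟩, -⟩ := hstall γ' y z hst
    have hγ' := hst.mem
    have hM1 := hMx _ _ _ _ hadm hst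
    have hM2 := hMp _ _ _ _ _ _ _ _ hadm hclose.memL hclose.memR hst hspeed hco
    have hL := hcomp hadm hst.flow_left (fun t ht => (hM1 t ht).1) hco.coflow_left
      (fun t ht => (hM2 t ht).1)
    have hR := hcomp hadm hst.flow_right (fun t ht => (hM1 t ht).2) hco.coflow_right
      (fun t ht => (hM2 t ht).2)
    let u' : TwoPiece P.T mu :=
      { toFun := TwoPiece.glue (fun t => h (y t) (q t)) (fun t => h (z t) (r t)) γ'
        β := γ'
        β_mem := hγ'
        lip_left := ⟨R', fun s hs t ht => by
          rw [TwoPiece.glue_of_lt hs.2, TwoPiece.glue_of_lt ht.2]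
          exact hL ⟨hs.1, hs.2.le.trans hγ'.2.le⟩ ⟨ht.1, ht.2.le.trans hγ'.2.le⟩⟩
        lip_right := ⟨R', fun s hs t ht => by
          rw [TwoPiece.glue_of_le hs.1.le, TwoPiece.glue_of_le ht.1.le]
          exact hR ⟨hγ'.1.le.trans hs.1.le, hs.2⟩ ⟨hγ'.1.le.trans ht.1.le, ht.2⟩⟩ }
    rw [← hu.left_eq, ← hu.right_eq] at hco
    refine ⟨u', γ', _, _, isState_glue (ae_glue_eq hu) hst,
      hB.isCostate_glue hadm (ae_glue_eq hu) hst hco, rfl, fun t ht hne => ?_⟩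
    rw [hhmin, show u' t = TwoPiece.glue (fun t => h (y t) (q t)) (fun t => h (z t) (r t)) γ' t
      from rfl]
    rcases lt_or_gt_of_ne hne with hlt | hlt
    · rw [TwoPiece.glue_of_lt hlt, TwoPiece.glue_of_lt hlt, TwoPiece.glue_of_lt hlt]
    · rw [TwoPiece.glue_of_le hlt.le, TwoPiece.glue_of_le hlt.le, TwoPiece.glue_of_le hlt.le]
  · rintro u' ⟨γ', x, p, hx, hp, rfl, hum⟩
    obtain ⟨y, z, hst, hl, hr⟩ := hB.exists_statePair hadm (ae_glue_eq hu) hx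
    obtain ⟨q, r, hco, hl', hr'⟩ := hB.exists_costatePair hadm (ae_glue_eq hu) hst hl hr hp
    rw [hu.left_eq, hu.right_eq] at hco
    obtain ⟨hspeed, -, hall⟩ := hstall u'.β y z hst
    obtain ⟨hγd, hyz⟩ := hall q r hco
    have hγ' := hst.mem
    have hM1 := hMx _ _ _ _ hadm hst
    have hM2 := hMp _ _ _ _ _ _ _ _ hadm hclose.memL hclose.memR hst hspeed hco
    have hL := hcomp hadm hst.flow_left (fun t ht => (hM1 t ht).1) hco.coflow_left
      (fun t ht => (hM2 t ht).1)
    have hR := hcomp hadm hst.flow_right (fun t ht => (hM1 t ht).2) hco.coflow_right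
      (fun t ht => (hM2 t ht).2)
    have huL : ∀ t ∈ Ico 0 u'.β, u' t = h (y t) (q t) := fun t ht => by
      have := hum t ⟨ht.1, ht.2.le.trans hγ'.2.le⟩ ht.2.ne
      rwa [hhmin, hl t ht, hl' t ht] at this
    have huR : ∀ t ∈ Ioc u'.β P.T, u' t = h (z t) (r t) := fun t ht => by
      have := hum t ⟨hγ'.1.le.trans ht.1.le, ht.2⟩ ht.1.ne'
      rwa [hhmin, hr t ht, hr' t ht] at this
    have hγs := ustar.β_mem
    -- By uniqueness of the minimizer, `ustar` is `h` of the reference curves just as `u'` is `h` of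
    -- the perturbed ones, so their distance reduces to that of states and costates.
    have hsL : ∀ t ∈ Ico 0 ustar.β, ustar t = h (ys t) (qs t) := fun t ht => by
      have := hopt.minimal t ⟨ht.1, ht.2.le.trans hγs.2.le⟩ (by rw [← hγβ]; exact ht.2.ne)
      rw [hγβ] at ht
      rwa [hhmin, (hsl t ht).1, (hsl t ht).2] at this
    have hsR : ∀ t ∈ Ioc ustar.β P.T, ustar t = h (zs t) (rs t) := fun t ht => by
      have := hopt.minimal t ⟨hγs.1.le.trans ht.1.le, ht.2⟩ (by rw [← hγβ]; exact ht.1.ne')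
      rw [hγβ] at ht
      rwa [hhmin, (hsr t ht).1, (hsr t ht).2] at this
    have hfac : ∀ e ≤ C * (c * semidist u ustar) + 2 * |Bh| * C * (c * semidist u ustar),
        e ≤ ((C + 2 * |Bh| * C) * c + 1) * semidist u ustar := fun e he => by linarith
    have hp1 : 0 ≤ C * (c * semidist u ustar) := by positivity
    have hp2 : 0 ≤ 2 * |Bh| * C * (c * semidist u ustar) := by positivity
    have hp3 : 0 ≤ ((C + 2 * |Bh| * C) * c + 1) * semidist u ustar := by positivity
    refine ⟨max_le (max_le (normLinf_le hp3 fun t ht => hfac _ ?_)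
      (normLinf_le hp3 fun t ht => hfac _ ?_)) (hfac _ ?_), ⟨?_, ?_⟩, fun t ht hne => ?_⟩
    · have htT : t ∈ Icc 0 P.T := ⟨ht.1.le, (ht.2.trans_le (min_le_left _ _)).le.trans hγ'.2.le⟩
      rw [huL t ⟨ht.1.le, ht.2.trans_le (min_le_left _ _)⟩,
        hsL t ⟨ht.1.le, ht.2.trans_le (min_le_right _ _)⟩]
      obtain ⟨h1, -, h2, -⟩ := hyz t htT
      calc _ ≤ |Bh| * (C * (c * semidist u ustar) + C * (c * semidist u ustar)) :=
            (hh _ _ _ _).trans (by gcongr)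
        _ ≤ _ := by linarith
    · have htT : t ∈ Icc 0 P.T :=
        ⟨hγ'.1.le.trans ((le_max_left _ _).trans_lt ht.1).le, ht.2.le⟩
      rw [huR t ⟨(le_max_left _ _).trans_lt ht.1, ht.2.le⟩,
        hsR t ⟨(le_max_right _ _).trans_lt ht.1, ht.2.le⟩]
      obtain ⟨-, h1, -, h2⟩ := hyz t htT
      calc _ ≤ |Bh| * (C * (c * semidist u ustar) + C * (c * semidist u ustar)) :=
            (hh _ _ _ _).trans (by gcongr)
        _ ≤ _ := by linarith
    · rw [hγβ]
      linarith
    · intro s hs t ht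
      rw [huL s hs, huL t ht]
      exact hL ⟨hs.1, hs.2.le.trans hγ'.2.le⟩ ⟨ht.1, ht.2.le.trans hγ'.2.le⟩
    · intro s hs t ht
      rw [huR s hs, huR t ht]
      exact hR ⟨hγ'.1.le.trans hs.1.le, hs.2⟩ ⟨hγ'.1.le.trans ht.1.le, ht.2⟩
    · exact (hum t ht hne).1

end UniformBounds

/-! ### Contraction constants and convergence of the iteration. -/

variable {P : Problem m mu} {ustar : TwoPiece P.T mu} {K R C₀ C₀' C₁ : ℝ}

/-- The Lipschitz constant `R'` and admissibility pass from iterate to iterate, so the one-step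
estimate applies to each of them. The choice `C₀' = K / C₀` gives `K ≤ C₀ C₀'` with equality. -/
theorem exists_contractionConstants (hT : 0 < P.T) (hU : Bornology.IsBounded P.U) {γ : ℝ}
    {xs ps : ℝ → E m} (hopt : IsOptimalSolution P ustar γ xs ps) {Bfu a b S : ℝ}
    (hsmooth : Smoothness P Bfu) (hs : StrongCollision P Bfu ustar γ xs a b K S)
    (hmin : RegularMinimizer P) (R : ℝ) :
    ∃ C₀ C₀' C₁ : ℝ, ContractionConstants P ustar K R C₀ C₀' C₁ := by
  obtain ⟨N, B, hB⟩ := hsmooth.exists_uniformBounds hT hU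
  obtain ⟨R', C₀, C₁, hRR', hC₀, hC₁, hstep⟩ :=
    hB.exists_step_estimates hopt hs hmin R.toNNReal
  have hK := hs.K_pos
  refine ⟨C₀, K / C₀, C₁, hC₀, by positivity, hC₁, (mul_div_cancel₀ _ hC₀.ne').ge, ?_⟩
  intro k u hgood hiter hclose
  have hinv : ∀ i ≤ k, (u i).IsLipschitz R' ∧ TakesValuesIn (u i) P.U := fun i => by
    induction i with
    | zero =>
      exact fun _ => ⟨(TwoPiece.isLipschitz_of_derivBound_le hgood.deriv_le).mono hRR', hgood.values⟩
    | succ i ih =>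
      intro hi
      obtain ⟨h1, h2⟩ := ih (by omega)
      exact ((hstep (u i) h1 h2 (hclose i (by omega))).2 (u (i + 1)) (hiter i (by omega))).2
  obtain ⟨h1, h2⟩ := hinv k le_rfl
  obtain ⟨h3, h4⟩ := hstep (u k) h1 h2 (hclose k le_rfl)
  exact ⟨h3, fun u' hu' => (h4 u' hu').1⟩

namespace ContractionConstants

theorem semidist_le_of_goodGuess (h : ContractionConstants P ustar K R C₀ C₀' C₁) (hK : 0 < K)
    {u₀ : TwoPiece P.T mu} (hu₀ : GoodGuess P ustar K R C₀' u₀) : semidist u₀ ustar ≤ C₀ := by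
  have h1 : 0 ≤ derivBound u₀ := (normLinf_nonneg _ _ _).trans (le_max_left _ _)
  have h2 := h.C₀'_pos
  refine hu₀.close.trans ((div_le_div_of_nonneg_left hK.le h2 (by linarith)).trans ?_)
  rw [div_le_iff₀ h2]
  exact h.K_le

/-- Iterates that start at a good guess stay close to the reference. -/
theorem semidist_le_of_iterates (h : ContractionConstants P ustar K R C₀ C₀' C₁) (hK : 0 < K)
    (hC₁ : C₁ < 1) {u : ℕ → TwoPiece P.T mu} (hu₀ : GoodGuess P ustar K R C₀' (u 0)) (k : ℕ)
    (hiter : ∀ i < k, MSAStep P (u i) (u (i + 1))) : ∀ i ≤ k, semidist (u i) ustar ≤ C₀ := by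
  induction k with
  | zero =>
    intro i hi
    rw [Nat.le_zero.1 hi]
    exact h.semidist_le_of_goodGuess hK hu₀
  | succ k ih =>
    have hk := ih fun i hi => hiter i (by omega)
    intro i hi
    rcases Nat.lt_or_ge i (k + 1) with hlt | hge
    · exact hk i (by omega)
    · obtain rfl : i = k + 1 := by omega
      have h1 := (h.contract k u hu₀ (fun i hi => hiter i (by omega)) hk).2 _ (hiter k (by omega))
      have h2 := hk k le_rfl
      have h3 := TwoPiece.semidist_nonneg (u k) ustar
      exact h1.trans ((mul_le_of_le_one_left h3 hC₁.le).trans h2)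

theorem exists_iterates (h : ContractionConstants P ustar K R C₀ C₀' C₁) (hK : 0 < K)
    (hC₁ : C₁ < 1) {u₀ : TwoPiece P.T mu} (hu₀ : GoodGuess P ustar K R C₀' u₀) :
    ∃ u : ℕ → TwoPiece P.T mu, u 0 = u₀ ∧ ∀ k, MSAStep P (u k) (u (k + 1)) := by
  -- A total successor function, with `v` itself as default where no step exists. Strong induction
  -- shows that the default is never reached: a step at `k` requires all earlier transitions to be
  -- genuine steps.
  have hex : ∀ v : TwoPiece P.T mu, ∃ v', (∃ v'', MSAStep P v v'') → MSAStep P v v' := fun v => by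
    by_cases hv : ∃ v'', MSAStep P v v''
    · exact ⟨hv.choose, fun _ => hv.choose_spec⟩
    · exact ⟨v, fun h => absurd h hv⟩
  choose next hnext using hex
  refine ⟨fun k => next^[k] u₀, rfl, fun k => ?_⟩
  induction k using Nat.strong_induction_on with
  | _ k ih =>
    simp only [Function.iterate_succ_apply']
    simp only [Function.iterate_succ_apply'] at ih
    refine hnext _ (h.contract k (fun k => next^[k] u₀) hu₀ ?_ ?_).1
    · intro i hi
      simp only [Function.iterate_succ_apply']
      exact ih i hi
    · refine h.semidist_le_of_iterates hK hC₁ hu₀ k fun i hi => ?_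
      simp only [Function.iterate_succ_apply']
      exact ih i hi

theorem semidist_succ_le (h : ContractionConstants P ustar K R C₀ C₀' C₁) (hK : 0 < K)
    (hC₁ : C₁ < 1) {u : ℕ → TwoPiece P.T mu} (hu₀ : GoodGuess P ustar K R C₀' (u 0))
    (hiter : ∀ k, MSAStep P (u k) (u (k + 1))) (k : ℕ) :
    semidist (u (k + 1)) ustar ≤ C₁ * semidist (u k) ustar :=
  (h.contract k u hu₀ (fun i _ => hiter i)
    (h.semidist_le_of_iterates hK hC₁ hu₀ k fun i _ => hiter i)).2 _ (hiter k)

theorem tendsto_semidist (h : ContractionConstants P ustar K R C₀ C₀' C₁) (hK : 0 < K)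
    (hC₁ : C₁ < 1) {u : ℕ → TwoPiece P.T mu} (hu₀ : GoodGuess P ustar K R C₀' (u 0))
    (hiter : ∀ k, MSAStep P (u k) (u (k + 1))) :
    Tendsto (fun k => semidist (u k) ustar) atTop (𝓝 0) := by
  have hgeom : ∀ k, semidist (u k) ustar ≤ C₁ ^ k * semidist (u 0) ustar := fun k => by
    induction k with
    | zero => simp
    | succ k ih =>
      refine (h.semidist_succ_le hK hC₁ hu₀ hiter k).trans ?_
      rw [pow_succ', mul_assoc]
      exact mul_le_mul_of_nonneg_left ih h.C₁_pos.le
  have hlim := (tendsto_pow_atTop_nhds_zero_of_lt_one h.C₁_pos.le hC₁).mul_const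
    (semidist (u 0) ustar)
  rw [zero_mul] at hlim
  exact squeeze_zero (fun k => TwoPiece.semidist_nonneg _ _) hgeom hlim

end ContractionConstants

end HybridMSA

end

theorem theorem4p6 {m mu : ℕ} (P : HybridMSA.Problem m mu) (hT : 0 < P.T)
    (hU : Bornology.IsBounded P.U)
    (ustar : HybridMSA.TwoPiece P.T mu) (γ : ℝ) (xstar pstar : ℝ → HybridMSA.E m)
    (hopt : HybridMSA.IsOptimalSolution P ustar γ xstar pstar)
    (Bfu : ℝ) (hsmooth : HybridMSA.Smoothness P Bfu)
    (a b K S : ℝ) (hstrong : HybridMSA.StrongCollision P Bfu ustar γ xstar a b K S)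
    (hmin : HybridMSA.RegularMinimizer P)
    (R : ℝ) (hR : 0 ≤ R) :
    (∃ C₀ C₀' C₁ : ℝ, HybridMSA.ContractionConstants P ustar K R C₀ C₀' C₁) ∧
    ∀ C₀ C₀' C₁ : ℝ, HybridMSA.ContractionConstants P ustar K R C₀ C₀' C₁ → C₁ < 1 →
      ∀ u₀ : HybridMSA.TwoPiece P.T mu, HybridMSA.GoodGuess P ustar K R C₀' u₀ →
        (∃ u : ℕ → HybridMSA.TwoPiece P.T mu,
          u 0 = u₀ ∧ ∀ k, HybridMSA.MSAStep P (u k) (u (k + 1))) ∧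
        ∀ u : ℕ → HybridMSA.TwoPiece P.T mu,
          u 0 = u₀ → (∀ k, HybridMSA.MSAStep P (u k) (u (k + 1))) →
          (∀ k, HybridMSA.semidist (u (k + 1)) ustar ≤ C₁ * HybridMSA.semidist (u k) ustar) ∧
          Tendsto (fun k => HybridMSA.semidist (u k) ustar) atTop (𝓝 0) := by
  have hK := hstrong.K_pos
  refine ⟨HybridMSA.exists_contractionConstants hT hU hopt hsmooth hstrong hmin R,
    fun C₀ C₀' C₁ h hC₁ u₀ hu₀ => ⟨h.exists_iterates hK hC₁ hu₀, ?_⟩⟩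
  rintro u rfl hiter
  exact ⟨h.semidist_succ_le hK hC₁ hu₀ hiter, h.tendsto_semidist hK hC₁ hu₀ hiter⟩
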